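/- Let $(\mathcal F_t)_{t\ge 0}$ be a filtration on a probability space $(\Omega,\mathcal A,\mathbb P)$, let $\mathcal F_\infty=\sigma(\bigcup_{t\ge0}\mathcal F_t)$, and let $(W_n)$ be a sequence of real random variables in $L^1$ that are $\mathcal F_\infty$-measurable (up to null sets). Let $(v(n))$ be a sequence of nonzero real numbers. Assume that for every $n$ the martingale $W_{n,t}=\mathbb E[W_n\mid\mathcal F_t]$, $t\ge0$, has a modification that is continuous in $t$, and let $\langle W_n\rangle$ be its quadratic variation, i.e. the a.s. continuous, nondecreasing process, null at time $0$ and adapted to the completed filtration, for which $W_{n,t}^2-\langle W_n\rangle_t$ is a local martingale; put $\langle W_n\rangle_\infty=\lim_{t\to\infty}\langle W_n\rangle_t$. Let $Z$ be a nonnegative random variable and assume that, in probability as $n\to\infty$, $$\frac{\langle W_n\rangle_\infty}{v(n)^2}\to Z,\qquad \frac{\langle W_n\rangle_t}{v(n)^2}\to 0\ \text{ for every fixed } t\ge 0,\qquad \frac{W_{n,0}}{v(n)}\to 0 .$$ Then: (a) for every bounded $\mathcal F_\infty$-measurable (complex-valued) $H$ and every $\xi\in\mathbb R$, $$\lim_{n\to\infty}\mathbb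 E\left[H e^{i\xi W_n/v(n)}\right]=\mathbb E\left[H e^{-\xi^2Z/2}\right];$$ (b) equivalently, for every $\mathcal F_\infty$-measurable random variable $Y$ with values in a Polish space, $(Y,W_n/v(n))$ converges in law to $(Y,\sqrt Z\,\mathcal N)$, where $\mathcal N$ is a standard Gaussian variable independent of $(Y,Z)$. -/

import Mathlib

open MeasureTheory ProbabilityTheory Filter Topology
open scoped NNReal

universe u w

namespace RandomVarianceCLT

variable {Ω : Type*} {mΩ : MeasurableSpace Ω}

/-- The `P`-completion of a filtration: the events at time `t` are the events of the ambient
probability space that coincide, up to a `P`-null set, with an element of `𝓕 t`. If `𝓕 0`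
already contains all `P`-null events, this is `𝓕` itself. -/
def completion (𝓕 : Filtration ℝ≥0 mΩ) (P : Measure Ω) : Filtration ℝ≥0 mΩ where
  seq t := eventuallyMeasurableSpace (𝓕 t) (ae P) ⊓ mΩ
  mono' s t hst := by
    refine inf_le_inf_right _ ?_
    rintro A ⟨B, hB, hAB⟩
    exact ⟨B, 𝓕.mono hst B hB, hAB⟩
  le' _ := inf_le_right

/-- `X` is a local martingale: there are stopping times `τ k`, almost surely nondecreasing in `k`
with limit `∞`, such that each stopped process `1_{τ k > 0} X_{t ∧ τ k}` is a martingale. -/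
def IsLocalMartingale (X : ℝ≥0 → Ω → ℝ) (𝓕 : Filtration ℝ≥0 mΩ) (P : Measure Ω) : Prop :=
  Locally (fun Y => Martingale Y 𝓕 P) 𝓕 X P

/-- `A` is (a version of) the quadratic variation `⟨M⟩` of the continuous martingale `M`: it is
adapted, almost surely continuous, nondecreasing and null at time `0`, and `M² - A` is a local
martingale. -/
structure IsQuadraticVariation (M A : ℝ≥0 → Ω → ℝ) (𝓕 : Filtration ℝ≥0 mΩ)
    (P : Measure Ω) : Prop where
  adapted : StronglyAdapted 𝓕 A
  continuous_paths : ∀ᵐ ω ∂P, Continuous (fun t => A t ω)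
  monotone_paths : ∀ᵐ ω ∂P, Monotone (fun t => A t ω)
  zero_at_zero : ∀ᵐ ω ∂P, A 0 ω = 0
  isLocalMartingale : IsLocalMartingale (fun t ω => M t ω ^ 2 - A t ω) 𝓕 P

/-- The value at infinity `A_∞ = lim_{t → ∞} A_t = sup_t A_t` of a nondecreasing process. For the
quadratic variation of a continuous martingale `E[W | 𝓕 t]` with `W ∈ L¹`, the supremum is almost
surely finite, so that the value `0` given to infinite suprema plays no role. -/
noncomputable def valueAtInfinity (A : ℝ≥0 → Ω → ℝ) (ω : Ω) : ℝ := ⨆ t, A t ω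

end RandomVarianceCLT

/-! Write `X n` for `W n / v n`, and `M n`, `A n` for the normalized martingale and its bracket. As
long as `A` is bounded, `E t = exp (i ξ M t + ξ² A t / 2)` is a martingale. At a late time `T` it is
close to `exp (i ξ X + ξ² Z / 2)`, so with `G = H exp (-ξ² Z / 2)` the integral of `G * E T` is
close to that of `H exp (i ξ X)`. At a fixed time `m` it is close to `1` in `L¹`, because `A m` and
`M 0` are negligible. If `G` were known at time `m`, the martingale property would give `∫ G * E T =
∫ G * E m`, which tends to `∫ G`, as claimed. In general `Z` is `𝓕_∞`-measurable up to null sets,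
being a limit of brackets, so `G` is approximated in `L¹` by its conditional expectations given time
`m`. The error is harmless because `|E|` is at most `exp (ξ² (K + 1) / 2)` after stopping `A` at `K
+ 1`. This suffices when `H` vanishes on `Z > K`, a restriction removed at the end by letting `K`
grow. The estimate is `eventually_norm_integral_sub_le`, the approximation
`tendsto_integral_of_vanishing`.

The martingale property `BoundedPair.integral_mul_expProc` is proved without stochastic integrals.
On each interval of a subdivision the expansion of `E` to second order integrates to zero, since `M`
and `M² - A` are martingales. The third order remainders add up to at most a constant times the
largest increment times the sum of squared increments; the latter is bounded in `L²`, the former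
tends to zero. Boundedness comes from stopping (`martingale_stoppedProcess`,
`ContinuousPair.exists_boundedPair`); the bound on `M` may depend on `n`, only the bound on `A` must
be uniform.

For (b), conditioning on `Y ∈ B` turns (a) with `H = 1_{Y ∈ B}` into convergence of characteristic
functions, and rectangles `B ×ˢ J` with `J` a continuity set determine the joint convergence
(`tendstoInDistribution_prodMk`). -/

namespace RandomVarianceCLT

/-! ### Optional stopping for continuous martingales. -/

section OptionalStopping

variable {Ω : Type*} {mΩ : MeasurableSpace Ω} {P : Measure Ω} {𝓖 : Filtration ℝ≥0 mΩ}

/-- The smallest multiple of `1 / (m + 1)` above `x`, capped at `t`. -/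
noncomputable def gridCeil (t : ℝ≥0) (m : ℕ) (x : ℝ≥0) : ℝ≥0 :=
  min t (⌈(m + 1 : ℝ≥0) * x⌉₊ / (m + 1))

lemma le_gridCeil {t x : ℝ≥0} (hx : x ≤ t) (m : ℕ) : x ≤ gridCeil t m x := by
  refine le_min hx ?_
  rw [le_div_iff₀ (by positivity), mul_comm]
  exact Nat.le_ceil _

lemma gridCeil_le (t : ℝ≥0) (m : ℕ) (x : ℝ≥0) : gridCeil t m x ≤ t := min_le_left _ _

lemma tendsto_gridCeil {t x : ℝ≥0} (hx : x ≤ t) :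
    Tendsto (fun m => gridCeil t m x) atTop (𝓝 x) := by
  have h : Tendsto (fun m : ℕ => x + 1 / ((m : ℝ≥0) + 1)) atTop (𝓝 (x + 0)) :=
    tendsto_const_nhds.add tendsto_one_div_add_atTop_nhds_zero_nat
  rw [add_zero] at h
  refine tendsto_of_tendsto_of_tendsto_of_le_of_le tendsto_const_nhds h
    (fun m => le_gridCeil hx m) fun m => (min_le_right _ _).trans ?_
  have e : (x + 1 / ((m : ℝ≥0) + 1)) * (m + 1) = (m + 1) * x + 1 := by field_simp
  rw [div_le_iff₀ (by positivity), e]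
  exact (Nat.ceil_lt_add_one (by positivity)).le

/-- The right side compares `x` with the last grid point before `u`, so rounding a stopping time up
again gives a stopping time. The cap plays no role below `t`. -/
lemma gridCeil_le_iff {t u x : ℝ≥0} (hu : u < t) (m : ℕ) :
    gridCeil t m x ≤ u ↔ x ≤ (⌊(m + 1 : ℝ≥0) * u⌋₊ : ℝ≥0) / (m + 1) := by
  rw [gridCeil, min_le_iff, or_iff_right hu.not_ge, div_le_iff₀ (by positivity),
    le_div_iff₀ (by positivity), mul_comm u, ← Nat.le_floor_iff (by positivity), Nat.ceil_le,
    mul_comm x]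

lemma countable_range_gridCeil (t : ℝ≥0) (m : ℕ) : (Set.range (gridCeil t m)).Countable := by
  refine (Set.countable_range fun k : ℕ => min t ((k : ℝ≥0) / (m + 1))).mono ?_
  rintro _ ⟨x, rfl⟩
  exact ⟨_, rfl⟩

/-- The value of a stopping time truncated at `t`, as a nonnegative real number. -/
noncomputable def truncTime (τ : Ω → WithTop ℝ≥0) (t : ℝ≥0) (ω : Ω) : ℝ≥0 :=
  (min (t : WithTop ℝ≥0) (τ ω)).untopA

lemma coe_truncTime (τ : Ω → WithTop ℝ≥0) (t : ℝ≥0) (ω : Ω) :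
    (truncTime τ t ω : WithTop ℝ≥0) = min (t : WithTop ℝ≥0) (τ ω) := by
  unfold truncTime
  rw [WithTop.untopA_eq_untop (ne_top_of_le_ne_top WithTop.coe_ne_top (min_le_left _ _)),
    WithTop.coe_untop]

lemma truncTime_le (τ : Ω → WithTop ℝ≥0) (t : ℝ≥0) (ω : Ω) : truncTime τ t ω ≤ t := by
  rw [← WithTop.coe_le_coe, coe_truncTime]
  exact min_le_left _ _

lemma stoppedProcess_eq_truncTime {β : Type*} (X : ℝ≥0 → Ω → β) (τ : Ω → WithTop ℝ≥0) (t : ℝ≥0) :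
    stoppedProcess X τ t = fun ω => X (truncTime τ t ω) ω := rfl

lemma truncTime_le_iff {τ : Ω → WithTop ℝ≥0} {t u : ℝ≥0} (hu : u < t) (ω : Ω) :
    truncTime τ t ω ≤ u ↔ τ ω ≤ u := by
  rw [← WithTop.coe_le_coe, coe_truncTime, min_le_iff, or_iff_right]
  exact (WithTop.coe_lt_coe.2 hu).not_ge

lemma isStoppingTime_gridCeil {τ : Ω → WithTop ℝ≥0} (hτ : IsStoppingTime 𝓖 τ) (t : ℝ≥0) (m : ℕ) :
    IsStoppingTime 𝓖 (fun ω => (gridCeil t m (truncTime τ t ω) : WithTop ℝ≥0)) := by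
  intro u
  rcases le_or_gt t u with h | h
  · have : {ω | (gridCeil t m (truncTime τ t ω) : WithTop ℝ≥0) ≤ u} = Set.univ := by
      ext ω
      exact iff_of_true (WithTop.coe_le_coe.2 ((gridCeil_le t m _).trans h)) trivial
    rw [this]
    exact MeasurableSet.univ
  · have hq : (⌊(m + 1 : ℝ≥0) * u⌋₊ : ℝ≥0) / (m + 1) ≤ u := by
      rw [div_le_iff₀ (by positivity), mul_comm]
      exact Nat.floor_le (by positivity)
    have : {ω | (gridCeil t m (truncTime τ t ω) : WithTop ℝ≥0) ≤ u}
        = {ω | τ ω ≤ ((⌊(m + 1 : ℝ≥0) * u⌋₊ : ℝ≥0) / (m + 1) : ℝ≥0)} := by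
      ext ω
      simp only [Set.mem_ofPred_eq, WithTop.coe_le_coe]
      rw [gridCeil_le_iff h, truncTime_le_iff (hq.trans_lt h)]
    rw [this]
    exact 𝓖.mono hq _ (hτ _)

variable [IsProbabilityMeasure P] {X : ℝ≥0 → Ω → ℝ} {τ : Ω → WithTop ℝ≥0}

/-- A rounded time takes countably many values, so optional stopping for such times applies. -/
lemma ae_eq_condExp_gridCeil (hX : Martingale X 𝓖 P) (hτ : IsStoppingTime 𝓖 τ) (t : ℝ≥0) (m : ℕ) :
    (fun ω => X (gridCeil t m (truncTime τ t ω)) ω)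
      =ᵐ[P] P[X t | (isStoppingTime_gridCeil hτ t m).measurableSpace] :=
  hX.stoppedValue_ae_eq_condExp_of_le_const_of_countable_range
    (isStoppingTime_gridCeil hτ t m) (fun ω => WithTop.coe_le_coe.2 (gridCeil_le t m _)) (by
      refine ((countable_range_gridCeil t m).image ((↑) : ℝ≥0 → WithTop ℝ≥0)).mono ?_
      rintro _ ⟨ω, rfl⟩
      exact ⟨_, ⟨_, rfl⟩, rfl⟩)

/-- Conditional expectations of the single variable `X t` are uniformly integrable. This upgrades
the pointwise convergence given by continuous paths to convergence in `L¹`. -/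
lemma uniformIntegrable_gridCeil (hX : Martingale X 𝓖 P) (hτ : IsStoppingTime 𝓖 τ) (t : ℝ≥0) :
    UniformIntegrable (fun m ω => X (gridCeil t m (truncTime τ t ω)) ω) 1 P :=
  ((hX.integrable t).uniformIntegrable_condExp
    fun m => (isStoppingTime_gridCeil hτ t m).measurableSpace_le).ae_eq
    fun m => (ae_eq_condExp_gridCeil hX hτ t m).symm

lemma tendsto_gridCeil_process (hc : ∀ ω, Continuous fun t => X t ω) (τ : Ω → WithTop ℝ≥0)
    (t : ℝ≥0) (ω : Ω) : Tendsto (fun m => X (gridCeil t m (truncTime τ t ω)) ω) atTop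
      (𝓝 (stoppedProcess X τ t ω)) :=
  ((hc ω).tendsto _).comp (tendsto_gridCeil (truncTime_le τ t ω))

lemma integrable_stoppedProcess_of_continuous (hX : Martingale X 𝓖 P)
    (hc : ∀ ω, Continuous fun t => X t ω) (hτ : IsStoppingTime 𝓖 τ) (t : ℝ≥0) :
    Integrable (stoppedProcess X τ t) P :=
  (uniformIntegrable_gridCeil hX hτ t).integrable_of_ae_tendsto
    (ae_of_all _ (tendsto_gridCeil_process hc τ t))

lemma tendsto_eLpNorm_gridCeil (hX : Martingale X 𝓖 P)
    (hc : ∀ ω, Continuous fun t => X t ω) (hτ : IsStoppingTime 𝓖 τ) (t : ℝ≥0) :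
    Tendsto (fun m => eLpNorm ((fun ω => X (gridCeil t m (truncTime τ t ω)) ω)
      - stoppedProcess X τ t) 1 P) atTop (𝓝 0) :=
  tendsto_Lp_finite_of_tendsto_ae le_rfl ENNReal.one_ne_top
    (uniformIntegrable_gridCeil hX hτ t).1
    (memLp_one_iff_integrable.2 (integrable_stoppedProcess_of_continuous hX hc hτ t))
    (uniformIntegrable_gridCeil hX hτ t).2.1
    (ae_of_all _ (tendsto_gridCeil_process hc τ t))

/-- Fatou's lemma along the rounded times, where conditional expectation contracts the `L¹` norm. -/
lemma integral_abs_stoppedProcess_le (hX : Martingale X 𝓖 P)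
    (hc : ∀ ω, Continuous fun t => X t ω) (hτ : IsStoppingTime 𝓖 τ) (t : ℝ≥0) :
    ∫ ω, |(stoppedProcess X τ t ω)| ∂P ≤ ∫ ω, |X t ω| ∂P := by
  have h := Lp.eLpNorm_lim_le_liminf_eLpNorm (p := 1) (uniformIntegrable_gridCeil hX hτ t).1
    (stoppedProcess X τ t) (ae_of_all _ (tendsto_gridCeil_process hc τ t))
  have h2 : eLpNorm (stoppedProcess X τ t) 1 P ≤ eLpNorm (X t) 1 P := by
    refine h.trans (liminf_le_of_le (by isBoundedDefault) fun b hb => ?_)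
    obtain ⟨m, hm⟩ := hb.exists
    refine hm.trans ?_
    rw [eLpNorm_congr_ae (ae_eq_condExp_gridCeil hX hτ t m)]
    exact eLpNorm_condExp_le_eLpNorm _ le_rfl
  have h3 := ENNReal.toReal_mono (memLp_one_iff_integrable.2 (hX.integrable t)).2.ne h2
  rw [eLpNorm_one_eq_lintegral_enorm, eLpNorm_one_eq_lintegral_enorm,
    ← integral_norm_eq_lintegral_enorm (hX.integrable t).1,
    ← integral_norm_eq_lintegral_enorm (integrable_stoppedProcess_of_continuous hX hc hτ t).1] at h3
  simpa [Real.norm_eq_abs] using h3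

/-- On `τ ≤ s` the two stopped values coincide. Off this event the rounded time is at least `s`, so
the rest of `S` is known at that time and the integral there is the one of `X t`, hence of `X s`. -/
lemma setIntegral_stoppedProcess_eq (hX : Martingale X 𝓖 P)
    (hc : ∀ ω, Continuous fun t => X t ω) (hτ : IsStoppingTime 𝓖 τ) {s t : ℝ≥0} (hst : s ≤ t)
    {S : Set Ω} (hS : MeasurableSet[𝓖 s] S) :
    ∫ ω in S, stoppedProcess X τ t ω ∂P = ∫ ω in S, stoppedProcess X τ s ω ∂P := by
  have hA : MeasurableSet[𝓖 s] {ω | τ ω ≤ s} := hτ s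
  have hAm : MeasurableSet {ω | τ ω ≤ s} := 𝓖.le s _ hA
  have hit := integrable_stoppedProcess_of_continuous hX hc hτ t
  have his := integrable_stoppedProcess_of_continuous hX hc hτ s
  rw [← integral_inter_add_sdiff hAm hit.integrableOn, ← integral_inter_add_sdiff hAm his.integrableOn]
  congr 1
  · refine setIntegral_congr_fun ((𝓖.le s _ hS).inter hAm) fun ω hω => ?_
    have h1 : τ ω ≤ s := hω.2
    rw [stoppedProcess_eq_of_ge h1, stoppedProcess_eq_of_ge (h1.trans (WithTop.coe_le_coe.2 hst))]
  · have hB : MeasurableSet[𝓖 s] (S \ {ω | τ ω ≤ s}) := hS.diff hA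
    have e1 : ∫ ω in S \ {ω | τ ω ≤ s}, stoppedProcess X τ s ω ∂P
        = ∫ ω in S \ {ω | τ ω ≤ s}, X s ω ∂P := by
      refine setIntegral_congr_fun (𝓖.le s _ hB) fun ω hω => ?_
      have h1 : ¬ τ ω ≤ s := hω.2
      rw [stoppedProcess_eq_of_le (not_le.1 h1).le]
    rw [e1, hX.setIntegral_eq hst hB]
    -- The same sequence converges to the integral of the stopped process, by `L¹` convergence, and
    -- is constantly equal to the integral of `X t`.
    refine tendsto_nhds_unique (f := fun m : ℕ =>
        ∫ ω in S \ {ω | τ ω ≤ s}, X (gridCeil t m (truncTime τ t ω)) ω ∂P) (l := atTop) ?_ ?_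
    · exact tendsto_setIntegral_of_L1' _ hit.1
        (Eventually.of_forall fun m => memLp_one_iff_integrable.1
          ((uniformIntegrable_gridCeil hX hτ t).memLp m))
        (tendsto_eLpNorm_gridCeil hX hc hτ t) _
    · refine tendsto_const_nhds.congr fun m => ?_
      have hBm : MeasurableSet[(isStoppingTime_gridCeil hτ t m).measurableSpace]
          (S \ {ω | τ ω ≤ s}) := by
        refine (IsStoppingTime.measurableSet _ _).2 ⟨le_iSup (fun t => (𝓖 t : MeasurableSpace Ω)) s _ hB, fun u => ?_⟩
        rcases lt_or_ge u s with h | h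
        · have : S \ {ω | τ ω ≤ s} ∩ {ω | (gridCeil t m (truncTime τ t ω) : WithTop ℝ≥0) ≤ u}
              = ∅ := by
            ext ω
            simp only [Set.mem_inter_iff, Set.mem_sdiff, Set.mem_ofPred_eq, WithTop.coe_le_coe,
              Set.mem_empty_iff_false, iff_false, not_and, not_le, and_imp]
            intro _ h2
            refine h.trans_le (le_trans ?_ (le_gridCeil (truncTime_le τ t ω) m))
            rw [← WithTop.coe_le_coe, coe_truncTime]
            exact le_min (WithTop.coe_le_coe.2 hst) h2.le
          rw [this]
          exact @MeasurableSet.empty _ (𝓖 u)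
        · have h1 : MeasurableSet[𝓖 u] (S \ {ω | τ ω ≤ s}) := 𝓖.mono h _ hB
          have h2 := isStoppingTime_gridCeil hτ t m u
          exact h1.inter h2
      rw [integral_congr_ae (ae_restrict_of_ae (ae_eq_condExp_gridCeil hX hτ t m)),
        setIntegral_condExp (IsStoppingTime.measurableSpace_le _) (hX.integrable t) hBm]

/-- **Optional stopping** for a martingale with continuous paths. -/
theorem martingale_stoppedProcess (hX : Martingale X 𝓖 P)
    (hc : ∀ ω, Continuous fun t => X t ω) (hτ : IsStoppingTime 𝓖 τ) :
    Martingale (stoppedProcess X τ) 𝓖 P := by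
  have hadapt : StronglyAdapted 𝓖 (stoppedProcess X τ) := StronglyAdapted.stoppedProcess hX.1 hc hτ
  refine ⟨hadapt, fun s t hst => ?_⟩
  refine (ae_eq_condExp_of_forall_setIntegral_eq (𝓖.le s)
    (integrable_stoppedProcess_of_continuous hX hc hτ t)
    (fun S _ _ => (integrable_stoppedProcess_of_continuous hX hc hτ s).integrableOn)
    (fun S hS _ => (setIntegral_stoppedProcess_eq hX hc hτ hst hS).symm)
    (hadapt s).aestronglyMeasurable).symm

omit [IsProbabilityMeasure P] in
-- An event known at time `0` comes out of every conditional expectation. This serves both for the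
-- factor `1_{τ > 0}` of localization and for discarding a null event.
lemma martingale_indicator {S : Set Ω} (hX : Martingale X 𝓖 P) (hS : MeasurableSet[𝓖 0] S) :
    Martingale (fun t => S.indicator (X t)) 𝓖 P := by
  refine ⟨fun t => (hX.1 t).indicator (𝓖.mono (zero_le) _ hS), fun s t hst => ?_⟩
  refine (condExp_indicator (hX.integrable t) (𝓖.mono (zero_le) _ hS)).trans ?_
  filter_upwards [hX.2 s t hst] with ω hω
  by_cases h : ω ∈ S <;> simp [h, hω]

/-- The process `1_{τ > 0} X_{t ∧ τ}`. -/
noncomputable def stopped (X : ℝ≥0 → Ω → ℝ) (τ : Ω → WithTop ℝ≥0) : ℝ≥0 → Ω → ℝ :=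
  stoppedProcess (fun t => {ω | ⊥ < τ ω}.indicator (X t)) τ

lemma stopped_of_pos {τ : Ω → WithTop ℝ≥0} {ω : Ω} (h : ⊥ < τ ω) (t : ℝ≥0) :
    stopped X τ t ω = X (truncTime τ t ω) ω := by
  have : ω ∈ {ω | ⊥ < τ ω} := h
  simp only [stopped, stoppedProcess_eq_truncTime, Set.indicator_of_mem this]

lemma stopped_of_not_pos {τ : Ω → WithTop ℝ≥0} {ω : Ω} (h : ¬ ⊥ < τ ω) (t : ℝ≥0) :
    stopped X τ t ω = 0 := by
  have : ω ∉ {ω | ⊥ < τ ω} := h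
  simp only [stopped, stoppedProcess_eq_truncTime, Set.indicator_of_notMem this]

lemma measurableSet_pos (hτ : IsStoppingTime 𝓖 τ) : MeasurableSet[𝓖 0] {ω | ⊥ < τ ω} := by
  have : {ω | ⊥ < τ ω} = {ω | τ ω ≤ (0 : ℝ≥0)}ᶜ := by
    ext ω
    simp only [Set.mem_ofPred_eq, Set.mem_compl_iff, not_le]
    rfl
  rw [this]
  exact (hτ 0).compl

lemma continuous_indicator {S : Set Ω} (hc : ∀ ω, Continuous fun t => X t ω) (ω : Ω) :
    Continuous fun t => S.indicator (X t) ω := by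
  by_cases h : ω ∈ S
  · simpa [h] using hc ω
  · simpa [h] using continuous_const

lemma continuous_truncTime (τ : Ω → WithTop ℝ≥0) (ω : Ω) :
    Continuous fun t => truncTime τ t ω := by
  unfold truncTime
  cases h : τ ω with
  | top =>
    have : (fun t : ℝ≥0 => (min (t : WithTop ℝ≥0) ⊤).untopA) = id := by
      ext t
      rw [min_eq_left le_top]
      rfl
    rw [this]
    exact continuous_id
  | coe r =>
    have : (fun t : ℝ≥0 => (min (t : WithTop ℝ≥0) (r : WithTop ℝ≥0)).untopA) = fun t => min t r := by
      ext t
      rw [← WithTop.coe_min]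
      rfl
    rw [this]
    exact continuous_id.min continuous_const

lemma continuous_stopped (hc : ∀ ω, Continuous fun t => X t ω) (ω : Ω) :
    Continuous fun t => stopped X τ t ω :=
  (continuous_indicator hc ω).comp (continuous_truncTime τ ω)

lemma martingale_stopped (hX : Martingale X 𝓖 P)
    (hc : ∀ ω, Continuous fun t => X t ω) (hτ : IsStoppingTime 𝓖 τ) :
    Martingale (stopped X τ) 𝓖 P :=
  martingale_stoppedProcess (martingale_indicator hX (measurableSet_pos hτ))
    (continuous_indicator hc) hτ

lemma stronglyAdapted_stopped (hX : StronglyAdapted 𝓖 X)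
    (hc : ∀ ω, Continuous fun t => X t ω) (hτ : IsStoppingTime 𝓖 τ) :
    StronglyAdapted 𝓖 (stopped X τ) :=
  StronglyAdapted.stoppedProcess
    (fun t => (hX t).indicator (𝓖.mono (zero_le) _ (measurableSet_pos hτ)))
    (continuous_indicator hc) hτ

/-- Allows a process that localization has already made a martingale to be stopped once more at a
hitting time. -/
lemma stopped_stopped (X : ℝ≥0 → Ω → ℝ) (τ σ : Ω → WithTop ℝ≥0) :
    stopped (stopped X τ) σ = stopped X (fun ω => min (σ ω) (τ ω)) := by
  simp only [stopped, stoppedProcess_indicator_comm', stoppedProcess_stoppedProcess',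
    Set.indicator_indicator]
  ext t ω
  congr 2
  ext ω
  simp

end OptionalStopping

end RandomVarianceCLT

/-! ### Hitting times of levels. -/

namespace RandomVarianceCLT

section HittingTime

variable {Ω : Type*} {mΩ : MeasurableSpace Ω} {𝓖 : Filtration ℝ≥0 mΩ} {f : ℝ≥0 → Ω → ℝ} {c : ℝ}

/-- The first time at which the process `f` reaches the level `c`. -/
noncomputable def levelTime (f : ℝ≥0 → Ω → ℝ) (c : ℝ) : Ω → WithTop ℝ≥0 :=
  hittingAfter f (Set.Ici c) 0

/-- By continuity the set of times above the level is closed, so the infimum is attained. -/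
lemma levelTime_le_iff (hc : ∀ ω, Continuous fun t => f t ω) (ω : Ω) (t : ℝ≥0) :
    levelTime f c ω ≤ t ↔ ∃ u ≤ t, c ≤ f u ω := by
  constructor
  · intro h
    have hex : ∃ j, 0 ≤ j ∧ f j ω ∈ Set.Ici c := by
      by_contra hne
      have : levelTime f c ω = ⊤ := by
        rw [levelTime, hittingAfter_eq_top_iff]
        exact fun j hj hmem => hne ⟨j, hj, hmem⟩
      rw [this] at h
      exact absurd (top_le_iff.1 h) WithTop.coe_ne_top
    have heq : levelTime f c ω = ((sInf {i : ℝ≥0 | 0 ≤ i ∧ f i ω ∈ Set.Ici c} : ℝ≥0)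
        : WithTop ℝ≥0) := by
      rw [levelTime, hittingAfter_def]
      exact if_pos hex
    have hcl : IsClosed {i : ℝ≥0 | 0 ≤ i ∧ f i ω ∈ Set.Ici c} := by
      have : {i : ℝ≥0 | 0 ≤ i ∧ f i ω ∈ Set.Ici c} = (fun t => f t ω) ⁻¹' Set.Ici c := by
        ext i
        simp
      rw [this]
      exact isClosed_Ici.preimage (hc ω)
    have hmem := hcl.csInf_mem hex (OrderBot.bddBelow _)
    rw [heq, WithTop.coe_le_coe] at h
    exact ⟨_, h, hmem.2⟩
  · rintro ⟨u, hu, hfu⟩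
    exact (hittingAfter_le_of_mem (zero_le) hfu).trans (WithTop.coe_le_coe.2 hu)

/-- The maximum over the compact `[0, t]` is attained and is approximated along a countable dense
set of times. Evaluating at `min q t` keeps everything within the past of `t`, so no
right-continuity of the filtration is needed. -/
lemma isStoppingTime_levelTime (hf : StronglyAdapted 𝓖 f) (hc : ∀ ω, Continuous fun t => f t ω) :
    IsStoppingTime 𝓖 (levelTime f c) := by
  intro t
  obtain ⟨D, hDc, hDd⟩ := TopologicalSpace.exists_countable_dense ℝ≥0
  have : {ω | levelTime f c ω ≤ t}
      = ⋂ n : ℕ, ⋃ q ∈ D, {ω | c - 1 / ((n : ℝ) + 1) < f (min q t) ω} := by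
    ext ω
    simp only [Set.mem_ofPred_eq, levelTime_le_iff hc, Set.mem_iInter, Set.mem_iUnion,
      exists_prop]
    constructor
    · rintro ⟨u, hut, hu⟩ n
      have hcont : Continuous fun q => f (min q t) ω :=
        (hc ω).comp (continuous_id.min continuous_const)
      have hopen : IsOpen {q : ℝ≥0 | c - 1 / ((n : ℝ) + 1) < f (min q t) ω} :=
        isOpen_lt continuous_const hcont
      have hne : {q : ℝ≥0 | c - 1 / ((n : ℝ) + 1) < f (min q t) ω}.Nonempty := by
        refine ⟨u, ?_⟩
        have : (0 : ℝ) < 1 / ((n : ℝ) + 1) := by positivity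
        simp only [Set.mem_ofPred_eq, min_eq_left hut]
        linarith
      obtain ⟨q, hq, hqD⟩ := hDd.inter_open_nonempty _ hopen hne
      exact ⟨q, hqD, hq⟩
    · intro h
      choose q hq using h
      obtain ⟨u, hu, hmax⟩ := (isCompact_Icc (a := (0 : ℝ≥0)) (b := t)).exists_isMaxOn
        ⟨0, by simp⟩ (hc ω).continuousOn
      refine ⟨u, hu.2, ?_⟩
      refine le_of_forall_pos_le_add fun ε hε => ?_
      obtain ⟨n, hn⟩ := exists_nat_one_div_lt hε
      have h1 := (hq n).2
      have h2 : f (min (q n) t) ω ≤ f u ω := hmax ⟨zero_le, min_le_right _ _⟩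
      linarith
  rw [this]
  refine MeasurableSet.iInter fun n => MeasurableSet.biUnion hDc fun q _ => ?_
  exact 𝓖.mono (min_le_right q t) _ ((hf (min q t)).measurable measurableSet_Ioi)

/-- The process is strictly below the level before the hitting time, and continuity carries the weak
inequality up to it. Positivity of the hitting time excludes a start above the level. -/
lemma le_of_le_levelTime (hc : ∀ ω, Continuous fun t => f t ω) {ω : Ω}
    (hpos : ⊥ < levelTime f c ω) {t : ℝ≥0} (ht : (t : WithTop ℝ≥0) ≤ levelTime f c ω) :
    f t ω ≤ c := by
  have hlt : ∀ u : ℝ≥0, (u : WithTop ℝ≥0) < levelTime f c ω → f u ω < c := fun u hu =>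
    lt_of_not_ge fun h => hu.not_ge ((levelTime_le_iff hc ω u).2 ⟨u, le_rfl, h⟩)
  rcases eq_or_lt_of_le (zero_le : 0 ≤ t) with h0 | h0
  · subst h0
    exact (hlt 0 hpos).le
  · have hcl : t ∈ closure (Set.Iio t) := by
      rw [closure_Iio' (a := t) ⟨0, h0⟩]
      exact Set.self_mem_Iic
    have : IsClosed {u | f u ω ≤ c} := isClosed_le (hc ω) continuous_const
    refine this.closure_subset_iff.2 (fun u hu => ?_) hcl
    exact (hlt u ((WithTop.coe_lt_coe.2 hu).trans_le ht)).le

end HittingTime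

end RandomVarianceCLT

/-! ### Second order expansion and bounded pairs. -/

namespace RandomVarianceCLT

section BoundedPair

variable {Ω : Type*} {mΩ : MeasurableSpace Ω} {P : Measure Ω} {𝓖 : Filtration ℝ≥0 mΩ}

/-- With `z = i ξ d + ξ² e / 2`, the square `z² / 2` contributes `-ξ² d² / 2`, which joins `z` to
form the subtracted term; that term integrates to zero when `d`, `e` are increments of `M`, `A`. The
rest of `z² / 2` and the Taylor remainder are of third order, `d` counting as `√e`. -/
lemma norm_exp_sub_second_order_le {ξ R K d e : ℝ} (hd : |d| ≤ 2 * R) (he : 0 ≤ e) (heK : e ≤ K) :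
    ‖Complex.exp (Complex.I * ξ * d + ξ ^ 2 / 2 * e) - 1
      - (Complex.I * ξ * d + ξ ^ 2 / 2 * (e - d ^ 2))‖
      ≤ ((|ξ| + ξ ^ 2 / 2) ^ 3 * (2 * (1 + K)) * Real.exp ((|ξ| + ξ ^ 2 / 2) * (2 * R + K))
        + (|ξ| ^ 3 + ξ ^ 4)) * ((|d| + e) * (d ^ 2 + e)) := by
  set B := |ξ| + ξ ^ 2 / 2 with hB
  have hB0 : 0 ≤ B := by positivity
  set z : ℂ := Complex.I * ξ * d + ξ ^ 2 / 2 * e with hz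
  have hzn : ‖z‖ ≤ B * (|d| + e) := by
    refine (norm_add_le _ _).trans ?_
    simp only [norm_mul, Complex.norm_I, Complex.norm_real, norm_div, norm_pow, Real.norm_eq_abs,
      one_mul, abs_of_nonneg he, Complex.norm_ofNat, sq_abs]
    have h1 : 0 ≤ ξ ^ 2 / 2 * |d| := by positivity
    have h2 : 0 ≤ |ξ| * e := by positivity
    rw [hB]
    nlinarith
  have hexp := Complex.norm_exp_sub_sum_le_norm_mul_exp z 3
  have hsum : ∑ m ∈ Finset.range 3, z ^ m / (m.factorial : ℂ) = 1 + z + z ^ 2 / 2 := by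
    simp [Finset.sum_range_succ, Nat.factorial]
  rw [hsum] at hexp
  have hde : 0 ≤ |d| + e := by positivity
  have hsplit : Complex.exp z - 1 - (Complex.I * ξ * d + ξ ^ 2 / 2 * (e - d ^ 2))
      = (Complex.exp z - (1 + z + z ^ 2 / 2))
        + (Complex.I * ξ ^ 3 * d * e / 2 + ξ ^ 4 * e ^ 2 / 8) := by
    rw [hz]
    have hI : Complex.I ^ 2 = -1 := Complex.I_sq
    linear_combination (1 / 2 * (ξ : ℂ) ^ 2 * d ^ 2) * hI
  rw [hsplit]
  have hd2 : |d| ^ 2 = d ^ 2 := sq_abs d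
  -- The bound `e ≤ K` turns `e²` into `K e`, so two factors of the cube of `|d| + e` become `d² +
  -- e`.
  have hquad : (|d| + e) ^ 2 ≤ 2 * (1 + K) * (d ^ 2 + e) := by
    have h1 : e ^ 2 ≤ K * e := by nlinarith
    have h2 : 0 ≤ K * d ^ 2 := by
      have : 0 ≤ K := he.trans heK
      positivity
    nlinarith [sq_nonneg (|d| - e)]
  have hcube : ‖z‖ ^ 3 ≤ B ^ 3 * (2 * (1 + K)) * ((|d| + e) * (d ^ 2 + e)) := by
    calc ‖z‖ ^ 3 ≤ (B * (|d| + e)) ^ 3 := pow_le_pow_left₀ (norm_nonneg _) hzn 3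
      _ = B ^ 3 * (|d| + e) * (|d| + e) ^ 2 := by ring
      _ ≤ B ^ 3 * (|d| + e) * (2 * (1 + K) * (d ^ 2 + e)) := by gcongr
      _ = _ := by ring
  have hexpz : Real.exp ‖z‖ ≤ Real.exp (B * (2 * R + K)) := by
    refine Real.exp_le_exp.2 (hzn.trans ?_)
    gcongr
  have hfirst : ‖Complex.exp z - (1 + z + z ^ 2 / 2)‖
      ≤ B ^ 3 * (2 * (1 + K)) * Real.exp (B * (2 * R + K)) * ((|d| + e) * (d ^ 2 + e)) := by
    refine hexp.trans ?_
    calc ‖z‖ ^ 3 * Real.exp ‖z‖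
        ≤ (B ^ 3 * (2 * (1 + K)) * ((|d| + e) * (d ^ 2 + e))) * Real.exp (B * (2 * R + K)) := by
          gcongr
          exact (pow_nonneg (norm_nonneg z) 3).trans hcube
      _ = _ := by ring
  have hsecond : ‖Complex.I * ξ ^ 3 * d * e / 2 + ξ ^ 4 * e ^ 2 / 8‖
      ≤ (|ξ| ^ 3 + ξ ^ 4) * ((|d| + e) * (d ^ 2 + e)) := by
    refine (norm_add_le _ _).trans ?_
    simp only [norm_mul, Complex.norm_I, Complex.norm_real, norm_div, norm_pow, Real.norm_eq_abs,
      one_mul, abs_of_nonneg he, Complex.norm_ofNat]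
    have h4 : |ξ| ^ 4 = ξ ^ 4 := by
      rw [show (4 : ℕ) = 2 * 2 from rfl, pow_mul, pow_mul, sq_abs]
    rw [h4]
    have hc3 : 0 ≤ |ξ| ^ 3 := by positivity
    have hc4 : 0 ≤ ξ ^ 4 := by positivity
    have t1 : |d| * e ≤ (|d| + e) * (d ^ 2 + e) := by
      have : 0 ≤ (|d| + e) * d ^ 2 := by positivity
      nlinarith [sq_nonneg e]
    have t2 : e ^ 2 ≤ (|d| + e) * (d ^ 2 + e) := by
      have : 0 ≤ (|d| + e) * d ^ 2 := by positivity
      have : 0 ≤ |d| * e := by positivity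
      nlinarith
    have t3 : 0 ≤ |d| * e := by positivity
    have t4 : 0 ≤ e ^ 2 := by positivity
    have u1 := mul_le_mul_of_nonneg_left t1 hc3
    have u2 := mul_le_mul_of_nonneg_left t2 hc4
    have u3 : 0 ≤ |ξ| ^ 3 * (|d| * e) := by positivity
    have u4 : 0 ≤ ξ ^ 4 * e ^ 2 := by positivity
    nlinarith
  refine (norm_add_le _ _).trans ((add_le_add hfirst hsecond).trans (le_of_eq ?_))
  ring

/-- A bounded continuous martingale `M` together with a bounded continuous nondecreasing process
`A` such that `M ^ 2 - A` is a martingale. -/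
structure BoundedPair (𝓖 : Filtration ℝ≥0 mΩ) (P : Measure Ω) (M A : ℝ≥0 → Ω → ℝ) (R K : ℝ) :
    Prop where
  martingale : Martingale M 𝓖 P
  continuous_left : ∀ ω, Continuous fun t => M t ω
  adapted : StronglyAdapted 𝓖 A
  continuous_right : ∀ ω, Continuous fun t => A t ω
  mono : ∀ ω, Monotone fun t => A t ω
  zero : ∀ ω, A 0 ω = 0
  abs_le : ∀ t ω, |M t ω| ≤ R
  le : ∀ t ω, A t ω ≤ K
  martingale_sq_sub : Martingale (fun t ω => M t ω ^ 2 - A t ω) 𝓖 P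

variable [IsProbabilityMeasure P]

lemma integral_mul_martingale {X : ℝ≥0 → Ω → ℝ} (hX : Martingale X 𝓖 P) {s t : ℝ≥0} (hst : s ≤ t)
    {g : Ω → ℝ} (hg : StronglyMeasurable[𝓖 s] g) {C : ℝ} (hC : ∀ ω, ‖g ω‖ ≤ C) :
    ∫ ω, g ω * (X t ω - X s ω) ∂P = 0 := by
  have hgm : AEStronglyMeasurable g P := (hg.mono (𝓖.le s)).aestronglyMeasurable
  have hi : ∀ u, Integrable (fun ω => g ω * X u ω) P := fun u =>
    (hX.integrable u).bdd_mul hgm (ae_of_all _ hC)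
  simp_rw [mul_sub]
  rw [integral_sub (hi t) (hi s), sub_eq_zero]
  calc ∫ ω, g ω * X t ω ∂P = ∫ ω, (P[fun ω => g ω * X t ω | 𝓖 s]) ω ∂P :=
        (integral_condExp (𝓖.le s)).symm
    _ = ∫ ω, g ω * X s ω ∂P := by
        refine integral_congr_ae ?_
        filter_upwards [condExp_mul_of_stronglyMeasurable_left hg (hi t) (hX.integrable t),
          hX.2 s t hst] with ω h1 h2
        rw [← h2]
        exact h1

lemma integral_complex_mul_martingale {X : ℝ≥0 → Ω → ℝ} (hX : Martingale X 𝓖 P) {s t : ℝ≥0}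
    (hst : s ≤ t) {g : Ω → ℂ} (hg : StronglyMeasurable[𝓖 s] g) {C : ℝ} (hC : ∀ ω, ‖g ω‖ ≤ C) :
    ∫ ω, g ω * ((X t ω - X s ω : ℝ) : ℂ) ∂P = 0 := by
  have hgm : AEStronglyMeasurable g P := (hg.mono (𝓖.le s)).aestronglyMeasurable
  have hi : Integrable (fun ω => g ω * ((X t ω - X s ω : ℝ) : ℂ)) P :=
    (((hX.integrable t).sub (hX.integrable s)).ofReal (𝕜 := ℂ)).bdd_mul hgm (ae_of_all _ hC)
  apply Complex.ext
  · rw [← Complex.reCLM_apply, ← Complex.reCLM.integral_comp_comm hi]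
    simp only [Complex.reCLM_apply, Complex.re_mul_ofReal, Complex.zero_re]
    exact integral_mul_martingale hX hst (Complex.continuous_re.comp_stronglyMeasurable hg)
      fun ω => (Complex.abs_re_le_norm _).trans (hC ω)
  · rw [← Complex.imCLM_apply, ← Complex.imCLM.integral_comp_comm hi]
    simp only [Complex.imCLM_apply, Complex.im_mul_ofReal, Complex.zero_im]
    exact integral_mul_martingale hX hst (Complex.continuous_im.comp_stronglyMeasurable hg)
      fun ω => (Complex.abs_im_le_norm _).trans (hC ω)

namespace BoundedPair

variable {M A : ℝ≥0 → Ω → ℝ} {R K : ℝ}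

omit [IsProbabilityMeasure P] in
lemma nonneg (h : BoundedPair 𝓖 P M A R K) (t : ℝ≥0) (ω : Ω) : 0 ≤ A t ω := by
  rw [← h.zero ω]
  exact h.mono ω zero_le

omit [IsProbabilityMeasure P] in
lemma abs_right_le (h : BoundedPair 𝓖 P M A R K) (t : ℝ≥0) (ω : Ω) : |A t ω| ≤ K := by
  rw [abs_of_nonneg (h.nonneg t ω)]
  exact h.le t ω

omit [IsProbabilityMeasure P] in
lemma abs_sub_le (h : BoundedPair 𝓖 P M A R K) (s t : ℝ≥0) (ω : Ω) :
    |M t ω - M s ω| ≤ 2 * R := by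
  refine (abs_sub _ _).trans ?_
  linarith [h.abs_le s ω, h.abs_le t ω]

/-- The square of the increment has the same expectation as the increment of `A`, even after
multiplication with the past. -/
lemma integral_mul_sq (h : BoundedPair 𝓖 P M A R K) {s t : ℝ≥0} (hst : s ≤ t)
    {g : Ω → ℂ} (hg : StronglyMeasurable[𝓖 s] g) {C : ℝ} (hC : ∀ ω, ‖g ω‖ ≤ C) :
    ∫ ω, g ω * (((A t ω - A s ω) - (M t ω - M s ω) ^ 2 : ℝ) : ℂ) ∂P = 0 := by
  have h1 := integral_complex_mul_martingale h.martingale_sq_sub hst hg hC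
  have hg2 : StronglyMeasurable[𝓖 s] (fun ω => g ω * ((M s ω : ℝ) : ℂ)) :=
    hg.mul (Complex.continuous_ofReal.comp_stronglyMeasurable (h.martingale.1 s))
  have hC2 : ∀ ω, ‖g ω * ((M s ω : ℝ) : ℂ)‖ ≤ C * R := fun ω => by
    rw [norm_mul, Complex.norm_real]
    exact mul_le_mul (hC ω) (h.abs_le s ω) (norm_nonneg _) ((norm_nonneg _).trans (hC ω))
  have h2 := integral_complex_mul_martingale h.martingale hst hg2 hC2
  have hgm : AEStronglyMeasurable g P := (hg.mono (𝓖.le s)).aestronglyMeasurable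
  have i1 : Integrable (fun ω => g ω * (((M t ω ^ 2 - A t ω) - (M s ω ^ 2 - A s ω) : ℝ) : ℂ)) P :=
    (((h.martingale_sq_sub.integrable t).sub
      (h.martingale_sq_sub.integrable s)).ofReal (𝕜 := ℂ)).bdd_mul hgm (ae_of_all _ hC)
  have i2 : Integrable (fun ω => g ω * ((M s ω : ℝ) : ℂ) * ((M t ω - M s ω : ℝ) : ℂ)) P :=
    (((h.martingale.integrable t).sub
      (h.martingale.integrable s)).ofReal (𝕜 := ℂ)).bdd_mul
      ((hg2.mono (𝓖.le s)).aestronglyMeasurable) (ae_of_all _ hC2)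
  -- Up to the factor `g`, this is twice `M s` times the increment of `M`, minus the increment of
  -- `M² - A`: past factors times martingale increments.
  have : (fun ω => g ω * (((A t ω - A s ω) - (M t ω - M s ω) ^ 2 : ℝ) : ℂ))
      = fun ω => 2 * (g ω * ((M s ω : ℝ) : ℂ) * ((M t ω - M s ω : ℝ) : ℂ))
        - g ω * (((M t ω ^ 2 - A t ω) - (M s ω ^ 2 - A s ω) : ℝ) : ℂ) := by
    ext ω
    push_cast
    ring
  rw [this, integral_sub (i2.const_mul 2) i1, integral_const_mul, h1, h2]
  simp

end BoundedPair

end BoundedPair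

end RandomVarianceCLT

/-! ### Moment bounds for sums of squared increments. -/

namespace RandomVarianceCLT

namespace BoundedPair

variable {Ω : Type*} {mΩ : MeasurableSpace Ω} {P : Measure Ω} {𝓖 : Filtration ℝ≥0 mΩ}
  {M A : ℝ≥0 → Ω → ℝ} {R K : ℝ}

/-- The sum of the squared increments of `M` and of the increments of `A` along `u`. -/
noncomputable def incSum (M A : ℝ≥0 → Ω → ℝ) (u : ℕ → ℝ≥0) (n : ℕ) (ω : Ω) : ℝ :=
  ∑ j ∈ Finset.range n, ((M (u (j + 1)) ω - M (u j) ω) ^ 2 + (A (u (j + 1)) ω - A (u j) ω))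

lemma inc_nonneg (h : BoundedPair 𝓖 P M A R K) {u : ℕ → ℝ≥0} (hu : Monotone u) (j : ℕ) (ω : Ω) :
    0 ≤ A (u (j + 1)) ω - A (u j) ω :=
  sub_nonneg.2 (h.mono ω (hu j.le_succ))

lemma inc_le (h : BoundedPair 𝓖 P M A R K) (s t : ℝ≥0) (ω : Ω) : A t ω - A s ω ≤ K := by
  linarith [h.le t ω, h.nonneg s ω]

lemma inc_sq_le (h : BoundedPair 𝓖 P M A R K) (s t : ℝ≥0) (ω : Ω) :
    (M t ω - M s ω) ^ 2 + (A t ω - A s ω) ≤ 4 * R ^ 2 + K := by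
  have h1 := h.abs_sub_le s t ω
  have h2 : (M t ω - M s ω) ^ 2 ≤ (2 * R) ^ 2 := by
    rw [← sq_abs]
    exact pow_le_pow_left₀ (abs_nonneg _) h1 2
  have h3 := h.inc_le s t ω
  nlinarith

lemma incSum_term_nonneg (h : BoundedPair 𝓖 P M A R K) {u : ℕ → ℝ≥0} (hu : Monotone u) (j : ℕ)
    (ω : Ω) : 0 ≤ (M (u (j + 1)) ω - M (u j) ω) ^ 2 + (A (u (j + 1)) ω - A (u j) ω) :=
  add_nonneg (sq_nonneg _) (h.inc_nonneg hu j ω)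

lemma incSum_nonneg (h : BoundedPair 𝓖 P M A R K) {u : ℕ → ℝ≥0} (hu : Monotone u) (n : ℕ)
    (ω : Ω) : 0 ≤ incSum M A u n ω :=
  Finset.sum_nonneg fun j _ => h.incSum_term_nonneg hu j ω

lemma incSum_mono (h : BoundedPair 𝓖 P M A R K) {u : ℕ → ℝ≥0} (hu : Monotone u) {m n : ℕ}
    (hmn : m ≤ n) (ω : Ω) : incSum M A u m ω ≤ incSum M A u n ω :=
  Finset.sum_le_sum_of_subset_of_nonneg (Finset.range_mono hmn)
    fun j _ _ => h.incSum_term_nonneg hu j ω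

lemma incSum_le (h : BoundedPair 𝓖 P M A R K) (u : ℕ → ℝ≥0) (n : ℕ) (ω : Ω) :
    incSum M A u n ω ≤ n * (4 * R ^ 2 + K) := by
  refine (Finset.sum_le_card_nsmul _ _ (4 * R ^ 2 + K) fun j _ => h.inc_sq_le _ _ ω).trans ?_
  rw [Finset.card_range, nsmul_eq_mul]

lemma abs_incSum_le (h : BoundedPair 𝓖 P M A R K) {u : ℕ → ℝ≥0} (hu : Monotone u) (n : ℕ)
    (ω : Ω) : ‖incSum M A u n ω‖ ≤ n * (4 * R ^ 2 + K) := by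
  rw [Real.norm_of_nonneg (h.incSum_nonneg hu n ω)]
  exact h.incSum_le u n ω

lemma stronglyMeasurable_incSum (h : BoundedPair 𝓖 P M A R K) {u : ℕ → ℝ≥0} (hu : Monotone u)
    (n : ℕ) : StronglyMeasurable[𝓖 (u n)] (incSum M A u n) := by
  unfold incSum
  refine Finset.stronglyMeasurable_fun_sum _ fun j hj => ?_
  have hj' : j + 1 ≤ n := Finset.mem_range.1 hj
  have hM : ∀ i ≤ n, StronglyMeasurable[𝓖 (u n)] (M (u i)) := fun i hi =>
    (h.martingale.1 (u i)).mono (𝓖.mono (hu hi))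
  have hA : ∀ i ≤ n, StronglyMeasurable[𝓖 (u n)] (A (u i)) := fun i hi =>
    (h.adapted (u i)).mono (𝓖.mono (hu hi))
  exact (((hM _ hj').sub (hM _ (by omega))).pow 2).add ((hA _ hj').sub (hA _ (by omega)))

lemma aestronglyMeasurable_left (h : BoundedPair 𝓖 P M A R K) (t : ℝ≥0) :
    AEStronglyMeasurable (M t) P := ((h.martingale.1 t).mono (𝓖.le t)).aestronglyMeasurable

lemma aestronglyMeasurable_right (h : BoundedPair 𝓖 P M A R K) (t : ℝ≥0) :
    AEStronglyMeasurable (A t) P := ((h.adapted t).mono (𝓖.le t)).aestronglyMeasurable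

variable [IsProbabilityMeasure P]

lemma integrable_right (h : BoundedPair 𝓖 P M A R K) (t : ℝ≥0) : Integrable (A t) P :=
  Integrable.of_bound (h.aestronglyMeasurable_right t) K
    (ae_of_all _ fun ω => h.abs_right_le t ω)

lemma integrable_inc (h : BoundedPair 𝓖 P M A R K) (s t : ℝ≥0) :
    Integrable (fun ω => A t ω - A s ω) P := (h.integrable_right t).sub (h.integrable_right s)

lemma integrable_sq_inc (h : BoundedPair 𝓖 P M A R K) (s t : ℝ≥0) :
    Integrable (fun ω => (M t ω - M s ω) ^ 2) P :=
  Integrable.of_bound (((h.aestronglyMeasurable_left t).sub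
    (h.aestronglyMeasurable_left s)).pow 2) ((2 * R) ^ 2) (ae_of_all _ fun ω => by
      rw [norm_pow]
      exact pow_le_pow_left₀ (norm_nonneg _) (h.abs_sub_le s t ω) 2)

lemma integral_real_mul_sq (h : BoundedPair 𝓖 P M A R K) {s t : ℝ≥0} (hst : s ≤ t)
    {g : Ω → ℝ} (hg : StronglyMeasurable[𝓖 s] g) {C : ℝ} (hC : ∀ ω, ‖g ω‖ ≤ C) :
    ∫ ω, g ω * ((M t ω - M s ω) ^ 2 + (A t ω - A s ω)) ∂P
      = ∫ ω, 2 * (g ω * (A t ω - A s ω)) ∂P := by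
  have h1 := h.integral_mul_sq hst (Complex.continuous_ofReal.comp_stronglyMeasurable hg)
    (C := C) (fun ω => by simpa using hC ω)
  have h2 : ∫ ω, g ω * ((A t ω - A s ω) - (M t ω - M s ω) ^ 2) ∂P = 0 := by
    have e : ∀ ω, (((g ω : ℝ) : ℂ)) * ((((A t ω - A s ω) - (M t ω - M s ω) ^ 2 : ℝ)) : ℂ)
        = ((g ω * ((A t ω - A s ω) - (M t ω - M s ω) ^ 2) : ℝ) : ℂ) := fun ω => by
      push_cast
      ring
    simp only [e] at h1
    rw [integral_complex_ofReal] at h1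
    exact_mod_cast h1
  have hgm : AEStronglyMeasurable g P := (hg.mono (𝓖.le s)).aestronglyMeasurable
  have i1 : Integrable (fun ω => g ω * (A t ω - A s ω)) P :=
    (h.integrable_inc s t).bdd_mul hgm (ae_of_all _ hC)
  have i2 : Integrable (fun ω => g ω * ((A t ω - A s ω) - (M t ω - M s ω) ^ 2)) P :=
    ((h.integrable_inc s t).sub (h.integrable_sq_inc s t)).bdd_mul hgm (ae_of_all _ hC)
  have e : (fun ω => g ω * ((M t ω - M s ω) ^ 2 + (A t ω - A s ω)))
      = fun ω => 2 * (g ω * (A t ω - A s ω))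
        - g ω * ((A t ω - A s ω) - (M t ω - M s ω) ^ 2) := by
    ext ω
    ring
  rw [e, integral_sub (i1.const_mul 2) i2, h2, sub_zero]

lemma integrable_incSum (h : BoundedPair 𝓖 P M A R K) {u : ℕ → ℝ≥0} (hu : Monotone u) (n : ℕ) :
    Integrable (incSum M A u n) P :=
  Integrable.of_bound ((h.stronglyMeasurable_incSum hu n).mono (𝓖.le _)).aestronglyMeasurable
    _ (ae_of_all _ fun ω => h.abs_incSum_le hu n ω)

lemma integral_incSum_le (h : BoundedPair 𝓖 P M A R K) {u : ℕ → ℝ≥0} (hu : Monotone u) (n : ℕ) :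
    ∫ ω, incSum M A u n ω ∂P ≤ 2 * K := by
  have hi : ∀ j, Integrable (fun ω => (M (u (j + 1)) ω - M (u j) ω) ^ 2
      + (A (u (j + 1)) ω - A (u j) ω)) P := fun j =>
    (h.integrable_sq_inc _ _).add (h.integrable_inc _ _)
  unfold incSum
  rw [integral_finsetSum _ fun j _ => hi j]
  have e : ∀ j, ∫ ω, ((M (u (j + 1)) ω - M (u j) ω) ^ 2 + (A (u (j + 1)) ω - A (u j) ω)) ∂P
      = ∫ ω, 2 * (A (u (j + 1)) ω - A (u j) ω) ∂P := fun j => by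
    have := h.integral_real_mul_sq (hu j.le_succ) (g := fun _ => 1) stronglyMeasurable_const
      (C := 1) (fun ω => by simp)
    simpa using this
  simp only [e]
  rw [← integral_finsetSum _ fun j _ => (h.integrable_inc _ _).const_mul 2]
  have e2 : ∀ ω, ∑ j ∈ Finset.range n, 2 * (A (u (j + 1)) ω - A (u j) ω)
      = 2 * (A (u n) ω - A (u 0) ω) := fun ω => by
    rw [← Finset.mul_sum, Finset.sum_range_sub (fun j => A (u j) ω)]
  simp only [e2]
  calc ∫ ω, 2 * (A (u n) ω - A (u 0) ω) ∂P ≤ ∫ _, 2 * K ∂P :=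
        integral_mono ((h.integrable_inc _ _).const_mul 2) (integrable_const _)
          fun ω => by linarith [h.inc_le (u 0) (u n) ω]
    _ = 2 * K := by simp

/-- Telescope `S²` into terms `2 S_j q_j + q_j²`. Since `S_j` belongs to the past, `q_j` may be
replaced under the integral by twice the increment of `A`, and these increments sum to at most `K`;
in `q_j²` one factor is bounded by `4 R² + K`. What remains is the first moment of `S`. The bound is
independent of the subdivision. -/
lemma integral_incSum_sq_le (h : BoundedPair 𝓖 P M A R K) {u : ℕ → ℝ≥0} (hu : Monotone u)
    (n : ℕ) : ∫ ω, incSum M A u n ω ^ 2 ∂P ≤ (4 * K + (4 * R ^ 2 + K)) * (2 * K) := by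
  set q : ℕ → Ω → ℝ := fun j ω => (M (u (j + 1)) ω - M (u j) ω) ^ 2
    + (A (u (j + 1)) ω - A (u j) ω) with hq
  have hqi : ∀ j, Integrable (q j) P := fun j =>
    (h.integrable_sq_inc _ _).add (h.integrable_inc _ _)
  have hq0 : ∀ j ω, 0 ≤ q j ω := fun j ω => h.incSum_term_nonneg hu j ω
  have hqc : ∀ j ω, q j ω ≤ 4 * R ^ 2 + K := fun j ω => h.inc_sq_le _ _ ω
  have hSm : ∀ j, AEStronglyMeasurable (incSum M A u j) P := fun j =>
    ((h.stronglyMeasurable_incSum hu j).mono (𝓖.le _)).aestronglyMeasurable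
  have hSq : ∀ j, Integrable (fun ω => incSum M A u j ω * q j ω) P := fun j =>
    (hqi j).bdd_mul (hSm j) (ae_of_all _ fun ω => h.abs_incSum_le hu j ω)
  have hSe : ∀ j k, Integrable (fun ω => incSum M A u k ω * (A (u (j + 1)) ω - A (u j) ω)) P :=
    fun j k => (h.integrable_inc _ _).bdd_mul (hSm k) (ae_of_all _ fun ω => h.abs_incSum_le hu k ω)
  have hq2 : ∀ j, Integrable (fun ω => q j ω ^ 2) P := fun j => by
    simp only [pow_two]
    refine (hqi j).bdd_mul (c := 4 * R ^ 2 + K) (hqi j).1 (ae_of_all _ fun ω => ?_)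
    rw [Real.norm_of_nonneg (hq0 j ω)]
    exact hqc j ω
  have htel : ∀ ω, incSum M A u n ω ^ 2
      = ∑ j ∈ Finset.range n, (2 * (incSum M A u j ω * q j ω) + q j ω ^ 2) := fun ω => by
    have e := Finset.sum_range_sub (fun j => incSum M A u j ω ^ 2) n
    have e0 : incSum M A u 0 ω = 0 := by simp [incSum]
    simp only [e0] at e
    rw [← sub_zero (incSum M A u n ω ^ 2), ← zero_pow two_ne_zero, ← e]
    refine Finset.sum_congr rfl fun j _ => ?_
    have : incSum M A u (j + 1) ω = incSum M A u j ω + q j ω := Finset.sum_range_succ _ _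
    rw [this]
    ring
  have hK : 0 ≤ K := by
    obtain ⟨ω⟩ : Nonempty Ω := P.nonempty_of_neZero
    exact (h.nonneg 0 ω).trans (h.le 0 ω)
  simp only [htel]
  have hi1 : ∀ j, Integrable (fun ω => 2 * (incSum M A u j ω * q j ω) + q j ω ^ 2) P :=
    fun j => ((hSq j).const_mul 2).add (hq2 j)
  have hi2 : ∀ j, Integrable
      (fun ω => 4 * (incSum M A u j ω * (A (u (j + 1)) ω - A (u j) ω)) + q j ω ^ 2) P :=
    fun j => ((hSe j j).const_mul 4).add (hq2 j)
  rw [integral_finsetSum _ fun j _ => hi1 j]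
  have hterm : ∀ j, ∫ ω, (2 * (incSum M A u j ω * q j ω) + q j ω ^ 2) ∂P
      = ∫ ω, (4 * (incSum M A u j ω * (A (u (j + 1)) ω - A (u j) ω)) + q j ω ^ 2) ∂P := fun j => by
    have e := h.integral_real_mul_sq (hu j.le_succ) (h.stronglyMeasurable_incSum hu j)
      (fun ω => h.abs_incSum_le hu j ω)
    rw [integral_add ((hSq j).const_mul 2) (hq2 j),
      integral_add ((hSe j j).const_mul 4) (hq2 j), integral_const_mul, integral_const_mul]
    rw [integral_const_mul] at e
    change 2 * (∫ ω, incSum M A u j ω * ((M (u (j + 1)) ω - M (u j) ω) ^ 2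
      + (A (u (j + 1)) ω - A (u j) ω)) ∂P) + _ = _
    rw [e]
    ring
  simp only [hterm]
  rw [← integral_finsetSum _ fun j _ => hi2 j]
  have hbound : ∀ ω, ∑ j ∈ Finset.range n,
      (4 * (incSum M A u j ω * (A (u (j + 1)) ω - A (u j) ω)) + q j ω ^ 2)
      ≤ (4 * K + (4 * R ^ 2 + K)) * incSum M A u n ω := fun ω => by
    have hS0 := h.incSum_nonneg hu n ω
    calc _ ≤ ∑ j ∈ Finset.range n, (4 * incSum M A u n ω * (A (u (j + 1)) ω - A (u j) ω)
          + (4 * R ^ 2 + K) * q j ω) := by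
          refine Finset.sum_le_sum fun j hj => add_le_add ?_ ?_
          · rw [← mul_assoc]
            refine mul_le_mul_of_nonneg_right ?_ (h.inc_nonneg hu j ω)
            linarith [h.incSum_mono hu (Finset.mem_range.1 hj).le ω]
          · rw [pow_two]
            exact mul_le_mul_of_nonneg_right (hqc j ω) (hq0 j ω)
      _ = 4 * incSum M A u n ω * (A (u n) ω - A (u 0) ω)
          + (4 * R ^ 2 + K) * incSum M A u n ω := by
          rw [Finset.sum_add_distrib, ← Finset.mul_sum, ← Finset.mul_sum,
            Finset.sum_range_sub (fun j => A (u j) ω)]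
          rfl
      _ ≤ _ := by
          have := mul_le_mul_of_nonneg_left (h.inc_le (u 0) (u n) ω)
            (show 0 ≤ 4 * incSum M A u n ω by linarith)
          linarith
  calc _ ≤ ∫ ω, (4 * K + (4 * R ^ 2 + K)) * incSum M A u n ω ∂P := by
        refine integral_mono ?_ ((h.integrable_incSum hu n).const_mul _) hbound
        exact integrable_finsetSum _ fun j _ => hi2 j
    _ ≤ _ := by
        rw [integral_const_mul]
        exact mul_le_mul_of_nonneg_left (h.integral_incSum_le hu n) (by positivity)

/-- The exponential process `exp (i ξ M + ξ² A / 2)`. -/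
noncomputable def expProc (M A : ℝ≥0 → Ω → ℝ) (ξ : ℝ) (t : ℝ≥0) (ω : Ω) : ℂ :=
  Complex.exp (Complex.I * ξ * M t ω + ξ ^ 2 / 2 * A t ω)

omit [IsProbabilityMeasure P] in
lemma norm_expProc (M A : ℝ≥0 → Ω → ℝ) (ξ : ℝ) (t : ℝ≥0) (ω : Ω) :
    ‖expProc M A ξ t ω‖ = Real.exp (ξ ^ 2 / 2 * A t ω) := by
  rw [expProc, Complex.norm_exp]
  congr 1
  have : Complex.I * ξ * M t ω + (ξ : ℂ) ^ 2 / 2 * A t ω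
      = ((ξ ^ 2 / 2 * A t ω : ℝ) : ℂ) + ((ξ * M t ω : ℝ) : ℂ) * Complex.I := by
    push_cast
    ring
  rw [this, Complex.add_re, Complex.ofReal_re, Complex.re_ofReal_mul, Complex.I_re, mul_zero,
    add_zero]

omit [IsProbabilityMeasure P] in
lemma norm_expProc_le (h : BoundedPair 𝓖 P M A R K) (ξ : ℝ) (t : ℝ≥0) (ω : Ω) :
    ‖expProc M A ξ t ω‖ ≤ Real.exp (ξ ^ 2 / 2 * K) := by
  rw [norm_expProc]
  exact Real.exp_le_exp.2 (mul_le_mul_of_nonneg_left (h.le t ω) (by positivity))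

omit [IsProbabilityMeasure P] in
lemma stronglyMeasurable_expProc (h : BoundedPair 𝓖 P M A R K) (ξ : ℝ) (t : ℝ≥0) :
    StronglyMeasurable[𝓖 t] (expProc M A ξ t) := by
  have hM := Complex.continuous_ofReal.comp_stronglyMeasurable (h.martingale.1 t)
  have hA := Complex.continuous_ofReal.comp_stronglyMeasurable (h.adapted t)
  exact Complex.continuous_exp.comp_stronglyMeasurable
    ((hM.const_mul (Complex.I * ξ)).add (hA.const_mul ((ξ : ℂ) ^ 2 / 2)))

end BoundedPair

end RandomVarianceCLT

/-! ### The exponential martingale. -/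

namespace RandomVarianceCLT

namespace BoundedPair

variable {Ω : Type*} {mΩ : MeasurableSpace Ω} {P : Measure Ω} {𝓖 : Filtration ℝ≥0 mΩ}
  {M A : ℝ≥0 → Ω → ℝ} {R K : ℝ}

/-- The constant in the second order expansion of the exponential process. -/
noncomputable def expConst (ξ R K : ℝ) : ℝ :=
  (|ξ| + ξ ^ 2 / 2) ^ 3 * (2 * (1 + K)) * Real.exp ((|ξ| + ξ ^ 2 / 2) * (2 * R + K))
    + (|ξ| ^ 3 + ξ ^ 4)

/-- The third order error of the exponential process over the interval `[s, t]`. -/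
noncomputable def stepError (M A : ℝ≥0 → Ω → ℝ) (s t : ℝ≥0) (ω : Ω) : ℝ :=
  (|M t ω - M s ω| + (A t ω - A s ω)) * ((M t ω - M s ω) ^ 2 + (A t ω - A s ω))

variable [IsProbabilityMeasure P]

omit [IsProbabilityMeasure P] in
lemma aestronglyMeasurable_stepError (h : BoundedPair 𝓖 P M A R K) (s t : ℝ≥0) :
    AEStronglyMeasurable (stepError M A s t) P := by
  have hM := (h.aestronglyMeasurable_left t).sub (h.aestronglyMeasurable_left s)
  have hA := (h.aestronglyMeasurable_right t).sub (h.aestronglyMeasurable_right s)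
  exact (hM.norm.add hA).mul ((hM.pow 2).add hA)

omit [IsProbabilityMeasure P] in
lemma stepError_nonneg (h : BoundedPair 𝓖 P M A R K) {s t : ℝ≥0} (hst : s ≤ t) (ω : Ω) :
    0 ≤ stepError M A s t ω := by
  have : 0 ≤ A t ω - A s ω := sub_nonneg.2 (h.mono ω hst)
  unfold stepError
  positivity

lemma integrable_stepError (h : BoundedPair 𝓖 P M A R K) {s t : ℝ≥0} (hst : s ≤ t) :
    Integrable (stepError M A s t) P := by
  refine Integrable.of_bound (h.aestronglyMeasurable_stepError s t)
    ((2 * R + K) * (4 * R ^ 2 + K)) (ae_of_all _ fun ω => ?_)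
  rw [Real.norm_of_nonneg (h.stepError_nonneg hst ω)]
  have h0 : 0 ≤ A t ω - A s ω := sub_nonneg.2 (h.mono ω hst)
  have h1 : |M t ω - M s ω| + (A t ω - A s ω) ≤ 2 * R + K :=
    add_le_add (h.abs_sub_le s t ω) (h.inc_le s t ω)
  exact mul_le_mul h1 (h.inc_sq_le s t ω) (by positivity)
    ((add_nonneg (abs_nonneg _) h0).trans h1)

/-- Factoring `g` times the exponential at time `s` out of the difference leaves an exponential of
increments. Its second order part integrates to zero against this past factor; only the remainder
survives. -/
lemma norm_integral_mul_expProc_sub_le (h : BoundedPair 𝓖 P M A R K) (ξ : ℝ) {s t : ℝ≥0}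
    (hst : s ≤ t) {g : Ω → ℂ} (hg : StronglyMeasurable[𝓖 s] g) {C : ℝ} (hC : ∀ ω, ‖g ω‖ ≤ C) :
    ‖(∫ ω, g ω * expProc M A ξ t ω ∂P) - ∫ ω, g ω * expProc M A ξ s ω ∂P‖
      ≤ C * Real.exp (ξ ^ 2 / 2 * K) * expConst ξ R K * ∫ ω, stepError M A s t ω ∂P := by
  set L : Ω → ℂ := fun ω => g ω * expProc M A ξ s ω with hL
  have hLm : StronglyMeasurable[𝓖 s] L := hg.mul (h.stronglyMeasurable_expProc ξ s)
  have hLC : ∀ ω, ‖L ω‖ ≤ C * Real.exp (ξ ^ 2 / 2 * K) := fun ω => by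
    rw [hL, norm_mul]
    exact mul_le_mul (hC ω) (h.norm_expProc_le ξ s ω) (norm_nonneg _)
      ((norm_nonneg _).trans (hC ω))
  have hgm : AEStronglyMeasurable g P := (hg.mono (𝓖.le s)).aestronglyMeasurable
  have hEm : ∀ r, AEStronglyMeasurable (expProc M A ξ r) P := fun r =>
    ((h.stronglyMeasurable_expProc ξ r).mono (𝓖.le r)).aestronglyMeasurable
  have hEi : ∀ r, Integrable (fun ω => g ω * expProc M A ξ r ω) P := fun r =>
    (Integrable.of_bound (hEm r) _ (ae_of_all _ (h.norm_expProc_le ξ r))).bdd_mul hgm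
      (ae_of_all _ hC)
  have hLm' : AEStronglyMeasurable L P := (hLm.mono (𝓖.le s)).aestronglyMeasurable
  have i1 : Integrable (fun ω => L ω * ((M t ω - M s ω : ℝ) : ℂ)) P :=
    (((h.martingale.integrable t).sub
      (h.martingale.integrable s)).ofReal (𝕜 := ℂ)).bdd_mul hLm' (ae_of_all _ hLC)
  have i2 : Integrable
      (fun ω => L ω * (((A t ω - A s ω) - (M t ω - M s ω) ^ 2 : ℝ) : ℂ)) P :=
    (((h.integrable_inc s t).sub (h.integrable_sq_inc s t)).ofReal (𝕜 := ℂ)).bdd_mul hLm'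
      (ae_of_all _ hLC)
  set d : Ω → ℝ := fun ω => M t ω - M s ω with hd
  set e : Ω → ℝ := fun ω => A t ω - A s ω with he
  have hkey : (∫ ω, g ω * expProc M A ξ t ω ∂P) - ∫ ω, g ω * expProc M A ξ s ω ∂P
      = ∫ ω, L ω * (Complex.exp (Complex.I * ξ * d ω + ξ ^ 2 / 2 * e ω) - 1
        - (Complex.I * ξ * d ω + ξ ^ 2 / 2 * (e ω - d ω ^ 2))) ∂P := by
    have hpt : ∀ ω, L ω * (Complex.exp (Complex.I * ξ * d ω + ξ ^ 2 / 2 * e ω) - 1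
        - (Complex.I * ξ * d ω + ξ ^ 2 / 2 * (e ω - d ω ^ 2)))
        = (g ω * expProc M A ξ t ω - g ω * expProc M A ξ s ω)
          - (Complex.I * ξ * (L ω * ((M t ω - M s ω : ℝ) : ℂ))
            + ξ ^ 2 / 2 * (L ω * (((A t ω - A s ω) - (M t ω - M s ω) ^ 2 : ℝ) : ℂ))) := fun ω => by
      have hexp : expProc M A ξ t ω
          = expProc M A ξ s ω * Complex.exp (Complex.I * ξ * d ω + ξ ^ 2 / 2 * e ω) := by
        rw [expProc, expProc, ← Complex.exp_add]
        congr 1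
        simp only [hd, he]
        push_cast
        ring
      rw [hexp]
      simp only [hL, hd, he]
      push_cast
      ring
    simp only [hpt]
    have i3 : Integrable (fun ω => g ω * expProc M A ξ t ω - g ω * expProc M A ξ s ω) P :=
      (hEi t).sub (hEi s)
    have i4 : Integrable (fun ω => Complex.I * ξ * (L ω * ((M t ω - M s ω : ℝ) : ℂ))
            + ξ ^ 2 / 2 * (L ω * (((A t ω - A s ω) - (M t ω - M s ω) ^ 2 : ℝ) : ℂ))) P :=
      (i1.const_mul _).add (i2.const_mul _)
    rw [integral_sub i3 i4, integral_sub (hEi t) (hEi s),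
      integral_add (i1.const_mul _) (i2.const_mul _), integral_const_mul, integral_const_mul,
      integral_complex_mul_martingale h.martingale hst hLm hLC, h.integral_mul_sq hst hLm hLC]
    simp
  rw [hkey, ← integral_const_mul]
  refine (norm_integral_le_integral_norm _).trans ?_
  refine integral_mono_of_nonneg (ae_of_all _ fun ω => norm_nonneg _)
    ((h.integrable_stepError hst).const_mul _) (ae_of_all _ fun ω => ?_)
  have hrem : ‖Complex.exp (Complex.I * ξ * d ω + ξ ^ 2 / 2 * e ω) - 1
      - (Complex.I * ξ * d ω + ξ ^ 2 / 2 * (e ω - d ω ^ 2))‖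
      ≤ expConst ξ R K * stepError M A s t ω :=
    norm_exp_sub_second_order_le (h.abs_sub_le s t ω)
      (sub_nonneg.2 (h.mono ω hst)) (h.inc_le s t ω)
  refine (norm_mul_le _ _).trans ((mul_le_mul (hLC ω) hrem (norm_nonneg _)
    ((norm_nonneg _).trans (hLC ω))).trans_eq ?_)
  exact (mul_assoc _ _ _).symm

/-- The `j`-th point of the regular subdivision of `[s, t]` into `N + 1` intervals. -/
noncomputable def subdiv (s t : ℝ≥0) (N j : ℕ) : ℝ≥0 := s + (t - s) * (j / (N + 1))

lemma monotone_subdiv (s t : ℝ≥0) (N : ℕ) : Monotone (subdiv s t N) := fun i j hij => by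
  unfold subdiv
  gcongr

lemma subdiv_zero (s t : ℝ≥0) (N : ℕ) : subdiv s t N 0 = s := by simp [subdiv]

lemma subdiv_last {s t : ℝ≥0} (hst : s ≤ t) (N : ℕ) : subdiv s t N (N + 1) = t := by
  have : ((N + 1 : ℕ) : ℝ≥0) / (N + 1) = 1 := by
    push_cast
    exact div_self (by positivity)
  rw [subdiv, this, mul_one, add_tsub_cancel_of_le hst]

lemma dist_subdiv (s t : ℝ≥0) (N j : ℕ) :
    dist (subdiv s t N (j + 1)) (subdiv s t N j) = (t - s : ℝ≥0) * (1 / ((N : ℝ) + 1)) := by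
  rw [NNReal.dist_eq]
  unfold subdiv
  push_cast
  rw [add_sub_add_left_eq_sub, ← mul_sub, ← sub_div, add_sub_cancel_left]
  exact abs_of_nonneg (by positivity)

/-- The largest increment of `M` and `A` along the regular subdivision of `[s, t]`. -/
noncomputable def maxInc (M A : ℝ≥0 → Ω → ℝ) (s t : ℝ≥0) (N : ℕ) (ω : Ω) : ℝ :=
  (Finset.range (N + 1)).sup' Finset.nonempty_range_add_one fun j =>
    |M (subdiv s t N (j + 1)) ω - M (subdiv s t N j) ω|
      + (A (subdiv s t N (j + 1)) ω - A (subdiv s t N j) ω)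

omit [IsProbabilityMeasure P] in
lemma maxInc_nonneg (h : BoundedPair 𝓖 P M A R K) (s t : ℝ≥0) (N : ℕ) (ω : Ω) :
    0 ≤ maxInc M A s t N ω := by
  refine le_trans ?_ (Finset.le_sup' _ (Finset.mem_range.2 N.succ_pos))
  exact add_nonneg (abs_nonneg _) (h.inc_nonneg (monotone_subdiv s t N) 0 ω)

omit [IsProbabilityMeasure P] in
lemma maxInc_le (h : BoundedPair 𝓖 P M A R K) (s t : ℝ≥0) (N : ℕ) (ω : Ω) :
    maxInc M A s t N ω ≤ 2 * R + K :=
  Finset.sup'_le _ _ fun _ _ => add_le_add (h.abs_sub_le _ _ ω) (h.inc_le _ _ ω)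

omit [IsProbabilityMeasure P] in
lemma measurable_maxInc (h : BoundedPair 𝓖 P M A R K) (s t : ℝ≥0) (N : ℕ) :
    Measurable (maxInc M A s t N) := by
  refine Finset.measurable_range_sup'' fun j _ => ?_
  have hM : ∀ r, Measurable (M r) := fun r => ((h.martingale.1 r).mono (𝓖.le r)).measurable
  have hA : ∀ r, Measurable (A r) := fun r => ((h.adapted r).mono (𝓖.le r)).measurable
  exact (((hM _).sub (hM _)).abs).add ((hA _).sub (hA _))

omit [IsProbabilityMeasure P] in
lemma tendsto_maxInc (h : BoundedPair 𝓖 P M A R K) {s t : ℝ≥0} (hst : s ≤ t) (ω : Ω) :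
    Tendsto (fun N => maxInc M A s t N ω) atTop (𝓝 0) := by
  have huc : ∀ f : ℝ≥0 → ℝ, Continuous f → ∀ ε > 0, ∀ᶠ N : ℕ in atTop, ∀ j ≤ N,
      |f (subdiv s t N (j + 1)) - f (subdiv s t N j)| < ε := by
    intro f hf ε hε
    have := (isCompact_Icc (a := (0 : ℝ≥0)) (b := t)).uniformContinuousOn_of_continuous
      hf.continuousOn
    obtain ⟨δ, hδ, hfδ⟩ := Metric.uniformContinuousOn_iff.1 this ε hε
    have hlim : Tendsto (fun N : ℕ => ((t - s : ℝ≥0) : ℝ) * (1 / ((N : ℝ) + 1))) atTop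
        (𝓝 (((t - s : ℝ≥0) : ℝ) * 0)) :=
      tendsto_const_nhds.mul tendsto_one_div_add_atTop_nhds_zero_nat
    rw [mul_zero] at hlim
    filter_upwards [hlim.eventually (gt_mem_nhds hδ)] with N hN j hj
    have hmem : ∀ i ≤ N + 1, subdiv s t N i ∈ Set.Icc (0 : ℝ≥0) t := fun i hi =>
      ⟨zero_le, (monotone_subdiv s t N hi).trans_eq (subdiv_last hst N)⟩
    have := hfδ _ (hmem (j + 1) (by omega)) _ (hmem j (by omega))
      (by rw [dist_subdiv]; exact hN)
    rwa [Real.dist_eq] at this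
  refine Metric.tendsto_atTop.2 fun ε hε => ?_
  obtain ⟨N₀, hN₀⟩ := eventually_atTop.1 ((huc _ (h.continuous_left ω) (ε / 2) (by positivity)).and
    (huc _ (h.continuous_right ω) (ε / 2) (by positivity)))
  refine ⟨N₀, fun N hN => ?_⟩
  rw [Real.dist_eq, sub_zero, abs_of_nonneg (h.maxInc_nonneg s t N ω)]
  refine (Finset.sup'_lt_iff _).2 fun j hj => ?_
  have hj' : j ≤ N := Nat.lt_succ_iff.1 (Finset.mem_range.1 hj)
  have h1 := (hN₀ N hN).1 j hj'
  have h2 := lt_of_abs_lt ((hN₀ N hN).2 j hj')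
  linarith

/-- Pointwise the sum is at most the largest increment times the sum of squares. The weight `η`
splits the product into a part that vanishes as the subdivision is refined and a part uniformly
small in `η`. -/
lemma integral_sum_stepError_le (h : BoundedPair 𝓖 P M A R K) (s t : ℝ≥0) (N : ℕ) {η : ℝ}
    (hη : 0 < η) :
    ∑ j ∈ Finset.range (N + 1),
      ∫ ω, stepError M A (subdiv s t N j) (subdiv s t N (j + 1)) ω ∂P
      ≤ (∫ ω, maxInc M A s t N ω ^ 2 ∂P) / η
        + η * ((4 * K + (4 * R ^ 2 + K)) * (2 * K)) := by
  have hmono := monotone_subdiv s t N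
  have hSi : Integrable (fun ω => incSum M A (subdiv s t N) (N + 1) ω ^ 2) P := by
    refine Integrable.of_bound
      ((((h.stronglyMeasurable_incSum hmono (N + 1)).mono (𝓖.le _)).pow 2).aestronglyMeasurable)
      (((N + 1 : ℕ) * (4 * R ^ 2 + K)) ^ 2) (ae_of_all _ fun ω => ?_)
    · rw [norm_pow]
      exact pow_le_pow_left₀ (norm_nonneg _) (h.abs_incSum_le hmono (N + 1) ω) 2
  have hDi : Integrable (fun ω => maxInc M A s t N ω ^ 2) P := by
    refine Integrable.of_bound ((h.measurable_maxInc s t N).pow_const 2).aestronglyMeasurable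
      ((2 * R + K) ^ 2) (ae_of_all _ fun ω => ?_)
    rw [norm_pow, Real.norm_of_nonneg (h.maxInc_nonneg s t N ω)]
    exact pow_le_pow_left₀ (h.maxInc_nonneg s t N ω) (h.maxInc_le s t N ω) 2
  rw [← integral_finsetSum _ fun j _ => h.integrable_stepError (hmono j.le_succ)]
  calc _ ≤ ∫ ω, (maxInc M A s t N ω ^ 2 / η
        + η * incSum M A (subdiv s t N) (N + 1) ω ^ 2) ∂P := by
        refine integral_mono (integrable_finsetSum _ fun j _ =>
          h.integrable_stepError (hmono j.le_succ)) ((hDi.div_const η).add (hSi.const_mul η))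
          fun ω => ?_
        have h1 : ∑ j ∈ Finset.range (N + 1),
            stepError M A (subdiv s t N j) (subdiv s t N (j + 1)) ω
            ≤ maxInc M A s t N ω * incSum M A (subdiv s t N) (N + 1) ω := by
          rw [incSum, Finset.mul_sum]
          refine Finset.sum_le_sum fun j hj => ?_
          refine mul_le_mul_of_nonneg_right ?_ (h.incSum_term_nonneg hmono j ω)
          exact Finset.le_sup' (fun j => |M (subdiv s t N (j + 1)) ω - M (subdiv s t N j) ω|
            + (A (subdiv s t N (j + 1)) ω - A (subdiv s t N j) ω)) hj
        refine h1.trans ?_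
        set a := maxInc M A s t N ω
        set b := incSum M A (subdiv s t N) (N + 1) ω
        have h2 : a * b = (a / η) * (η * b) := by field_simp
        -- Completing the square gives the weighted inequality `a b ≤ a² / η + η b²`.
        have h3 : a ^ 2 / η + η * b ^ 2 - a * b
            = (3 / 4 * (a ^ 2 / η)) + η * (b - a / (2 * η)) ^ 2 := by
          field_simp
          ring
        have h4 : 0 ≤ (3 / 4 * (a ^ 2 / η)) + η * (b - a / (2 * η)) ^ 2 := by positivity
        linarith
    _ = (∫ ω, maxInc M A s t N ω ^ 2 ∂P) / η
        + η * ∫ ω, incSum M A (subdiv s t N) (N + 1) ω ^ 2 ∂P := by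
        rw [integral_add (hDi.div_const η) (hSi.const_mul η), integral_div, integral_const_mul]
    _ ≤ _ := by
        gcongr
        exact h.integral_incSum_sq_le hmono (N + 1)

/-- The exponential process of a bounded pair is a martingale. -/
theorem integral_mul_expProc (h : BoundedPair 𝓖 P M A R K) (ξ : ℝ) {s t : ℝ≥0}
    (hst : s ≤ t) {g : Ω → ℂ} (hg : StronglyMeasurable[𝓖 s] g) {C : ℝ} (hC : ∀ ω, ‖g ω‖ ≤ C) :
    ∫ ω, g ω * expProc M A ξ t ω ∂P = ∫ ω, g ω * expProc M A ξ s ω ∂P := by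
  obtain ⟨ω₀⟩ : Nonempty Ω := P.nonempty_of_neZero
  have hC0 : 0 ≤ C := (norm_nonneg _).trans (hC ω₀)
  have hK : 0 ≤ K := (h.nonneg 0 ω₀).trans (h.le 0 ω₀)
  set B := C * Real.exp (ξ ^ 2 / 2 * K) * expConst ξ R K with hB
  have hB0 : 0 ≤ B := by
    have : 0 ≤ expConst ξ R K := by unfold expConst; positivity
    positivity
  set C₂ := (4 * K + (4 * R ^ 2 + K)) * (2 * K)
  have hC₂ : 0 ≤ C₂ := by positivity
  have hstep : ∀ N : ℕ, ∀ η > 0, ‖(∫ ω, g ω * expProc M A ξ t ω ∂P)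
      - ∫ ω, g ω * expProc M A ξ s ω ∂P‖
      ≤ B * ((∫ ω, maxInc M A s t N ω ^ 2 ∂P) / η + η * C₂) := by
    intro N η hη
    have hmono := monotone_subdiv s t N
    -- The difference between `s` and `t` is telescoped along the subdivision.
    have hd := dist_le_range_sum_dist
      (fun j => ∫ ω, g ω * expProc M A ξ (subdiv s t N j) ω ∂P) (N + 1)
    rw [dist_comm, dist_eq_norm, subdiv_last hst, subdiv_zero] at hd
    refine hd.trans ?_
    refine le_trans (Finset.sum_le_sum (g := fun j => B * ∫ ω, stepError M A (subdiv s t N j)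
      (subdiv s t N (j + 1)) ω ∂P) fun j _ => ?_) ?_
    · rw [dist_comm, dist_eq_norm]
      exact h.norm_integral_mul_expProc_sub_le ξ (hmono j.le_succ)
        (hg.mono (𝓖.mono ((subdiv_zero s t N).symm.le.trans (hmono j.zero_le)))) hC
    · rw [← Finset.mul_sum]
      exact mul_le_mul_of_nonneg_left (h.integral_sum_stepError_le s t N hη) hB0
  have hlim : Tendsto (fun N => ∫ ω, maxInc M A s t N ω ^ 2 ∂P) atTop (𝓝 0) := by
    have := tendsto_integral_of_dominated_convergence (μ := P)
      (F := fun N ω => maxInc M A s t N ω ^ 2) (f := fun _ => (0 : ℝ)) (fun _ => (2 * R + K) ^ 2)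
      (fun N => ((h.measurable_maxInc s t N).pow_const 2).aestronglyMeasurable)
      (integrable_const _) (fun N => ae_of_all _ fun ω => by
        rw [norm_pow, Real.norm_of_nonneg (h.maxInc_nonneg s t N ω)]
        exact pow_le_pow_left₀ (h.maxInc_nonneg s t N ω) (h.maxInc_le s t N ω) 2)
      (ae_of_all _ fun ω => by simpa using (h.tendsto_maxInc hst ω).pow 2)
    simpa using this
  -- The mesh goes to zero at fixed `η`; only afterwards does `η`.
  have hη : ∀ η > 0, ‖(∫ ω, g ω * expProc M A ξ t ω ∂P)
      - ∫ ω, g ω * expProc M A ξ s ω ∂P‖ ≤ B * (η * C₂) := by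
    intro η hη
    have h1 := ((hlim.div_const η).add_const (η * C₂)).const_mul B
    rw [zero_div, zero_add] at h1
    exact ge_of_tendsto' h1 fun N => hstep N η hη
  have hfin : Tendsto (fun η : ℝ => B * (η * C₂)) (𝓝[>] 0) (𝓝 (B * (0 * C₂))) := by
    refine Tendsto.mono_left ?_ nhdsWithin_le_nhds
    exact (Continuous.tendsto (by fun_prop) 0)
  rw [zero_mul, mul_zero] at hfin
  have h0 := ge_of_tendsto hfin (eventually_nhdsWithin_of_forall fun η hη' => hη η hη')
  exact sub_eq_zero.1 (norm_le_zero_iff.1 h0)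

end BoundedPair

end RandomVarianceCLT

/-! ### Localization, the maximal inequality and finiteness of the bracket. -/

namespace RandomVarianceCLT

variable {Ω : Type*} {mΩ : MeasurableSpace Ω} {P : Measure Ω} {𝓖 : Filtration ℝ≥0 mΩ}

/-- An `L¹`-bounded continuous martingale `M` and its quadratic variation `A`, all of whose paths
are regular. -/
structure ContinuousPair (𝓖 : Filtration ℝ≥0 mΩ) (P : Measure Ω) (M A : ℝ≥0 → Ω → ℝ) (c : ℝ) :
    Prop where
  martingale : Martingale M 𝓖 P
  continuous_left : ∀ ω, Continuous fun t => M t ω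
  integral_abs_le : ∀ t, ∫ ω, |M t ω| ∂P ≤ c
  adapted : StronglyAdapted 𝓖 A
  continuous_right : ∀ ω, Continuous fun t => A t ω
  mono : ∀ ω, Monotone fun t => A t ω
  zero : ∀ ω, A 0 ω = 0
  isLocalMartingale : IsLocalMartingale (fun t ω => M t ω ^ 2 - A t ω) 𝓖 P

/-- The indicators tend to zero almost surely, hence so do the measures by dominated convergence;
the events need not be monotone. -/
lemma exists_measure_le_of_eventually_notMem [IsFiniteMeasure P] {S : ℕ → Set Ω}
    (hS : ∀ n, MeasurableSet (S n)) (h : ∀ᵐ ω ∂P, ∀ᶠ n in atTop, ω ∉ S n) {ε : ENNReal}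
    (hε : ε ≠ 0) : ∃ n, P (S n) ≤ ε := by
  have hlim : Tendsto (fun n => P (S n)) atTop (𝓝 (P ∅)) := by
    refine tendsto_measure_of_ae_tendsto_indicator_of_isFiniteMeasure atTop MeasurableSet.empty hS ?_
    filter_upwards [h] with ω hω
    filter_upwards [hω] with n hn
    simp [hn]
  rw [measure_empty] at hlim
  exact ((hlim.eventually (gt_mem_nhds (pos_iff_ne_zero.2 hε))).mono fun n hn => hn.le).exists

lemma le_apply_truncTime_levelTime {f : ℝ≥0 → Ω → ℝ} {c : ℝ}
    (hc : ∀ ω, Continuous fun t => f t ω) {ω : Ω} {T : ℝ≥0} (hT : levelTime f c ω ≤ T) :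
    c ≤ f (truncTime (levelTime f c) T ω) ω := by
  have h1 : (truncTime (levelTime f c) T ω : WithTop ℝ≥0) = levelTime f c ω := by
    rw [coe_truncTime, min_eq_right hT]
  obtain ⟨u, hu, hfu⟩ := (levelTime_le_iff hc ω _).1 h1.ge
  have h2 : levelTime f c ω ≤ u := (levelTime_le_iff hc ω u).2 ⟨u, le_rfl, hfu⟩
  rw [← h1, WithTop.coe_le_coe] at h2
  rwa [← le_antisymm hu h2]

/-- Doob's maximal inequality in continuous time. -/
lemma measure_exists_le_abs_le [IsProbabilityMeasure P] {M : ℝ≥0 → Ω → ℝ} {c : ℝ}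
    (hM : Martingale M 𝓖 P) (hc : ∀ ω, Continuous fun t => M t ω)
    (hb : ∀ t, ∫ ω, |M t ω| ∂P ≤ c) (T : ℝ≥0) {R : ℝ} (hR : 0 < R) :
    MeasurableSet {ω | ∃ t ≤ T, R ≤ |M t ω|} ∧
      P {ω | ∃ t ≤ T, R ≤ |M t ω|} ≤ ENNReal.ofReal (c / R) := by
  set f : ℝ≥0 → Ω → ℝ := fun t ω => |M t ω| with hf
  have hfc : ∀ ω, Continuous fun t => f t ω := fun ω => (hc ω).abs
  have hfa : StronglyAdapted 𝓖 f := fun t => continuous_abs.comp_stronglyMeasurable (hM.1 t)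
  have hst := isStoppingTime_levelTime (c := R) hfa hfc
  have hset : {ω | ∃ t ≤ T, R ≤ |M t ω|} = {ω | levelTime f R ω ≤ T} := by
    ext ω
    exact (levelTime_le_iff hfc ω T).symm
  rw [hset]
  have hmeas : MeasurableSet {ω | levelTime f R ω ≤ T} := 𝓖.le T _ (hst T)
  refine ⟨hmeas, ?_⟩
  have hint := integrable_stoppedProcess_of_continuous hM hc hst T
  -- If `|M|` reaches `R` before `T`, then `M` stopped at that hitting time has absolute value at
  -- least `R`: Markov's inequality applies to the stopped variable, whose `L¹` norm is at most that
  -- of `M T`.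
  have h1 := mul_meas_ge_le_integral_of_nonneg (μ := P)
    (f := fun ω => |(stoppedProcess M (levelTime f R) T ω)|)
    (ae_of_all _ fun ω => abs_nonneg _) hint.abs R
  have h2 : P.real {ω | levelTime f R ω ≤ T}
      ≤ P.real {ω | R ≤ |(stoppedProcess M (levelTime f R) T ω)|} :=
    measureReal_mono fun ω hω => le_apply_truncTime_levelTime hfc hω
  have h3 : P.real {ω | levelTime f R ω ≤ T} ≤ c / R := by
    rw [le_div_iff₀' hR]
    calc R * P.real {ω | levelTime f R ω ≤ T}
        ≤ R * P.real {ω | R ≤ |(stoppedProcess M (levelTime f R) T ω)|} := by gcongr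
      _ ≤ _ := h1
      _ ≤ _ := integral_abs_stoppedProcess_le hM hc hst T
      _ ≤ c := hb T
  rw [← ofReal_measureReal]
  exact ENNReal.ofReal_le_ofReal h3

namespace ContinuousPair

variable {M A : ℝ≥0 → Ω → ℝ} {c : ℝ} [IsProbabilityMeasure P]

/-- The pair stopped when `|M|` reaches `R` or `A` reaches `K`, and along a localizing sequence. -/
lemma exists_boundedPair_of_localized (h : ContinuousPair 𝓖 P M A c) {R K : ℝ} (hR : 0 < R)
    (hK : 0 < K) (T : ℝ≥0) {ε : ENNReal} (hε : ε ≠ 0) :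
    ∃ (M' A' : ℝ≥0 → Ω → ℝ) (D : Set Ω), BoundedPair 𝓖 P M' A' R K ∧ MeasurableSet D ∧ P D ≤ ε ∧
      ∀ ω ∉ D, ∀ t ≤ T, (∀ u ≤ t, |M u ω| < R) → A t ω < K →
        M' t ω = M t ω ∧ A' t ω = A t ω := by
  obtain ⟨τ, hτ, hmart⟩ := h.isLocalMartingale
  obtain ⟨k, hk⟩ := exists_measure_le_of_eventually_notMem (P := P)
    (S := fun k => {ω | τ k ω ≤ T}) (fun k => 𝓖.le T _ (hτ.isStoppingTime k T)) (by
      filter_upwards [hτ.tendsto_top] with ω hω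
      filter_upwards [(WithTop.tendsto_nhds_top_iff _).1 hω T] with n hn
      exact not_le.2 hn) hε
  set N : ℝ≥0 → Ω → ℝ := fun t ω => M t ω ^ 2 - A t ω with hN
  -- Taking the maximum of the two ratios lets a single hitting time, at level `1`, enforce both
  -- bounds.
  set f : ℝ≥0 → Ω → ℝ := fun t ω => max (|M t ω| / R) (A t ω / K) with hf
  have hfc : ∀ ω, Continuous fun t => f t ω := fun ω =>
    ((h.continuous_left ω).abs.div_const R).max ((h.continuous_right ω).div_const K)
  have hfa : StronglyAdapted 𝓖 f := fun t => by
    have h1 : StronglyMeasurable[𝓖 t] (fun ω => |M t ω| / R) :=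
      (continuous_abs.div_const R).comp_stronglyMeasurable (h.martingale.1 t)
    have h2 : StronglyMeasurable[𝓖 t] (fun ω => A t ω / K) :=
      (continuous_id.div_const K).comp_stronglyMeasurable (h.adapted t)
    exact (continuous_fst.max continuous_snd).comp_stronglyMeasurable (h1.prodMk h2)
  set ρ := levelTime f 1 with hρ
  have hρs : IsStoppingTime 𝓖 ρ := isStoppingTime_levelTime hfa hfc
  set σ : Ω → WithTop ℝ≥0 := fun ω => min (ρ ω) (τ k ω) with hσ
  have hσs : IsStoppingTime 𝓖 σ := hρs.min (hτ.isStoppingTime k)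
  have hNc : ∀ ω, Continuous fun t => N t ω := fun ω =>
    ((h.continuous_left ω).pow 2).sub (h.continuous_right ω)
  have hsq : (fun t ω => stopped M σ t ω ^ 2 - stopped A σ t ω) = stopped N σ := by
    ext t ω
    by_cases hpos : ⊥ < σ ω
    · simp only [stopped_of_pos hpos, hN]
    · simp [stopped_of_not_pos hpos]
  have hle : ∀ {ω : Ω}, ⊥ < σ ω → ∀ t, f (truncTime σ t ω) ω ≤ 1 := fun {ω} hpos t => by
    refine le_of_le_levelTime hfc (hpos.trans_le (min_le_left _ _)) ?_
    rw [coe_truncTime]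
    exact (min_le_right _ _).trans (min_le_left _ _)
  refine ⟨stopped M σ, stopped A σ, {ω | τ k ω ≤ T}, ?_, 𝓖.le T _ (hτ.isStoppingTime k T), hk, ?_⟩
  · refine ⟨martingale_stopped h.martingale h.continuous_left hσs,
      continuous_stopped h.continuous_left, stronglyAdapted_stopped h.adapted h.continuous_right hσs,
      continuous_stopped h.continuous_right, fun ω s t hst => ?_, fun ω => ?_, fun t ω => ?_,
      fun t ω => ?_, ?_⟩
    · by_cases hpos : ⊥ < σ ω
      · simp only [stopped_of_pos hpos]
        refine h.mono ω ?_
        rw [← WithTop.coe_le_coe, coe_truncTime, coe_truncTime]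
        exact min_le_min_right _ (WithTop.coe_le_coe.2 hst)
      · simp [stopped_of_not_pos hpos]
    · by_cases hpos : ⊥ < σ ω
      · have : truncTime σ 0 ω = 0 := le_antisymm (truncTime_le σ 0 ω) zero_le
        rw [stopped_of_pos hpos, this, h.zero]
      · simp [stopped_of_not_pos hpos]
    · by_cases hpos : ⊥ < σ ω
      · rw [stopped_of_pos hpos, ← div_le_one hR]
        exact (le_max_left _ _).trans (hle hpos t)
      · simp [stopped_of_not_pos hpos, hR.le]
    · by_cases hpos : ⊥ < σ ω
      · rw [stopped_of_pos hpos, ← div_le_one hK]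
        exact (le_max_right _ _).trans (hle hpos t)
      · simp [stopped_of_not_pos hpos, hK.le]
    -- Stopping at `τ k` gives a martingale by localization; stopping it further at `ρ` is optional
    -- stopping.
    · rw [hsq, hσ, ← stopped_stopped]
      exact martingale_stopped (hmart k) (continuous_stopped hNc) hρs
  · intro ω hω t htT hMt hAt
    have hρt : (t : WithTop ℝ≥0) < ρ ω := by
      refine not_le.1 fun hle => ?_
      obtain ⟨u, hu, hfu⟩ := (levelTime_le_iff hfc ω t).1 hle
      rcases le_max_iff.1 hfu with h1 | h1
      · exact absurd ((one_le_div hR).1 h1) (not_le.2 (hMt u hu))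
      · exact absurd ((one_le_div hK).1 h1) (not_le.2 ((h.mono ω hu).trans_lt hAt))
    have hτt : (t : WithTop ℝ≥0) < τ k ω :=
      (WithTop.coe_le_coe.2 htT).trans_lt (not_le.1 hω)
    have hσt : (t : WithTop ℝ≥0) < σ ω := lt_min hρt hτt
    have hpos : ⊥ < σ ω := bot_le.trans_lt hσt
    have htr : truncTime σ t ω = t := by
      rw [← WithTop.coe_inj, coe_truncTime, min_eq_left hσt.le]
    rw [stopped_of_pos hpos, stopped_of_pos hpos, htr]
    exact ⟨rfl, rfl⟩

/-- A continuous pair coincides with a bounded pair as long as `A` stays below `K`, outside an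
event of small probability. -/
theorem exists_boundedPair (h : ContinuousPair 𝓖 P M A c) {K : ℝ}
    (hK : 0 < K) (T : ℝ≥0) {ε : ENNReal} (hε : ε ≠ 0) :
    ∃ (M' A' : ℝ≥0 → Ω → ℝ) (R : ℝ) (D : Set Ω), BoundedPair 𝓖 P M' A' R K ∧ P D ≤ ε ∧
      ∀ ω ∉ D, ∀ t ≤ T, A t ω < K → M' t ω = M t ω ∧ A' t ω = A t ω := by
  -- Paths are bounded on `[0, T]`, so a high enough level `R = n + 1` is reached by `|M|` only with
  -- small probability.
  obtain ⟨n, hn⟩ := exists_measure_le_of_eventually_notMem (P := P) (ε := ε / 2)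
    (S := fun n : ℕ => {ω | ∃ t ≤ T, (n : ℝ) + 1 ≤ |M t ω|})
    (fun n => (measure_exists_le_abs_le h.martingale h.continuous_left h.integral_abs_le T
      (by positivity)).1) (ae_of_all _ fun ω => by
        obtain ⟨b, hb⟩ := (isCompact_Icc (a := (0 : ℝ≥0)) (b := T)).bddAbove_image
          (h.continuous_left ω).abs.continuousOn
        obtain ⟨m, hm⟩ := exists_nat_gt b
        filter_upwards [eventually_ge_atTop m] with n hn
        rintro ⟨t, ht, htn⟩
        have h1 : |M t ω| ≤ b := hb ⟨t, ⟨zero_le, ht⟩, rfl⟩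
        have h2 : (m : ℝ) ≤ n := by exact_mod_cast hn
        linarith) (ENNReal.half_pos hε).ne'
  obtain ⟨M', A', D, hb, -, hD, heq⟩ := h.exists_boundedPair_of_localized
    (R := (n : ℝ) + 1) (by positivity) hK T (ENNReal.half_pos hε).ne'
  refine ⟨M', A', _, D ∪ {ω | ∃ t ≤ T, (n : ℝ) + 1 ≤ |M t ω|}, hb, ?_, fun ω hω t ht hAt => ?_⟩
  · refine (measure_union_le _ _).trans ((add_le_add hD hn).trans_eq (ENNReal.add_halves ε))
  · rw [Set.mem_union, not_or] at hω
    refine heq ω hω.1 t ht (fun u hu => ?_) hAt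
    exact not_le.1 fun hle => hω.2 ⟨u, hu.trans ht, hle⟩

/-- For a bounded pair the expectation of `A T` is at most that of `M T ^ 2`, hence at most `R²`,
and Markov's inequality yields `R² / L`. The event that `|M|` reaches `R` costs `c / R`;
localization costs arbitrarily little. The bound is uniform in `T`. -/
lemma measure_le_right_le (h : ContinuousPair 𝓖 P M A c) (T : ℝ≥0) {R L : ℝ} (hR : 0 < R)
    (hL : 0 < L) : P {ω | L ≤ A T ω} ≤ ENNReal.ofReal (c / R) + ENNReal.ofReal (R ^ 2 / L) := by
  refine ENNReal.le_of_forall_pos_le_add fun ε hε _ => ?_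
  have hε' : (ε : ENNReal) / 2 ≠ 0 := (ENNReal.half_pos (by simpa using hε.ne')).ne'
  have hAm : Measurable (A T) := ((h.adapted T).mono (𝓖.le T)).measurable
  obtain ⟨k, hk⟩ := exists_measure_le_of_eventually_notMem (P := P) (ε := ε / 2)
    (S := fun k : ℕ => {ω | (k : ℝ) + 1 ≤ A T ω})
    (fun k => measurableSet_le measurable_const hAm) (ae_of_all _ fun ω => by
      obtain ⟨m, hm⟩ := exists_nat_gt (A T ω)
      filter_upwards [eventually_ge_atTop m] with k hk hle
      have h2 : (m : ℝ) ≤ k := by exact_mod_cast hk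
      have h3 : (k : ℝ) + 1 ≤ A T ω := hle
      linarith) hε'
  obtain ⟨M', A', D, hb, -, hD, heq⟩ := h.exists_boundedPair_of_localized
    hR (K := (k : ℝ) + 1) (by positivity) T hε'
  have hA' : P {ω | L ≤ A' T ω} ≤ ENNReal.ofReal (R ^ 2 / L) := by
    have h1 := mul_meas_ge_le_integral_of_nonneg (μ := P) (f := A' T)
      (ae_of_all _ (hb.nonneg T)) (hb.integrable_right T) L
    have h2 : ∫ ω, A' T ω ∂P ≤ R ^ 2 := by
      have e := hb.martingale_sq_sub.setIntegral_eq (zero_le : 0 ≤ T) MeasurableSet.univ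
      simp only [Measure.restrict_univ, hb.zero, sub_zero] at e
      have hsqi : Integrable (fun ω => M' T ω ^ 2) P :=
        Integrable.of_bound ((hb.aestronglyMeasurable_left T).pow 2) (R ^ 2)
          (ae_of_all _ fun ω => by
            rw [norm_pow]
            exact pow_le_pow_left₀ (norm_nonneg _) (hb.abs_le T ω) 2)
      rw [integral_sub hsqi (hb.integrable_right T)] at e
      have h3 : 0 ≤ ∫ ω, M' 0 ω ^ 2 ∂P := integral_nonneg fun _ => sq_nonneg _
      have h4 : ∫ ω, M' T ω ^ 2 ∂P ≤ ∫ _, R ^ 2 ∂P :=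
        integral_mono hsqi (integrable_const _) fun ω => by
          rw [← sq_abs]
          exact pow_le_pow_left₀ (abs_nonneg _) (hb.abs_le T ω) 2
      simp only [integral_const, probReal_univ, one_smul] at h4
      linarith
    rw [← ofReal_measureReal]
    refine ENNReal.ofReal_le_ofReal ?_
    rw [le_div_iff₀' hL]
    exact h1.trans h2
  have hsub : {ω | L ≤ A T ω} ⊆ ({ω | ∃ t ≤ T, R ≤ |M t ω|} ∪ {ω | L ≤ A' T ω})
      ∪ (D ∪ {ω | (k : ℝ) + 1 ≤ A T ω}) := by
    intro ω hω
    by_contra hn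
    simp only [Set.mem_union, not_or, Set.mem_ofPred_eq, not_exists, not_and, not_le] at hn
    obtain ⟨⟨h1, h2⟩, h3, h4⟩ := hn
    have := (heq ω h3 T le_rfl (fun u hu => h1 u hu) h4).2
    rw [this] at h2
    exact absurd h2 (not_lt.2 hω)
  calc P {ω | L ≤ A T ω} ≤ _ := measure_mono hsub
    _ ≤ (P {ω | ∃ t ≤ T, R ≤ |M t ω|} + P {ω | L ≤ A' T ω})
      + (P D + P {ω | (k : ℝ) + 1 ≤ A T ω}) :=
        (measure_union_le _ _).trans (add_le_add (measure_union_le _ _) (measure_union_le _ _))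
    _ ≤ (ENNReal.ofReal (c / R) + ENNReal.ofReal (R ^ 2 / L)) + (ε / 2 + ε / 2) :=
        add_le_add (add_le_add (measure_exists_le_abs_le h.martingale h.continuous_left
          h.integral_abs_le T hR).2 hA') (add_le_add hD hk)
    _ = _ := by rw [ENNReal.add_halves]

/-- The quadratic variation of an `L¹`-bounded continuous martingale is almost surely bounded. -/
theorem ae_bddAbove (h : ContinuousPair 𝓖 P M A c) :
    ∀ᵐ ω ∂P, BddAbove (Set.range fun t => A t ω) := by
  -- The level `R³` makes both error terms of order `1 / R`.
  have hunion : ∀ R : ℝ, 0 < R →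
      P (⋃ n : ℕ, {ω | R ^ 3 ≤ A n ω}) ≤ ENNReal.ofReal (c / R) + ENNReal.ofReal (1 / R) := by
    intro R hR
    have hmono : Monotone fun n : ℕ => {ω | R ^ 3 ≤ A n ω} := fun m n hmn ω hω =>
      le_trans (show R ^ 3 ≤ A m ω from hω) (h.mono ω (by exact_mod_cast hmn))
    rw [hmono.measure_iUnion]
    refine iSup_le fun n => ?_
    refine (h.measure_le_right_le n hR (by positivity : 0 < R ^ 3)).trans_eq ?_
    congr 2
    field_simp
  have hzero : P {ω | ¬ BddAbove (Set.range fun t => A t ω)} = 0 := by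
    have hlim : Tendsto (fun n : ℕ => ENNReal.ofReal (c / ((n : ℝ) + 1))
        + ENNReal.ofReal (1 / ((n : ℝ) + 1))) atTop (𝓝 0) := by
      have h1 : Tendsto (fun n : ℕ => 1 / ((n : ℝ) + 1)) atTop (𝓝 0) :=
        tendsto_one_div_add_atTop_nhds_zero_nat
      have h2 : Tendsto (fun n : ℕ => c / ((n : ℝ) + 1)) atTop (𝓝 0) := by
        simpa [div_eq_mul_inv] using h1.const_mul c
      simpa using (ENNReal.tendsto_ofReal h2).add (ENNReal.tendsto_ofReal h1)
    refine le_antisymm (ge_of_tendsto' hlim fun n => ?_) zero_le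
    refine (measure_mono fun ω hω => ?_).trans (hunion ((n : ℝ) + 1) (by positivity))
    obtain ⟨_, ⟨t, rfl⟩, ht⟩ := not_bddAbove_iff.1 hω (((n : ℝ) + 1) ^ 3)
    obtain ⟨m, hm⟩ := exists_nat_ge t
    exact Set.mem_iUnion.2 ⟨m, ht.le.trans (h.mono ω hm)⟩
  exact measure_eq_zero_iff_ae_notMem.1 hzero |>.mono fun ω hω => not_not.1 hω

end ContinuousPair

end RandomVarianceCLT

/-! ### The completed filtration and regular versions. -/

namespace RandomVarianceCLT

variable {Ω : Type*} {mΩ : MeasurableSpace Ω} {P : Measure Ω} {𝓕 𝓖 : Filtration ℝ≥0 mΩ}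

lemma le_completion (𝓕 : Filtration ℝ≥0 mΩ) (P : Measure Ω) (t : ℝ≥0) :
    (𝓕 t : MeasurableSpace Ω) ≤ completion 𝓕 P t :=
  le_inf le_eventuallyMeasurableSpace (𝓕.le t)

lemma measurableSet_completion_iff {t : ℝ≥0} {S : Set Ω} :
    MeasurableSet[completion 𝓕 P t] S ↔
      (∃ S', MeasurableSet[𝓕 t] S' ∧ S =ᵐ[P] S') ∧ MeasurableSet S :=
  MeasurableSpace.measurableSet_inf

lemma measurableSet_completion_of_ae {t : ℝ≥0} {S : Set Ω} (hS : MeasurableSet S)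
    (h : ∀ᵐ ω ∂P, ω ∈ S) : MeasurableSet[completion 𝓕 P t] S :=
  measurableSet_completion_iff.2 ⟨⟨Set.univ, MeasurableSet.univ, eventuallyEq_univ.2 h⟩, hS⟩

lemma measurable_completion_of_ae_eq {t : ℝ≥0} {f g : Ω → ℝ} (hf : Measurable f)
    (hg : Measurable[𝓕 t] g) (h : f =ᵐ[P] g) : Measurable[completion 𝓕 P t] f := fun B hB =>
  measurableSet_completion_iff.2 ⟨⟨g ⁻¹' B, hg hB, h.preimage B⟩, hf hB⟩

/-- Every event of the completion differs by a null set from an event of the original σ-algebra, so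
the integrals over both agree. -/
lemma condExp_completion [IsFiniteMeasure P] {f : Ω → ℝ} (hf : Integrable f P) (t : ℝ≥0) :
    P[f | 𝓕 t] =ᵐ[P] P[f | completion 𝓕 P t] := by
  refine ae_eq_condExp_of_forall_setIntegral_eq ((completion 𝓕 P).le t) hf
    (fun S _ _ => integrable_condExp.integrableOn) (fun S hS _ => ?_)
    ((stronglyMeasurable_condExp.mono (le_completion 𝓕 P t)).aestronglyMeasurable)
  obtain ⟨⟨S', hS', hSS'⟩, -⟩ := measurableSet_completion_iff.1 hS
  rw [setIntegral_congr_set hSS', setIntegral_condExp (𝓕.le t) hf hS', setIntegral_congr_set hSS']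

/-- The restriction of a filtration to the natural numbers. -/
def natFiltration (𝓖 : Filtration ℝ≥0 mΩ) : Filtration ℕ mΩ where
  seq n := 𝓖 n
  mono' _ _ h := 𝓖.mono (by exact_mod_cast h)
  le' n := 𝓖.le n

lemma iSup_natFiltration (𝓖 : Filtration ℝ≥0 mΩ) :
    ⨆ n, (natFiltration 𝓖 n : MeasurableSpace Ω) = ⨆ t, (𝓖 t : MeasurableSpace Ω) := by
  refine le_antisymm (iSup_le fun n => le_iSup (fun t => (𝓖 t : MeasurableSpace Ω)) (n : ℝ≥0))
    (iSup_le fun t => ?_)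
  obtain ⟨n, hn⟩ := exists_nat_ge t
  exact (𝓖.mono hn).trans (le_iSup (fun n => (natFiltration 𝓖 n : MeasurableSpace Ω)) n)

lemma ae_condExp_iSup_eq [IsFiniteMeasure P] {f : Ω → ℝ} (hf : Integrable f P)
    (hm : AEStronglyMeasurable[⨆ t, (𝓖 t : MeasurableSpace Ω)] f P) :
    P[f | ⨆ n, (natFiltration 𝓖 n : MeasurableSpace Ω)] =ᵐ[P] f :=
  condExp_of_aestronglyMeasurable' (iSup_le fun n => (natFiltration 𝓖).le n)
    (by rwa [iSup_natFiltration]) hf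

/-- Lévy's upward theorem in `L¹`, along integer times, which generate the same limit σ-algebra. -/
lemma tendsto_integral_abs_condExp_sub [IsFiniteMeasure P] {f : Ω → ℝ} (hf : Integrable f P)
    (hm : AEStronglyMeasurable[⨆ t, (𝓖 t : MeasurableSpace Ω)] f P) :
    Tendsto (fun n : ℕ => ∫ ω, |(P[f | 𝓖 n]) ω - f ω| ∂P) atTop (𝓝 0) := by
  have h := tendsto_eLpNorm_condExp (μ := P) (ℱ := natFiltration 𝓖) f
  have h2 := (ENNReal.tendsto_toReal ENNReal.zero_ne_top).comp h
  refine h2.congr fun n => ?_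
  have e : eLpNorm (P[f | natFiltration 𝓖 n]
      - P[f | ⨆ n, (natFiltration 𝓖 n : MeasurableSpace Ω)]) 1 P
      = eLpNorm (P[f | 𝓖 n] - f) 1 P :=
    eLpNorm_congr_ae ((ae_eq_refl _).sub (ae_condExp_iSup_eq hf hm))
  simp only [Function.comp]
  rw [e, eLpNorm_one_eq_lintegral_enorm,
    ← integral_norm_eq_lintegral_enorm (integrable_condExp.sub hf).1]
  rfl

/-- After modification on a null event and normalization, a continuous martingale and its
quadratic variation form a continuous pair. -/
theorem exists_continuousPair [IsProbabilityMeasure P] {W : Ω → ℝ} (hW : Integrable W P)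
    (hWm : AEStronglyMeasurable[⨆ t, (𝓕 t : MeasurableSpace Ω)] W P)
    {M A : ℝ≥0 → Ω → ℝ} (hM : ∀ t, M t =ᵐ[P] P[W | 𝓕 t])
    (hMc : ∀ᵐ ω ∂P, Continuous fun t => M t ω)
    (hA : IsQuadraticVariation M A (completion 𝓕 P) P) (v : ℝ) :
    ∃ (M' A' : ℝ≥0 → Ω → ℝ) (c : ℝ), ContinuousPair (completion 𝓕 P) P M' A' c ∧
      (∀ᵐ ω ∂P, ∀ t, M' t ω = M t ω / v ∧ A' t ω = A t ω / v ^ 2) ∧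
      ∀ᵐ ω ∂P, Tendsto (fun n : ℕ => M' n ω) atTop (𝓝 (W ω / v)) := by
  set 𝓖 := completion 𝓕 P with h𝓖
  obtain ⟨D, hDc, hDd⟩ := TopologicalSpace.exists_countable_dense ℝ≥0
  have hgood : ∀ᵐ ω ∂P, (Continuous fun t => M t ω) ∧ (Continuous fun t => A t ω) ∧
      (Monotone fun t => A t ω) ∧ A 0 ω = 0 ∧ ∀ q ∈ D, M q ω = (P[W | 𝓕 q]) ω := by
    have hq : ∀ᵐ ω ∂P, ∀ q ∈ D, M q ω = (P[W | 𝓕 q]) ω := (ae_ball_iff hDc).2 fun q _ => hM q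
    filter_upwards [hMc, hA.continuous_paths, hA.monotone_paths, hA.zero_at_zero, hq]
      with ω h1 h2 h3 h4 h5
    exact ⟨h1, h2, h3, h4, h5⟩
  -- A measurable conull set of good paths belongs to the completion at every time, so cutting off
  -- to it preserves adaptedness.
  obtain ⟨N, hN, hNm, hN0⟩ := exists_measurable_superset_of_null (mem_ae_iff.1 hgood)
  set S : Set Ω := Nᶜ with hS
  have hSm : MeasurableSet S := hNm.compl
  have hSae : ∀ᵐ ω ∂P, ω ∈ S := measure_eq_zero_iff_ae_notMem.1 hN0
  have hSgood : ∀ ω ∈ S, (Continuous fun t => M t ω) ∧ (Continuous fun t => A t ω) ∧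
      (Monotone fun t => A t ω) ∧ A 0 ω = 0 ∧ ∀ q ∈ D, M q ω = (P[W | 𝓕 q]) ω := fun ω hω => by
    by_contra hn
    exact hω (hN hn)
  have hS𝓖 : ∀ t, MeasurableSet[𝓖 t] S := fun t => measurableSet_completion_of_ae hSm hSae
  set M' : ℝ≥0 → Ω → ℝ := fun t => S.indicator fun ω => M t ω / v with hM'
  set A' : ℝ≥0 → Ω → ℝ := fun t => S.indicator fun ω => A t ω / v ^ 2 with hA'
  have hM'S : ∀ {ω}, ω ∈ S → ∀ t, M' t ω = M t ω / v := fun hω t => Set.indicator_of_mem hω _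
  have hA'S : ∀ {ω}, ω ∈ S → ∀ t, A' t ω = A t ω / v ^ 2 := fun hω t => Set.indicator_of_mem hω _
  have hM'n : ∀ {ω}, ω ∉ S → ∀ t, M' t ω = 0 := fun hω t => Set.indicator_of_notMem hω _
  have hA'n : ∀ {ω}, ω ∉ S → ∀ t, A' t ω = 0 := fun hω t => Set.indicator_of_notMem hω _
  -- `M t` is only almost everywhere equal to a measurable function. On `S` it is the limit, by path
  -- continuity, of conditional expectations at times of the countable dense set.
  have hM'meas : ∀ t, Measurable (M' t) := fun t => by
    obtain ⟨q, hqD, hqt⟩ := mem_closure_iff_seq_limit.1 (hDd t)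
    refine measurable_of_tendsto_metrizable (f := fun k =>
      S.indicator fun ω => (P[W | 𝓕 (q k)]) ω / v) (fun k => ?_) (tendsto_pi_nhds.2 fun ω => ?_)
    · exact ((stronglyMeasurable_condExp.mono (𝓕.le _)).measurable.div_const v).indicator hSm
    · by_cases hω : ω ∈ S
      · rw [hM'S hω]
        obtain ⟨hc, -, -, -, hq⟩ := hSgood ω hω
        refine (((hc.tendsto t).comp hqt).div_const v).congr fun k => ?_
        rw [Set.indicator_of_mem hω, Function.comp, hq _ (hqD k)]
      · rw [hM'n hω]
        refine tendsto_const_nhds.congr fun k => ?_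
        rw [Set.indicator_of_notMem hω]
  have hWv : Integrable (fun ω => W ω / v) P := hW.div_const v
  have hM'F : ∀ t, M' t =ᵐ[P] fun ω => (P[W | 𝓕 t]) ω / v := fun t => by
    filter_upwards [hSae, hM t] with ω h1 h2
    rw [hM'S h1, h2]
  have hM'G : ∀ t, M' t =ᵐ[P] P[fun ω => W ω / v | 𝓖 t] := fun t => by
    have h1 : P[fun ω => W ω / v | 𝓕 t] =ᵐ[P] fun ω => (P[W | 𝓕 t]) ω / v := by
      have := condExp_smul (μ := P) (v⁻¹) W (𝓕 t)
      filter_upwards [this] with ω hω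
      simp only [Pi.smul_apply, smul_eq_mul] at hω
      rw [div_eq_inv_mul, ← hω]
      congr 2
      ext ω
      simp [div_eq_inv_mul]
    exact (hM'F t).trans (h1.symm.trans (condExp_completion hWv t))
  have hM'ad : StronglyAdapted 𝓖 M' := fun t =>
    (measurable_completion_of_ae_eq (hM'meas t)
      (stronglyMeasurable_condExp.measurable.div_const v) (hM'F t)).stronglyMeasurable
  have hM'mart : Martingale M' 𝓖 P := by
    refine ⟨hM'ad, fun s t hst => ?_⟩
    exact (condExp_congr_ae (hM'G t)).trans
      ((condExp_condExp_of_le (𝓖.mono hst) (𝓖.le t)).trans (hM'G s).symm)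
  refine ⟨M', A', ∫ ω, |W ω / v| ∂P, ⟨hM'mart, fun ω => ?_, fun t => ?_, fun t => ?_, fun ω => ?_,
    fun ω => ?_, fun ω => ?_, ?_⟩, ?_, ?_⟩
  · by_cases hω : ω ∈ S
    · simp only [hM'S hω]
      exact (hSgood ω hω).1.div_const v
    · simp only [hM'n hω]
      exact continuous_const
  · refine le_trans (le_of_eq (integral_congr_ae ?_)) (integral_abs_condExp_le (m := 𝓖 t) _)
    filter_upwards [hM'G t] with ω hω
    rw [hω]
  · have h1 : StronglyMeasurable[𝓖 t] fun ω => A t ω / v ^ 2 :=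
      (continuous_id.div_const (v ^ 2)).comp_stronglyMeasurable (hA.adapted t)
    exact h1.indicator (hS𝓖 t)
  · by_cases hω : ω ∈ S
    · simp only [hA'S hω]
      exact (hSgood ω hω).2.1.div_const _
    · simp only [hA'n hω]
      exact continuous_const
  · by_cases hω : ω ∈ S
    · simp only [hA'S hω]
      exact fun s t hst => div_le_div_of_nonneg_right ((hSgood ω hω).2.2.1 hst) (sq_nonneg v)
    · simp only [hA'n hω]
      exact monotone_const
  · by_cases hω : ω ∈ S
    · rw [hA'S hω, (hSgood ω hω).2.2.2.1, zero_div]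
    · exact hA'n hω 0
  · obtain ⟨τ, hτ, hmart⟩ := hA.isLocalMartingale
    refine ⟨τ, hτ, fun k => ?_⟩
    -- The same localizing sequence works: the cutoff event is known at time `0` and the
    -- normalization is a scalar factor.
    have h1 : Martingale ((v ^ 2)⁻¹ • fun t =>
        S.indicator (stopped (fun t ω => M t ω ^ 2 - A t ω) (τ k) t)) 𝓖 P :=
      (martingale_indicator (hmart k) (hS𝓖 0)).smul (v ^ 2)⁻¹
    have h2 : stopped (fun t ω => M' t ω ^ 2 - A' t ω) (τ k) = (v ^ 2)⁻¹ • fun t =>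
        S.indicator (stopped (fun t ω => M t ω ^ 2 - A t ω) (τ k) t) := by
      ext t ω
      simp only [Pi.smul_apply, smul_eq_mul]
      by_cases hp : ⊥ < τ k ω
      · rw [stopped_of_pos hp]
        by_cases hω : ω ∈ S
        · rw [Set.indicator_of_mem hω, stopped_of_pos hp, hM'S hω, hA'S hω, div_pow, ← sub_div,
            div_eq_inv_mul]
        · rw [Set.indicator_of_notMem hω, hM'n hω, hA'n hω]
          simp
      · rw [stopped_of_not_pos hp]
        by_cases hω : ω ∈ S
        · rw [Set.indicator_of_mem hω, stopped_of_not_pos hp, mul_zero]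
        · rw [Set.indicator_of_notMem hω, mul_zero]
    rw [← h2] at h1
    exact h1
  · filter_upwards [hSae] with ω hω t
    exact ⟨hM'S hω t, hA'S hω t⟩
  · have hsup : ⨆ t, (𝓕 t : MeasurableSpace Ω) ≤ ⨆ t, (𝓖 t : MeasurableSpace Ω) :=
      iSup_mono fun t => le_completion 𝓕 P t
    have hWvm : AEStronglyMeasurable[⨆ t, (𝓖 t : MeasurableSpace Ω)] (fun ω => W ω / v) P := by
      have := (continuous_id.div_const v).comp_aestronglyMeasurable (hWm.mono hsup)
      exact this
    have hq : ∀ᵐ ω ∂P, ∀ n : ℕ, M' n ω = (P[fun ω => W ω / v | 𝓖 n]) ω :=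
      ae_all_iff.2 fun n => hM'G n
    filter_upwards [hq, ae_condExp_iSup_eq hWv hWvm,
      tendsto_ae_condExp (μ := P) (ℱ := natFiltration 𝓖) fun ω => W ω / v] with ω h1 h2 h3
    rw [h2] at h3
    exact h3.congr fun n => (h1 n).symm

end RandomVarianceCLT

/-! ### The exponential process at a fixed time. -/

namespace RandomVarianceCLT

variable {Ω : Type*} {mΩ : MeasurableSpace Ω} {P : Measure Ω} {𝓖 : Filtration ℝ≥0 mΩ}

lemma aestronglyMeasurable_sub_of_tendsto_ae {m : MeasurableSpace Ω} {f : ℕ → Ω → ℝ} {g : Ω → ℝ}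
    (hf : ∀ n, AEStronglyMeasurable[m] (f n) P)
    (hg : ∀ᵐ ω ∂P, Tendsto (fun n => f n ω) atTop (𝓝 (g ω))) : AEStronglyMeasurable[m] g P := by
  refine ⟨fun ω => limsup (fun n => (hf n).mk (f n) ω) atTop, ?_, ?_⟩
  · exact (Measurable.limsup fun n => (hf n).stronglyMeasurable_mk.measurable).stronglyMeasurable
  · have h : ∀ᵐ ω ∂P, ∀ n, f n ω = (hf n).mk (f n) ω := ae_all_iff.2 fun n => (hf n).ae_eq_mk
    filter_upwards [h, hg] with ω h1 h2
    simp only [← h1]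
    exact h2.limsup_eq.symm

/-- The variance of the norm is nonnegative, so its first moment is at most the root of the second.
-/
lemma tendsto_integral_norm_of_sq [IsProbabilityMeasure P] {f : ℕ → Ω → ℂ} {C : ℝ}
    (hf : ∀ n, AEStronglyMeasurable (f n) P) (hC : ∀ n ω, ‖f n ω‖ ≤ C)
    (h : Tendsto (fun n => ∫ ω, ‖f n ω‖ ^ 2 ∂P) atTop (𝓝 0)) :
    Tendsto (fun n => ∫ ω, ‖f n ω‖ ∂P) atTop (𝓝 0) := by
  have hi : ∀ n, Integrable (fun ω => ‖f n ω‖) P := fun n =>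
    (Integrable.of_bound (hf n) C (ae_of_all _ (hC n))).norm
  have hi2 : ∀ n, Integrable (fun ω => ‖f n ω‖ ^ 2) P := fun n =>
    Integrable.of_bound ((hf n).norm.pow 2) (C ^ 2) (ae_of_all _ fun ω => by
      rw [norm_pow, norm_norm]
      exact pow_le_pow_left₀ (norm_nonneg _) (hC n ω) 2)
  refine squeeze_zero (fun n => integral_nonneg fun ω => norm_nonneg _) (fun n => ?_)
    (g := fun n => √(∫ ω, ‖f n ω‖ ^ 2 ∂P)) (by simpa [Function.comp_def] using (Real.continuous_sqrt.tendsto 0).comp h)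
  refine Real.le_sqrt_of_sq_le ?_
  set a := ∫ ω, ‖f n ω‖ ∂P with ha
  have h1 : 0 ≤ ∫ ω, (‖f n ω‖ - a) ^ 2 ∂P := integral_nonneg fun ω => sq_nonneg _
  have h2 : ∫ ω, (‖f n ω‖ - a) ^ 2 ∂P = ∫ ω, (‖f n ω‖ ^ 2 - (2 * a * ‖f n ω‖ - a ^ 2)) ∂P := by
    congr 1
    ext ω
    ring
  have hi3 : Integrable (fun ω => 2 * a * ‖f n ω‖ - a ^ 2) P :=
    ((hi n).const_mul _).sub (integrable_const _)
  rw [h2, integral_sub (hi2 n) hi3, integral_sub ((hi n).const_mul _) (integrable_const _),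
    integral_const_mul, ← ha] at h1
  simp only [integral_const, probReal_univ, one_smul] at h1
  linarith [sq_nonneg a, pow_two a]

namespace BoundedPair

variable {M A : ℕ → ℝ≥0 → Ω → ℝ} {R : ℕ → ℝ} {K : ℝ} [IsProbabilityMeasure P]

/-- If `A` is asymptotically negligible at time `t`, so is the exponential process minus one. -/
lemma tendsto_integral_norm_expProc_sub_one (h : ∀ n, BoundedPair 𝓖 P (M n) (A n) (R n) K)
    (ξ : ℝ) (t : ℝ≥0) (hA : ∀ᵐ ω ∂P, Tendsto (fun n => A n t ω) atTop (𝓝 0))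
    (hM : ∀ᵐ ω ∂P, Tendsto (fun n => M n 0 ω) atTop (𝓝 0)) :
    Tendsto (fun n => ∫ ω, ‖expProc (M n) (A n) ξ t ω - 1‖ ∂P) atTop (𝓝 0) := by
  set B := Real.exp (ξ ^ 2 / 2 * K) with hB
  have hEm : ∀ n s, AEStronglyMeasurable (expProc (M n) (A n) ξ s) P := fun n s =>
    (((h n).stronglyMeasurable_expProc ξ s).mono (𝓖.le s)).aestronglyMeasurable
  have hEb : ∀ n s ω, ‖expProc (M n) (A n) ξ s ω‖ ≤ B := fun n s ω =>
    (h n).norm_expProc_le ξ s ω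
  have hEi : ∀ n s, Integrable (expProc (M n) (A n) ξ s) P := fun n s =>
    Integrable.of_bound (hEm n s) B (ae_of_all _ (hEb n s))
  refine tendsto_integral_norm_of_sq (C := B + 1) (fun n => (hEm n t).sub aestronglyMeasurable_const)
    (fun n ω => (norm_sub_le _ _).trans (add_le_add (hEb n t ω) (by simp))) ?_
  -- In `|E - 1|² = |E|² + 1 - 2 Re E` the modulus involves only `A`, and the martingale property
  -- moves the linear term to time `0`. Thus no direct control of `M` at time `t` is needed.
  have hsq : ∀ n, ∫ ω, ‖expProc (M n) (A n) ξ t ω - 1‖ ^ 2 ∂P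
      = (∫ ω, Real.exp (ξ ^ 2 / 2 * A n t ω) ^ 2 ∂P) + 1
        - 2 * (∫ ω, expProc (M n) (A n) ξ 0 ω ∂P).re := by
    intro n
    have h1 : ∫ ω, expProc (M n) (A n) ξ 0 ω ∂P = ∫ ω, expProc (M n) (A n) ξ t ω ∂P := by
      have := (h n).integral_mul_expProc ξ (zero_le : 0 ≤ t) (g := fun _ => 1)
        stronglyMeasurable_const (C := 1) (fun ω => by simp)
      simpa using this.symm
    have hpt : ∀ ω, ‖expProc (M n) (A n) ξ t ω - 1‖ ^ 2
        = Real.exp (ξ ^ 2 / 2 * A n t ω) ^ 2 + 1 - 2 * (expProc (M n) (A n) ξ t ω).re := fun ω => by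
      rw [← norm_expProc (M n) (A n) ξ t ω, ← Complex.normSq_eq_norm_sq,
        ← Complex.normSq_eq_norm_sq, Complex.normSq_apply, Complex.normSq_apply]
      simp only [Complex.sub_re, Complex.one_re, Complex.sub_im, Complex.one_im]
      ring
    have i1 : Integrable (fun ω => Real.exp (ξ ^ 2 / 2 * A n t ω) ^ 2) P := by
      simp only [← norm_expProc (M n)]
      refine Integrable.of_bound ((hEm n t).norm.pow 2) (B ^ 2) (ae_of_all _ fun ω => ?_)
      rw [norm_pow, norm_norm]
      exact pow_le_pow_left₀ (norm_nonneg _) (hEb n t ω) 2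
    have i2 : Integrable (fun ω => (expProc (M n) (A n) ξ t ω).re) P := (hEi n t).re
    have i3 : Integrable (fun ω => Real.exp (ξ ^ 2 / 2 * A n t ω) ^ 2 + 1) P :=
      i1.add (integrable_const _)
    simp only [hpt]
    rw [integral_sub i3 (i2.const_mul 2), integral_add i1 (integrable_const _),
      integral_const_mul, h1, ← Complex.reCLM_apply, ← Complex.reCLM.integral_comp_comm (hEi n t)]
    simp
  have hlim1 : Tendsto (fun n => ∫ ω, Real.exp (ξ ^ 2 / 2 * A n t ω) ^ 2 ∂P) atTop (𝓝 1) := by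
    have := tendsto_integral_of_dominated_convergence (μ := P)
      (F := fun n ω => Real.exp (ξ ^ 2 / 2 * A n t ω) ^ 2) (f := fun _ => (1 : ℝ)) (fun _ => B ^ 2)
      (fun n => by
        simp only [← norm_expProc (M n)]
        exact (hEm n t).norm.pow 2)
      (integrable_const _) (fun n => ae_of_all _ fun ω => by
        rw [← norm_expProc (M n), norm_pow, norm_norm]
        exact pow_le_pow_left₀ (norm_nonneg _) (hEb n t ω) 2)
      (by
        filter_upwards [hA] with ω hω
        have h1 := (Real.continuous_exp.tendsto _).comp (hω.const_mul (ξ ^ 2 / 2))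
        simpa using h1.pow 2)
    simpa using this
  have hlim2 : Tendsto (fun n => ∫ ω, expProc (M n) (A n) ξ 0 ω ∂P) atTop (𝓝 1) := by
    have := tendsto_integral_of_dominated_convergence (μ := P)
      (F := fun n ω => expProc (M n) (A n) ξ 0 ω) (f := fun _ => (1 : ℂ)) (fun _ => B)
      (fun n => hEm n 0) (integrable_const _) (fun n => ae_of_all _ (hEb n 0))
      (by
        filter_upwards [hM] with ω hω
        have h1 : Tendsto (fun n => ((M n 0 ω : ℝ) : ℂ)) atTop (𝓝 ((0 : ℝ) : ℂ)) :=
          (Complex.continuous_ofReal.tendsto 0).comp hω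
        have h2 := (Complex.continuous_exp.tendsto _).comp (h1.const_mul (Complex.I * ξ))
        simp only [Complex.ofReal_zero, mul_zero, Complex.exp_zero] at h2
        refine h2.congr fun n => ?_
        simp [expProc, (h n).zero])
    simpa using this
  simp only [hsq]
  have h3 := (hlim1.add_const 1).sub (((Complex.continuous_re.tendsto 1).comp hlim2).const_mul 2)
  norm_num at h3
  exact h3

end BoundedPair

end RandomVarianceCLT

/-! ### The main estimate. -/

namespace RandomVarianceCLT

variable {Ω : Type*} {mΩ : MeasurableSpace Ω} {P : Measure Ω} {𝓖 : Filtration ℝ≥0 mΩ}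

lemma tsum_half_pow_ne_top {s : ℕ → Set Ω} (h : ∀ n, P (s n) ≤ (1 / 2 : ENNReal) ^ n) :
    ∑' n, P (s n) ≠ ⊤ :=
  (lt_of_le_of_lt (ENNReal.summable.tsum_mono ENNReal.summable h)
    (tsum_geometric_lt_top.2 (by simp))).ne

/-- A time after which a process is close to its limit, outside an event of small probability. -/
lemma exists_nat_measure_lt_abs_sub_le [IsFiniteMeasure P] {Y : ℕ → Ω → ℝ} {L : Ω → ℝ}
    (hY : ∀ k, Measurable (Y k)) (hL : Measurable L)
    (h : ∀ᵐ ω ∂P, Tendsto (fun k => Y k ω) atTop (𝓝 (L ω))) {δ : ℝ} (hδ : 0 < δ) {ε : ENNReal}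
    (hε : ε ≠ 0) (N : ℕ) : ∃ k₀, ∀ k ≥ k₀, N ≤ k ∧ P {ω | δ < |Y k ω - L ω|} ≤ ε := by
  have hlim : Tendsto (fun k => P {ω | δ < |Y k ω - L ω|}) atTop (𝓝 (P ∅)) := by
    refine tendsto_measure_of_ae_tendsto_indicator_of_isFiniteMeasure atTop MeasurableSet.empty
      (fun k => measurableSet_lt measurable_const ((hY k).sub hL).abs) ?_
    filter_upwards [h] with ω hω
    have h1 : Tendsto (fun k => |Y k ω - L ω|) atTop (𝓝 0) := by
      have := (hω.sub_const (L ω)).abs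
      simpa using this
    filter_upwards [h1.eventually (gt_mem_nhds hδ)] with k hk
    simpa using hk.le
  rw [measure_empty] at hlim
  have h2 := (hlim.eventually (gt_mem_nhds (pos_iff_ne_zero.2 hε))).and (eventually_ge_atTop N)
  obtain ⟨k₀, hk₀⟩ := eventually_atTop.1 h2
  exact ⟨k₀, fun k hk => ⟨(hk₀ k hk).2, (hk₀ k hk).1.le⟩⟩

variable [IsProbabilityMeasure P]

/-- The convergence of the Fourier transforms, up to the error made by approximating the limiting
density by a function known at time `m`. -/
lemma eventually_norm_integral_sub_le {M A : ℕ → ℝ≥0 → Ω → ℝ} {c : ℕ → ℝ}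
    (h : ∀ n, ContinuousPair 𝓖 P (M n) (A n) (c n)) {X B : ℕ → Ω → ℝ}
    (hX : ∀ n, ∀ᵐ ω ∂P, Tendsto (fun k : ℕ => M n k ω) atTop (𝓝 (X n ω)))
    (hB : ∀ n, ∀ᵐ ω ∂P, Tendsto (fun k : ℕ => A n k ω) atTop (𝓝 (B n ω)))
    {Z : Ω → ℝ} (hZ : Measurable Z) (hZ0 : ∀ ω, 0 ≤ Z ω)
    (hBZ : ∀ᵐ ω ∂P, Tendsto (fun n => B n ω) atTop (𝓝 (Z ω))) (m : ℕ)
    (hAm : ∀ᵐ ω ∂P, Tendsto (fun n => A n m ω) atTop (𝓝 0))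
    (hM0 : ∀ᵐ ω ∂P, Tendsto (fun n => M n 0 ω) atTop (𝓝 0))
    {H : Ω → ℝ} (hH : Measurable H) {C : ℝ} (hC : ∀ ω, |H ω| ≤ C) {K : ℝ} (hK : 0 ≤ K)
    (hHK : ∀ ω, K < Z ω → H ω = 0) {g : Ω → ℝ} (hg : StronglyMeasurable[𝓖 m] g)
    (hgC : ∀ ω, |g ω| ≤ C) (ξ : ℝ) {η : ℝ} (hη : 0 < η) :
    ∀ᶠ n in atTop, ‖(∫ ω, (H ω : ℂ) * Complex.exp (Complex.I * ξ * X n ω) ∂P)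
      - ∫ ω, ((H ω * Real.exp (-(ξ ^ 2 / 2 * Z ω)) : ℝ) : ℂ) ∂P‖
      ≤ 2 * Real.exp (ξ ^ 2 / 2 * (K + 1))
        * (∫ ω, |g ω - H ω * Real.exp (-(ξ ^ 2 / 2 * Z ω))| ∂P) + η := by
  obtain ⟨ω₀⟩ : Nonempty Ω := P.nonempty_of_neZero
  have hC0 : 0 ≤ C := (abs_nonneg _).trans (hC ω₀)
  have hMm : ∀ n t, Measurable (M n t) := fun n t =>
    (((h n).martingale.1 t).mono (𝓖.le t)).measurable
  have hAmeas : ∀ n t, Measurable (A n t) := fun n t =>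
    (((h n).adapted t).mono (𝓖.le t)).measurable
  have hXm : ∀ n, AEMeasurable (X n) P := fun n =>
    aemeasurable_of_tendsto_metrizable_ae atTop (fun k : ℕ => (hMm n k).aemeasurable) (hX n)
  have hBm : ∀ n, AEMeasurable (B n) P := fun n =>
    aemeasurable_of_tendsto_metrizable_ae atTop (fun k : ℕ => (hAmeas n k).aemeasurable) (hB n)
  have hhalf : ∀ n : ℕ, ((1 / 2 : ENNReal) ^ n) ≠ 0 := fun n => pow_ne_zero n (by simp)
  -- The summable bounds `2⁻ⁿ` are chosen for Borel–Cantelli: almost surely, the values at time `T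
  -- n` are eventually within `2⁻ⁿ` of the terminal values.
  have hT : ∀ n : ℕ, ∃ T : ℕ, m ≤ T ∧
      P {ω | (1 / 2 : ℝ) ^ n < |M n T ω - (hXm n).mk _ ω|} ≤ (1 / 2 : ENNReal) ^ n ∧
      P {ω | (1 / 2 : ℝ) ^ n < |A n T ω - (hBm n).mk _ ω|} ≤ (1 / 2 : ENNReal) ^ n := by
    intro n
    obtain ⟨k₁, hk₁⟩ := exists_nat_measure_lt_abs_sub_le (P := P) (fun k : ℕ => hMm n k)
      (hXm n).measurable_mk (by
        filter_upwards [hX n, (hXm n).ae_eq_mk] with ω h1 h2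
        rwa [← h2]) (δ := (1 / 2 : ℝ) ^ n) (by positivity) (hhalf n) m
    obtain ⟨k₂, hk₂⟩ := exists_nat_measure_lt_abs_sub_le (P := P) (fun k : ℕ => hAmeas n k)
      (hBm n).measurable_mk (by
        filter_upwards [hB n, (hBm n).ae_eq_mk] with ω h1 h2
        rwa [← h2]) (δ := (1 / 2 : ℝ) ^ n) (by positivity) (hhalf n) m
    exact ⟨max k₁ k₂, (hk₁ _ (le_max_left _ _)).1, (hk₁ _ (le_max_left _ _)).2,
      (hk₂ _ (le_max_right _ _)).2⟩
  choose T hmT hTM hTA using hT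
  have hK1 : 0 < K + 1 := by linarith
  -- The margin in `K + 1` ensures that, where `Z ≤ K`, the bracket at time `T n` eventually stays
  -- below the stopping level. The bound `R n` is not uniform and never enters the estimate.
  choose M' A' R D hpair hD heq using fun n =>
    (h n).exists_boundedPair hK1 (T n) (hhalf n)
  -- almost surely, everything eventually holds
  have hgood : ∀ᵐ ω ∂P, (∀ᶠ n in atTop, ω ∉ D n) ∧
      Tendsto (fun n => M n (T n) ω - X n ω) atTop (𝓝 0) ∧
      Tendsto (fun n => A n (T n) ω) atTop (𝓝 (Z ω)) := by
    have e1 : ∀ᵐ ω ∂P, ∀ n, X n ω = (hXm n).mk _ ω := ae_all_iff.2 fun n => (hXm n).ae_eq_mk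
    have e2 : ∀ᵐ ω ∂P, ∀ n, B n ω = (hBm n).mk _ ω := ae_all_iff.2 fun n => (hBm n).ae_eq_mk
    filter_upwards [ae_eventually_notMem (tsum_half_pow_ne_top hD),
      ae_eventually_notMem (tsum_half_pow_ne_top hTM),
      ae_eventually_notMem (tsum_half_pow_ne_top hTA), e1, e2, hBZ] with ω h1 h2 h3 h4 h5 h6
    have hgeo : Tendsto (fun n : ℕ => (1 / 2 : ℝ) ^ n) atTop (𝓝 0) :=
      tendsto_pow_atTop_nhds_zero_of_lt_one (by norm_num) (by norm_num)
    refine ⟨h1, squeeze_zero_norm' ?_ hgeo, ?_⟩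
    · filter_upwards [h2] with n hn
      rw [h4 n]
      exact not_lt.1 hn
    · have h7 : Tendsto (fun n => A n (T n) ω - B n ω) atTop (𝓝 0) := by
        refine squeeze_zero_norm' ?_ hgeo
        filter_upwards [h3] with n hn
        rw [h5 n]
        exact not_lt.1 hn
      simpa using h7.add h6
  set b := Real.exp (ξ ^ 2 / 2 * (K + 1)) with hb
  have hb1 : 1 ≤ b := Real.one_le_exp (by positivity)
  set G : Ω → ℝ := fun ω => H ω * Real.exp (-(ξ ^ 2 / 2 * Z ω)) with hG
  have hGm : Measurable G := hH.mul ((hZ.const_mul _).neg.exp)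
  have hGC : ∀ ω, |G ω| ≤ C := fun ω => by
    rw [hG, abs_mul, abs_of_pos (Real.exp_pos _)]
    have : Real.exp (-(ξ ^ 2 / 2 * Z ω)) ≤ 1 :=
      Real.exp_le_one_iff.2 (neg_nonpos.2 (mul_nonneg (by positivity) (hZ0 ω)))
    calc |H ω| * Real.exp (-(ξ ^ 2 / 2 * Z ω)) ≤ |H ω| * 1 := by gcongr
      _ ≤ C := by simpa using hC ω
  set E : ℕ → ℝ≥0 → Ω → ℂ := fun n => BoundedPair.expProc (M' n) (A' n) ξ with hE
  have hEm : ∀ n s, AEStronglyMeasurable (E n s) P := fun n s =>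
    (((hpair n).stronglyMeasurable_expProc ξ s).mono (𝓖.le s)).aestronglyMeasurable
  have hEb : ∀ n s ω, ‖E n s ω‖ ≤ b := fun n s ω => (hpair n).norm_expProc_le ξ s ω
  have hgm : AEStronglyMeasurable (fun ω => (g ω : ℂ)) P :=
    (Complex.continuous_ofReal.comp_stronglyMeasurable (hg.mono (𝓖.le _))).aestronglyMeasurable
  have hGcm : AEStronglyMeasurable (fun ω => (G ω : ℂ)) P :=
    (Complex.measurable_ofReal.comp hGm).aestronglyMeasurable
  have hEi : ∀ n s, Integrable (E n s) P := fun n s =>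
    Integrable.of_bound (hEm n s) b (ae_of_all _ (hEb n s))
  have hgb : ∀ ω, ‖(g ω : ℂ)‖ ≤ C := fun ω => by simpa using hgC ω
  have hGb : ∀ ω, ‖(G ω : ℂ)‖ ≤ C := fun ω => by simpa using hGC ω
  have hgE : ∀ n s, Integrable (fun ω => (g ω : ℂ) * E n s ω) P := fun n s =>
    (hEi n s).bdd_mul hgm (ae_of_all _ hgb)
  have hGE : ∀ n s, Integrable (fun ω => (G ω : ℂ) * E n s ω) P := fun n s =>
    (hEi n s).bdd_mul hGcm (ae_of_all _ hGb)
  have hgi : Integrable (fun ω => (g ω : ℂ)) P := Integrable.of_bound hgm C (ae_of_all _ hgb)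
  have hGi : Integrable (fun ω => (G ω : ℂ)) P := Integrable.of_bound hGcm C (ae_of_all _ hGb)
  have hdi : Integrable (fun ω => |g ω - G ω|) P := by
    refine Integrable.of_bound (C := C + C) ?_ (ae_of_all _ fun ω => ?_)
    · exact (((hg.mono (𝓖.le _)).measurable.sub hGm).abs).aestronglyMeasurable
    · rw [Real.norm_eq_abs, abs_abs]
      exact (abs_sub _ _).trans (add_le_add (hgC ω) (hGC ω))
  have hHX : ∀ n, AEStronglyMeasurable
      (fun ω => (H ω : ℂ) * Complex.exp (Complex.I * ξ * X n ω)) P := fun n => by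
    refine AEMeasurable.aestronglyMeasurable ?_
    refine (Complex.measurable_ofReal.comp hH).aemeasurable.mul ?_
    exact Complex.measurable_exp.comp_aemeasurable
      ((Complex.measurable_ofReal.comp_aemeasurable (hXm n)).const_mul _)
  have hunit : ∀ n ω, ‖Complex.exp (Complex.I * ξ * X n ω)‖ = 1 := fun n ω => by
    have : Complex.I * ξ * X n ω = ((ξ * X n ω : ℝ) : ℂ) * Complex.I := by
      push_cast
      ring
    rw [this, Complex.norm_exp_ofReal_mul_I]
  have hHXb : ∀ n ω, ‖(H ω : ℂ) * Complex.exp (Complex.I * ξ * X n ω)‖ ≤ C := fun n ω => by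
    rw [norm_mul, hunit, mul_one]
    simpa using hC ω
  have hHXi : ∀ n, Integrable (fun ω => (H ω : ℂ) * Complex.exp (Complex.I * ξ * X n ω)) P :=
    fun n => Integrable.of_bound (hHX n) C (ae_of_all _ (hHXb n))
  -- the exponential martingale at time `T n` approximates the Fourier transform
  have hlimT : Tendsto (fun n => ∫ ω, ((H ω : ℂ) * Complex.exp (Complex.I * ξ * X n ω)
      - (G ω : ℂ) * E n (T n) ω) ∂P) atTop (𝓝 0) := by
    have := tendsto_integral_of_dominated_convergence (μ := P)
      (F := fun n ω => (H ω : ℂ) * Complex.exp (Complex.I * ξ * X n ω)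
        - (G ω : ℂ) * E n (T n) ω) (f := fun _ => (0 : ℂ)) (fun _ => C + C * b)
      (fun n => (hHX n).sub (hGE n (T n)).1) (integrable_const _)
      (fun n => ae_of_all _ fun ω => by
        refine (norm_sub_le _ _).trans (add_le_add (hHXb n ω) ?_)
        rw [norm_mul]
        exact mul_le_mul (hGb ω) (hEb n _ ω) (norm_nonneg _) hC0)
      (by
        filter_upwards [hgood] with ω ⟨hD1, hM1, hA1⟩
        -- Where `Z > K` both integrands vanish with `H`. Elsewhere the stopped pair eventually
        -- agrees with the original one at time `T n`.
        rcases lt_or_ge K (Z ω) with hZK | hZK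
        · have h1 : H ω = 0 := hHK ω hZK
          have h2 : G ω = 0 := by simp [hG, h1]
          simp [h1, h2]
        · have hev : ∀ᶠ n in atTop, A n (T n) ω < K + 1 :=
            hA1.eventually (gt_mem_nhds (by linarith))
          have hexp : Tendsto (fun n => Complex.exp (Complex.I * ξ * ((M n (T n) ω - X n ω : ℝ) : ℂ)
              + ξ ^ 2 / 2 * ((A n (T n) ω - Z ω : ℝ) : ℂ)) - 1) atTop (𝓝 0) := by
            have a1 : Tendsto (fun n => ((M n (T n) ω - X n ω : ℝ) : ℂ)) atTop (𝓝 ((0 : ℝ) : ℂ)) :=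
              (Complex.continuous_ofReal.tendsto 0).comp hM1
            have a2 : Tendsto (fun n => ((A n (T n) ω - Z ω : ℝ) : ℂ)) atTop (𝓝 ((0 : ℝ) : ℂ)) :=
              (Complex.continuous_ofReal.tendsto 0).comp (by simpa using hA1.sub_const (Z ω))
            have a3 := (Complex.continuous_exp.tendsto _).comp
              ((a1.const_mul (Complex.I * ξ)).add (a2.const_mul ((ξ : ℂ) ^ 2 / 2)))
            have a4 := a3.sub_const 1
            simpa [Function.comp_def] using a4
          have hexp2 : Tendsto (fun n => -((H ω : ℂ) * Complex.exp (Complex.I * ξ * X n ω)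
              * (Complex.exp (Complex.I * ξ * ((M n (T n) ω - X n ω : ℝ) : ℂ)
              + ξ ^ 2 / 2 * ((A n (T n) ω - Z ω : ℝ) : ℂ)) - 1))) atTop (𝓝 0) := by
            refine squeeze_zero_norm (fun n => ?_) (a := fun n =>
              C * ‖Complex.exp (Complex.I * ξ * ((M n (T n) ω - X n ω : ℝ) : ℂ)
              + ξ ^ 2 / 2 * ((A n (T n) ω - Z ω : ℝ) : ℂ)) - 1‖) ?_
            · rw [norm_neg, norm_mul]
              exact mul_le_mul_of_nonneg_right (hHXb n ω) (norm_nonneg _)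
            · simpa using hexp.norm.const_mul C
          refine hexp2.congr' ?_
          filter_upwards [hD1, hev] with n hn1 hn2
          obtain ⟨q1, q2⟩ := heq n ω hn1 (T n) le_rfl hn2
          have q3 : (G ω : ℂ) * E n (T n) ω = (H ω : ℂ) * Complex.exp (Complex.I * ξ * X n ω)
              * Complex.exp (Complex.I * ξ * ((M n (T n) ω - X n ω : ℝ) : ℂ)
              + ξ ^ 2 / 2 * ((A n (T n) ω - Z ω : ℝ) : ℂ)) := by
            simp only [hE, hG, BoundedPair.expProc, q1, q2]
            rw [Complex.ofReal_mul, Complex.ofReal_exp, mul_assoc (H ω : ℂ), mul_assoc (H ω : ℂ),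
              ← Complex.exp_add, ← Complex.exp_add]
            congr 2
            push_cast
            ring
          rw [q3]
          ring)
    simpa using this
  -- the exponential martingale at time `m` is asymptotically trivial
  have hlimm : Tendsto (fun n => ∫ ω, ‖E n m ω - 1‖ ∂P) atTop (𝓝 0) := by
    refine BoundedPair.tendsto_integral_norm_expProc_sub_one hpair ξ m ?_ ?_
    · filter_upwards [hgood, hAm] with ω ⟨hD1, _⟩ hA1
      refine hA1.congr' ?_
      filter_upwards [hD1, hA1.eventually (gt_mem_nhds hK1)] with n hn1 hn2
      exact (heq n ω hn1 m (by exact_mod_cast hmT n) hn2).2.symm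
    · filter_upwards [hgood, hM0] with ω ⟨hD1, _⟩ hM1
      refine hM1.congr' ?_
      filter_upwards [hD1] with n hn1
      exact (heq n ω hn1 0 zero_le (by rw [(h n).zero]; exact hK1)).1.symm
  have hsum : Tendsto (fun n => ‖∫ ω, ((H ω : ℂ) * Complex.exp (Complex.I * ξ * X n ω)
      - (G ω : ℂ) * E n (T n) ω) ∂P‖ + C * ∫ ω, ‖E n m ω - 1‖ ∂P) atTop (𝓝 0) := by
    simpa using hlimT.norm.add (hlimm.const_mul C)
  filter_upwards [hsum.eventually (gt_mem_nhds hη)] with n hn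
  -- The martingale property is used here; it requires a weight known at time `m`, which is why `g`
  -- replaces `G`.
  have hmart : ∫ ω, (g ω : ℂ) * E n (T n) ω ∂P = ∫ ω, (g ω : ℂ) * E n m ω ∂P :=
    (hpair n).integral_mul_expProc ξ (by exact_mod_cast hmT n)
      (Complex.continuous_ofReal.comp_stronglyMeasurable hg) hgb
  have hd0 : 0 ≤ ∫ ω, |g ω - G ω| ∂P := integral_nonneg fun _ => abs_nonneg _
  have hgG : ∀ Y : Ω → ℂ, AEStronglyMeasurable Y P → (∀ ω, ‖Y ω‖ ≤ b) →
      ‖∫ ω, ((G ω : ℂ) - g ω) * Y ω ∂P‖ ≤ b * ∫ ω, |g ω - G ω| ∂P := by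
    intro Y hYm hYb
    rw [← integral_const_mul]
    refine norm_integral_le_of_norm_le (hdi.const_mul b) (ae_of_all _ fun ω => ?_)
    rw [norm_mul, ← Complex.ofReal_sub, Complex.norm_real, Real.norm_eq_abs, abs_sub_comm, mul_comm]
    exact mul_le_mul_of_nonneg_right (hYb ω) (abs_nonneg _)
  -- Replacing `G` by `g` and back costs two terms in `G - g`, whence the factor `2` in the bound.
  have hsplit : (∫ ω, (H ω : ℂ) * Complex.exp (Complex.I * ξ * X n ω) ∂P) - ∫ ω, (G ω : ℂ) ∂P
      = (∫ ω, ((H ω : ℂ) * Complex.exp (Complex.I * ξ * X n ω) - (G ω : ℂ) * E n (T n) ω) ∂P)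
        + (∫ ω, ((G ω : ℂ) - g ω) * E n (T n) ω ∂P)
        + (∫ ω, (g ω : ℂ) * (E n m ω - 1) ∂P) - ∫ ω, ((G ω : ℂ) - g ω) * 1 ∂P := by
    simp only [sub_mul, mul_sub, mul_one]
    rw [integral_sub (hHXi n) (hGE n _), integral_sub (hGE n _) (hgE n _),
      integral_sub (hgE n _) hgi, integral_sub hGi hgi, hmart]
    ring
  have h1 := hgG (E n (T n)) (hEm n _) (hEb n _)
  have h2 := hgG (fun _ => 1) aestronglyMeasurable_const (fun ω => by simpa using hb1)
  have h3 : ‖∫ ω, (g ω : ℂ) * (E n m ω - 1) ∂P‖ ≤ C * ∫ ω, ‖E n m ω - 1‖ ∂P := by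
    rw [← integral_const_mul]
    refine norm_integral_le_of_norm_le
      ((((hEi n m).sub (integrable_const 1)).norm).const_mul C) (ae_of_all _ fun ω => ?_)
    rw [norm_mul]
    exact mul_le_mul_of_nonneg_right (hgb ω) (norm_nonneg _)
  rw [hsplit]
  refine (norm_sub_le _ _).trans ?_
  have h4 := norm_add₃_le (a := ∫ ω, ((H ω : ℂ) * Complex.exp (Complex.I * ξ * X n ω)
      - (G ω : ℂ) * E n (T n) ω) ∂P) (b := ∫ ω, ((G ω : ℂ) - g ω) * E n (T n) ω ∂P)
      (c := ∫ ω, (g ω : ℂ) * (E n m ω - 1) ∂P)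
  linarith

end RandomVarianceCLT

/-! ### Convergence in probability, approximation and truncation. -/

namespace RandomVarianceCLT

variable {Ω : Type*} {mΩ : MeasurableSpace Ω} {P : Measure Ω} {𝓖 : Filtration ℝ≥0 mΩ}
  [IsProbabilityMeasure P]

/-- If the bound failed infinitely often, successive extractions among the bad indices would give a
subsequence along which all three convergences hold almost surely, contradicting the almost sure
version. -/
lemma eventually_norm_integral_sub_le_of_tendstoInMeasure {M A : ℕ → ℝ≥0 → Ω → ℝ} {c : ℕ → ℝ}
    (h : ∀ n, ContinuousPair 𝓖 P (M n) (A n) (c n)) {X B : ℕ → Ω → ℝ}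
    (hX : ∀ n, ∀ᵐ ω ∂P, Tendsto (fun k : ℕ => M n k ω) atTop (𝓝 (X n ω)))
    (hB : ∀ n, ∀ᵐ ω ∂P, Tendsto (fun k : ℕ => A n k ω) atTop (𝓝 (B n ω)))
    {Z : Ω → ℝ} (hZ : Measurable Z) (hZ0 : ∀ ω, 0 ≤ Z ω)
    (hBZ : TendstoInMeasure P B atTop Z) (m : ℕ)
    (hAm : TendstoInMeasure P (fun n ω => A n m ω) atTop (fun _ => 0))
    (hM0 : TendstoInMeasure P (fun n ω => M n 0 ω) atTop (fun _ => 0))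
    {H : Ω → ℝ} (hH : Measurable H) {C : ℝ} (hC : ∀ ω, |H ω| ≤ C) {K : ℝ} (hK : 0 ≤ K)
    (hHK : ∀ ω, K < Z ω → H ω = 0) {g : Ω → ℝ} (hg : StronglyMeasurable[𝓖 m] g)
    (hgC : ∀ ω, |g ω| ≤ C) (ξ : ℝ) {η : ℝ} (hη : 0 < η) :
    ∀ᶠ n in atTop, ‖(∫ ω, (H ω : ℂ) * Complex.exp (Complex.I * ξ * X n ω) ∂P)
      - ∫ ω, ((H ω * Real.exp (-(ξ ^ 2 / 2 * Z ω)) : ℝ) : ℂ) ∂P‖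
      ≤ 2 * Real.exp (ξ ^ 2 / 2 * (K + 1))
        * (∫ ω, |g ω - H ω * Real.exp (-(ξ ^ 2 / 2 * Z ω))| ∂P) + η := by
  by_contra hcon
  obtain ⟨φ, hφ, hbad⟩ := extraction_of_frequently_atTop (not_eventually.1 hcon)
  obtain ⟨a, ha, haB⟩ := (TendstoInMeasure.comp hBZ hφ.tendsto_atTop).exists_seq_tendsto_ae
  have hφa := hφ.comp ha
  obtain ⟨b, hb, hbA⟩ := (TendstoInMeasure.comp hAm hφa.tendsto_atTop).exists_seq_tendsto_ae
  have hφb := hφa.comp hb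
  obtain ⟨d, hd, hdM⟩ := (TendstoInMeasure.comp hM0 hφb.tendsto_atTop).exists_seq_tendsto_ae
  set ψ : ℕ → ℕ := fun n => φ (a (b (d n))) with hψ
  have key := eventually_norm_integral_sub_le (fun n => h (ψ n)) (fun n => hX (ψ n))
    (fun n => hB (ψ n)) hZ hZ0
    (haB.mono fun ω hω => hω.comp ((hb.comp hd).tendsto_atTop)) m
    (hbA.mono fun ω hω => hω.comp hd.tendsto_atTop) hdM hH hC hK hHK hg hgC ξ hη
  obtain ⟨n, hn⟩ := key.exists
  exact hbad _ hn

/-- Clipping to `[-C, C]` fixes `y` and is a contraction. It makes a version of a conditional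
expectation bounded everywhere without spoiling the approximation. -/
lemma abs_clip_sub_le {x y C : ℝ} (hy : |y| ≤ C) : |max (-C) (min C x) - y| ≤ |x - y| := by
  obtain ⟨h1, h2⟩ := abs_le.1 hy
  rcases le_total C x with h | h
  · rw [min_eq_left h, max_eq_right (by linarith), abs_of_nonneg (by linarith),
      abs_of_nonneg (by linarith)]
    linarith
  · rw [min_eq_right h]
    rcases le_total (-C) x with h' | h'
    · rw [max_eq_right h']
    · rw [max_eq_left h', abs_of_nonpos (by linarith), abs_of_nonpos (by linarith)]
      linarith

/-- Convergence of the Fourier transforms for densities vanishing where the limiting variance is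
large. -/
lemma tendsto_integral_of_vanishing {M A : ℕ → ℝ≥0 → Ω → ℝ} {c : ℕ → ℝ}
    (h : ∀ n, ContinuousPair 𝓖 P (M n) (A n) (c n)) {X B : ℕ → Ω → ℝ}
    (hX : ∀ n, ∀ᵐ ω ∂P, Tendsto (fun k : ℕ => M n k ω) atTop (𝓝 (X n ω)))
    (hB : ∀ n, ∀ᵐ ω ∂P, Tendsto (fun k : ℕ => A n k ω) atTop (𝓝 (B n ω)))
    {Z : Ω → ℝ} (hZ : Measurable Z) (hZ0 : ∀ ω, 0 ≤ Z ω)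
    (hBZ : TendstoInMeasure P B atTop Z)
    (hAm : ∀ m : ℕ, TendstoInMeasure P (fun n ω => A n m ω) atTop (fun _ => 0))
    (hM0 : TendstoInMeasure P (fun n ω => M n 0 ω) atTop (fun _ => 0))
    {H : Ω → ℝ} (hH : Measurable H) {C : ℝ} (hC : ∀ ω, |H ω| ≤ C) {K : ℝ} (hK : 0 ≤ K)
    (hHK : ∀ ω, K < Z ω → H ω = 0) (ξ : ℝ)
    (hG : AEStronglyMeasurable[⨆ t, (𝓖 t : MeasurableSpace Ω)]
      (fun ω => H ω * Real.exp (-(ξ ^ 2 / 2 * Z ω))) P) :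
    Tendsto (fun n => ∫ ω, (H ω : ℂ) * Complex.exp (Complex.I * ξ * X n ω) ∂P) atTop
      (𝓝 (∫ ω, ((H ω * Real.exp (-(ξ ^ 2 / 2 * Z ω)) : ℝ) : ℂ) ∂P)) := by
  obtain ⟨ω₀⟩ : Nonempty Ω := P.nonempty_of_neZero
  have hC0 : 0 ≤ C := (abs_nonneg _).trans (hC ω₀)
  set G : Ω → ℝ := fun ω => H ω * Real.exp (-(ξ ^ 2 / 2 * Z ω)) with hGdef
  have hGm : Measurable G := hH.mul ((hZ.const_mul _).neg.exp)
  have hGC : ∀ ω, |G ω| ≤ C := fun ω => by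
    rw [hGdef, abs_mul, abs_of_pos (Real.exp_pos _)]
    have : Real.exp (-(ξ ^ 2 / 2 * Z ω)) ≤ 1 :=
      Real.exp_le_one_iff.2 (neg_nonpos.2 (mul_nonneg (by positivity) (hZ0 ω)))
    calc |H ω| * Real.exp (-(ξ ^ 2 / 2 * Z ω)) ≤ |H ω| * 1 := by gcongr
      _ ≤ C := by simpa using hC ω
  have hGi : Integrable G P := Integrable.of_bound hGm.aestronglyMeasurable C (ae_of_all _ hGC)
  rw [Metric.tendsto_atTop']
  intro ε hε
  set b := 2 * Real.exp (ξ ^ 2 / 2 * (K + 1)) with hb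
  have hb0 : 0 < b := by positivity
  -- The factor `b` depends on `K` and `ξ` but not on `n` or `m`, so `m` can be fixed before `n`
  -- goes to infinity.
  have hlim := (tendsto_integral_abs_condExp_sub hGi hG).const_mul b
  rw [mul_zero] at hlim
  obtain ⟨m, hm⟩ := (hlim.eventually (gt_mem_nhds (half_pos hε))).exists
  set g : Ω → ℝ := fun ω => max (-C) (min C ((P[G | 𝓖 m]) ω)) with hg
  have hgm : StronglyMeasurable[𝓖 m] g :=
    (measurable_const.max (measurable_const.min
      (stronglyMeasurable_condExp.measurable))).stronglyMeasurable
  have hgC : ∀ ω, |g ω| ≤ C := fun ω =>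
    abs_le.2 ⟨le_max_left _ _, max_le (by linarith) (min_le_left _ _)⟩
  have hgG : ∫ ω, |g ω - G ω| ∂P ≤ ∫ ω, |(P[G | 𝓖 m]) ω - G ω| ∂P :=
    integral_mono_of_nonneg (ae_of_all _ fun _ => abs_nonneg _)
      ((integrable_condExp.sub hGi).abs) (ae_of_all _ fun ω => abs_clip_sub_le (hGC ω))
  have key := eventually_norm_integral_sub_le_of_tendstoInMeasure h hX hB hZ hZ0 hBZ m (hAm m) hM0
    hH hC hK hHK hgm hgC ξ (η := ε / 4) (by positivity)
  obtain ⟨N, hN⟩ := eventually_atTop.1 key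
  refine ⟨N, fun n hn => ?_⟩
  rw [dist_eq_norm]
  have h1 := hN n hn.le
  have h2 : b * ∫ ω, |g ω - G ω| ∂P ≤ b * ∫ ω, |(P[G | 𝓖 m]) ω - G ω| ∂P :=
    mul_le_mul_of_nonneg_left hgG hb0.le
  refine h1.trans_lt ?_
  linarith

omit [IsProbabilityMeasure P] in
/-- The limiting variance is measurable with respect to the limit of the filtration. -/
lemma aestronglyMeasurable_limit {M A : ℕ → ℝ≥0 → Ω → ℝ} {c : ℕ → ℝ}
    (h : ∀ n, ContinuousPair 𝓖 P (M n) (A n) (c n)) {B : ℕ → Ω → ℝ}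
    (hB : ∀ n, ∀ᵐ ω ∂P, Tendsto (fun k : ℕ => A n k ω) atTop (𝓝 (B n ω)))
    {Z : Ω → ℝ} (hBZ : TendstoInMeasure P B atTop Z) :
    AEStronglyMeasurable[⨆ t, (𝓖 t : MeasurableSpace Ω)] Z P := by
  obtain ⟨a, -, ha⟩ := hBZ.exists_seq_tendsto_ae
  refine aestronglyMeasurable_sub_of_tendsto_ae (fun n => ?_) ha
  refine aestronglyMeasurable_sub_of_tendsto_ae (fun k => ?_) (hB (a n))
  exact (((h (a n)).adapted k).mono (le_iSup (fun t => (𝓖 t : MeasurableSpace Ω)) _)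
    ).aestronglyMeasurable

/-- Convergence of the Fourier transforms for bounded real densities. -/
lemma tendsto_integral_real {M A : ℕ → ℝ≥0 → Ω → ℝ} {c : ℕ → ℝ}
    (h : ∀ n, ContinuousPair 𝓖 P (M n) (A n) (c n)) {X B : ℕ → Ω → ℝ}
    (hX : ∀ n, ∀ᵐ ω ∂P, Tendsto (fun k : ℕ => M n k ω) atTop (𝓝 (X n ω)))
    (hB : ∀ n, ∀ᵐ ω ∂P, Tendsto (fun k : ℕ => A n k ω) atTop (𝓝 (B n ω)))
    {Z : Ω → ℝ} (hZ : Measurable Z) (hZ0 : ∀ ω, 0 ≤ Z ω)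
    (hBZ : TendstoInMeasure P B atTop Z)
    (hAm : ∀ m : ℕ, TendstoInMeasure P (fun n ω => A n m ω) atTop (fun _ => 0))
    (hM0 : TendstoInMeasure P (fun n ω => M n 0 ω) atTop (fun _ => 0))
    {H : Ω → ℝ} (hH : Measurable[⨆ t, (𝓖 t : MeasurableSpace Ω)] H) {C : ℝ}
    (hC : ∀ ω, |H ω| ≤ C) (ξ : ℝ) :
    Tendsto (fun n => ∫ ω, (H ω : ℂ) * Complex.exp (Complex.I * ξ * X n ω) ∂P) atTop
      (𝓝 (∫ ω, (H ω : ℂ) * Complex.exp (-(ξ ^ 2 * Z ω / 2)) ∂P)) := by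
  obtain ⟨ω₀⟩ : Nonempty Ω := P.nonempty_of_neZero
  have hC0 : 0 ≤ C := (abs_nonneg _).trans (hC ω₀)
  have hle : (⨆ t, (𝓖 t : MeasurableSpace Ω)) ≤ mΩ := iSup_le 𝓖.le
  have hHm : Measurable H := hH.mono hle le_rfl
  have hZm := aestronglyMeasurable_limit h hB hBZ
  have hXm : ∀ n, AEMeasurable (X n) P := fun n =>
    aemeasurable_of_tendsto_metrizable_ae atTop
      (fun k : ℕ => ((((h n).martingale.1 k).mono (𝓖.le k)).measurable).aemeasurable) (hX n)
  have hunit : ∀ n ω, ‖Complex.exp (Complex.I * ξ * X n ω)‖ = 1 := fun n ω => by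
    have : Complex.I * ξ * X n ω = ((ξ * X n ω : ℝ) : ℂ) * Complex.I := by
      push_cast
      ring
    rw [this, Complex.norm_exp_ofReal_mul_I]
  have hcast : ∀ ω, Complex.exp (-(ξ ^ 2 * Z ω / 2))
      = ((Real.exp (-(ξ ^ 2 / 2 * Z ω)) : ℝ) : ℂ) := fun ω => by
    rw [Complex.ofReal_exp]
    congr 1
    push_cast
    ring
  have hexp1 : ∀ ω, Real.exp (-(ξ ^ 2 / 2 * Z ω)) ≤ 1 := fun ω =>
    Real.exp_le_one_iff.2 (neg_nonpos.2 (mul_nonneg (by positivity) (hZ0 ω)))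
  have hHZ : ∀ K : ℝ, Measurable ({ω | Z ω ≤ K}.indicator H) := fun K =>
    hHm.indicator (measurableSet_le hZ measurable_const)
  have hmeas1 : ∀ n (F : Ω → ℝ), Measurable F → AEStronglyMeasurable
      (fun ω => (F ω : ℂ) * Complex.exp (Complex.I * ξ * X n ω)) P := fun n F hF =>
    ((Complex.measurable_ofReal.comp hF).aemeasurable.mul
      (Complex.measurable_exp.comp_aemeasurable
      ((Complex.measurable_ofReal.comp_aemeasurable (hXm n)).const_mul _))).aestronglyMeasurable
  have hmeas2 : ∀ (F : Ω → ℝ), Measurable F → AEStronglyMeasurable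
      (fun ω => (F ω : ℂ) * Complex.exp (-(ξ ^ 2 * Z ω / 2))) P := fun F hF => by
    simp only [hcast]
    exact ((Complex.measurable_ofReal.comp hF).mul (Complex.measurable_ofReal.comp
      ((hZ.const_mul _).neg.exp))).aestronglyMeasurable
  have hind : ∀ (K : ℝ) ω, |{ω | Z ω ≤ K}.indicator H ω| ≤ C := fun K ω => by
    by_cases hω : ω ∈ {ω | Z ω ≤ K}
    · rw [Set.indicator_of_mem hω]
      exact hC ω
    · rw [Set.indicator_of_notMem hω]
      simpa using hC0
  have hkey : ∀ K : ℕ, Tendsto (fun n => ∫ ω, (({ω | Z ω ≤ K}.indicator H ω : ℝ) : ℂ)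
      * Complex.exp (Complex.I * ξ * X n ω) ∂P) atTop
      (𝓝 (∫ ω, (({ω | Z ω ≤ K}.indicator H ω : ℝ) : ℂ)
        * Complex.exp (-(ξ ^ 2 * Z ω / 2)) ∂P)) := by
    intro K
    have := tendsto_integral_of_vanishing h hX hB hZ hZ0 hBZ hAm hM0 (hHZ K) (hind K)
      (Nat.cast_nonneg K)
      (fun ω hω => Set.indicator_of_notMem (by simpa using hω) _) ξ (by
        -- The truncation event is defined through `Z`, which is `𝓕_∞`-measurable only up to null
        -- sets; a measurable version `Z'` supplies the representative.
        obtain ⟨Z', hZ', hZZ'⟩ := hZm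
        refine ⟨fun ω => {ω | Z' ω ≤ K}.indicator H ω * Real.exp (-(ξ ^ 2 / 2 * Z' ω)), ?_, ?_⟩
        · have hZ'm := hZ'.measurable
          exact ((hH.indicator (measurableSet_le hZ'm measurable_const)).mul
            (Real.measurable_exp.comp (hZ'm.const_mul (ξ ^ 2 / 2)).neg)).stronglyMeasurable
        · filter_upwards [hZZ'] with ω hω
          simp only [Set.indicator, Set.mem_ofPred_eq, hω])
    simpa only [hcast, Complex.ofReal_mul] using this
  have hnorm : ∀ K : ℝ, ∀ ω, ‖(H ω : ℂ) - (({ω | Z ω ≤ K}.indicator H ω : ℝ) : ℂ)‖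
      ≤ {ω | K < Z ω}.indicator (fun _ => C) ω := fun K ω => by
    by_cases hω : Z ω ≤ K
    · rw [Set.indicator_of_mem (by exact hω), Set.indicator_of_notMem (by simpa using hω)]
      simp
    · rw [Set.indicator_of_notMem (by exact hω), Set.indicator_of_mem (by simpa using hω)]
      simpa using hC ω
  have hclose : ∀ (K : ℝ) (Q : Ω → ℂ), (∀ ω, ‖Q ω‖ ≤ 1) →
      (∀ F : Ω → ℝ, Measurable F → AEStronglyMeasurable (fun ω => (F ω : ℂ) * Q ω) P) →
      ‖(∫ ω, (H ω : ℂ) * Q ω ∂P)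
        - ∫ ω, (({ω | Z ω ≤ K}.indicator H ω : ℝ) : ℂ) * Q ω ∂P‖
      ≤ ∫ ω, {ω | K < Z ω}.indicator (fun _ => C) ω ∂P := by
    intro K Q hQ hQm
    have hi : ∀ F : Ω → ℝ, Measurable F → (∀ ω, |F ω| ≤ C) →
        Integrable (fun ω => (F ω : ℂ) * Q ω) P := fun F hF hFC =>
      Integrable.of_bound (hQm F hF) C (ae_of_all _ fun ω => by
        rw [norm_mul, Complex.norm_real, Real.norm_eq_abs]
        calc |F ω| * ‖Q ω‖ ≤ C * 1 := mul_le_mul (hFC ω) (hQ ω) (norm_nonneg _) hC0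
          _ = C := mul_one C)
    rw [← integral_sub (hi H hHm hC) (hi _ (hHZ K) (hind K))]
    refine norm_integral_le_of_norm_le ((integrable_const C).indicator
      (measurableSet_lt measurable_const hZ)) (ae_of_all _ fun ω => ?_)
    rw [← sub_mul, norm_mul]
    calc _ ≤ ‖(H ω : ℂ) - (({ω | Z ω ≤ K}.indicator H ω : ℝ) : ℂ)‖ * 1 :=
          mul_le_mul_of_nonneg_left (hQ ω) (norm_nonneg _)
      _ ≤ _ := by
          rw [mul_one]
          exact hnorm K ω
  -- The truncation error is at most `C` times the probability of `Z > K`, uniformly in `n`.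
  have htail : Tendsto (fun K : ℕ => ∫ ω, {ω | (K : ℝ) < Z ω}.indicator (fun _ => C) ω ∂P) atTop
      (𝓝 0) := by
    have := tendsto_integral_of_dominated_convergence (μ := P)
      (F := fun (K : ℕ) ω => {ω | (K : ℝ) < Z ω}.indicator (fun _ => C) ω) (f := fun _ => (0 : ℝ))
      (fun _ => C)
      (fun K => ((measurable_const.indicator
        (measurableSet_lt measurable_const hZ))).aestronglyMeasurable)
      (integrable_const _)
      (fun K => ae_of_all _ fun ω => by
        rw [Set.indicator_apply]
        split_ifs
        · rw [Real.norm_eq_abs, abs_of_nonneg hC0]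
        · simpa using hC0)
      (ae_of_all _ fun ω => by
        refine tendsto_const_nhds.congr' ?_
        filter_upwards [eventually_ge_atTop ⌈Z ω⌉₊] with K hK
        rw [Set.indicator_of_notMem]
        simpa using Nat.ceil_le.1 hK)
    simpa using this
  rw [Metric.tendsto_atTop']
  intro ε hε
  obtain ⟨K, hKε⟩ := (htail.eventually (gt_mem_nhds (show 0 < ε / 3 by positivity))).exists
  obtain ⟨N, hN⟩ := Metric.tendsto_atTop'.1 (hkey K) (ε / 3) (by positivity)
  refine ⟨N, fun n hn => ?_⟩
  have h1 := hclose K (fun ω => Complex.exp (Complex.I * ξ * X n ω)) (fun ω => (hunit n ω).le)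
    (hmeas1 n)
  have h2 := hclose K (fun ω => Complex.exp (-(ξ ^ 2 * Z ω / 2)))
    (fun ω => by
      rw [hcast, Complex.norm_real, Real.norm_eq_abs, abs_of_pos (Real.exp_pos _)]
      exact hexp1 ω) hmeas2
  have h3 := hN n hn
  rw [← dist_eq_norm] at h1 h2
  rw [dist_comm] at h2
  have h4 := dist_triangle4 (∫ ω, (H ω : ℂ) * Complex.exp (Complex.I * ξ * X n ω) ∂P)
    (∫ ω, (({ω | Z ω ≤ K}.indicator H ω : ℝ) : ℂ) * Complex.exp (Complex.I * ξ * X n ω) ∂P)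
    (∫ ω, (({ω | Z ω ≤ K}.indicator H ω : ℝ) : ℂ) * Complex.exp (-(ξ ^ 2 * Z ω / 2)) ∂P)
    (∫ ω, (H ω : ℂ) * Complex.exp (-(ξ ^ 2 * Z ω / 2)) ∂P)
  linarith

end RandomVarianceCLT

/-! ### Fourier transforms with complex densities. -/

namespace RandomVarianceCLT

variable {Ω : Type*} {mΩ : MeasurableSpace Ω} {P : Measure Ω} [IsProbabilityMeasure P]

/-- Stable convergence of continuous martingales with a random limiting variance, in terms of
Fourier transforms. -/
theorem tendsto_integral_mul_exp {𝓕 : Filtration ℝ≥0 mΩ} {W : ℕ → Ω → ℝ}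
    (hW : ∀ n, Integrable (W n) P) (hW_meas : ∀ n, AEStronglyMeasurable[⨆ t, 𝓕 t] (W n) P)
    {M : ℕ → ℝ≥0 → Ω → ℝ} (hM : ∀ n t, M n t =ᵐ[P] P[W n | 𝓕 t])
    (hM_cont : ∀ n, ∀ᵐ ω ∂P, Continuous (fun t => M n t ω)) {A : ℕ → ℝ≥0 → Ω → ℝ}
    (hA : ∀ n, IsQuadraticVariation (M n) (A n) (completion 𝓕 P) P)
    {v : ℕ → ℝ} {Z : Ω → ℝ} (hZ : Measurable Z) (hZ_nonneg : ∀ ω, 0 ≤ Z ω)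
    (h_infty : TendstoInMeasure P (fun n ω => valueAtInfinity (A n) ω / v n ^ 2) atTop Z)
    (h_fixed : ∀ t : ℝ≥0, TendstoInMeasure P (fun n ω => A n t ω / v n ^ 2) atTop (fun _ => 0))
    (h_zero : TendstoInMeasure P (fun n ω => M n 0 ω / v n) atTop (fun _ => 0))
    {H : Ω → ℂ} (hH : Measurable[⨆ t, 𝓕 t] H) {C : ℝ} (hC : ∀ ω, ‖H ω‖ ≤ C) (ξ : ℝ) :
    Tendsto (fun n => ∫ ω, H ω * Complex.exp (Complex.I * ξ * (W n ω / v n)) ∂P) atTop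
      (𝓝 (∫ ω, H ω * Complex.exp (-(ξ ^ 2 * Z ω / 2)) ∂P)) := by
  choose M' A' c hpair hae hX using fun n =>
    exists_continuousPair (hW n) (hW_meas n) (hM n) (hM_cont n) (hA n) (v n)
  have hle : (⨆ t, (𝓕 t : MeasurableSpace Ω)) ≤ ⨆ t, (completion 𝓕 P t : MeasurableSpace Ω) :=
    iSup_mono fun t => le_completion 𝓕 P t
  have hB : ∀ n, ∀ᵐ ω ∂P, Tendsto (fun k : ℕ => A' n k ω) atTop
      (𝓝 (valueAtInfinity (A n) ω / v n ^ 2)) := by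
    intro n
    filter_upwards [hae n, (hpair n).ae_bddAbove] with ω h1 h2
    have h3 : valueAtInfinity (A n) ω / v n ^ 2 = ⨆ t, A' n t ω := by
      simp only [h1, div_eq_mul_inv]
      exact Real.iSup_mul_of_nonneg (by positivity) _
    rw [h3]
    -- Almost sure boundedness of the bracket makes the supremum a genuine limit rather than a
    -- default value.
    exact (tendsto_atTop_ciSup ((hpair n).mono ω) h2).comp tendsto_natCast_atTop_atTop
  have hAm : ∀ m : ℕ, TendstoInMeasure P (fun n ω => A' n m ω) atTop (fun _ => 0) := fun m =>
    (h_fixed m).congr_left fun n => (hae n).mono fun ω hω => (hω m).2.symm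
  have hM0 : TendstoInMeasure P (fun n ω => M' n 0 ω) atTop (fun _ => 0) :=
    h_zero.congr_left fun n => (hae n).mono fun ω hω => (hω 0).1.symm
  have hHle : Measurable[⨆ t, (completion 𝓕 P t : MeasurableSpace Ω)] H := hH.mono hle le_rfl
  have hHm : Measurable H := hH.mono (iSup_le 𝓕.le) le_rfl
  have hre := tendsto_integral_real hpair hX hB hZ hZ_nonneg h_infty hAm hM0
    (Complex.measurable_re.comp hHle)
    (fun ω => (Complex.abs_re_le_norm (H ω)).trans (hC ω)) ξ
  have him := tendsto_integral_real hpair hX hB hZ hZ_nonneg h_infty hAm hM0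
    (Complex.measurable_im.comp hHle)
    (fun ω => (Complex.abs_im_le_norm (H ω)).trans (hC ω)) ξ
  have hsplit : ∀ Q : Ω → ℂ, AEMeasurable Q P → (∀ ω, ‖Q ω‖ ≤ 1) →
      ∫ ω, H ω * Q ω ∂P = (∫ ω, ((H ω).re : ℂ) * Q ω ∂P)
        + Complex.I * ∫ ω, ((H ω).im : ℂ) * Q ω ∂P := by
    intro Q hQ hQ1
    have hQi : Integrable Q P := Integrable.of_bound hQ.aestronglyMeasurable 1 (ae_of_all _ hQ1)
    have i1 : Integrable (fun ω => ((H ω).re : ℂ) * Q ω) P :=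
      hQi.bdd_mul (c := C) (Complex.measurable_ofReal.comp
        (Complex.measurable_re.comp hHm)).aestronglyMeasurable (ae_of_all _ fun ω => by
          simpa using (Complex.abs_re_le_norm (H ω)).trans (hC ω))
    have i2 : Integrable (fun ω => ((H ω).im : ℂ) * Q ω) P :=
      hQi.bdd_mul (c := C) (Complex.measurable_ofReal.comp
        (Complex.measurable_im.comp hHm)).aestronglyMeasurable (ae_of_all _ fun ω => by
          simpa using (Complex.abs_im_le_norm (H ω)).trans (hC ω))
    rw [← integral_const_mul, ← integral_add i1 (i2.const_mul _)]
    refine integral_congr_ae (ae_of_all _ fun ω => ?_)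
    calc H ω * Q ω = ((H ω).re + (H ω).im * Complex.I) * Q ω := by rw [Complex.re_add_im]
      _ = _ := by ring
  have hlim := hre.add (him.const_mul Complex.I)
  have hcast : ∀ n ω, (((W n ω / v n : ℝ)) : ℂ) = W n ω / v n := fun n ω => by push_cast; rfl
  simp only [Function.comp_apply, hcast] at hlim
  rw [hsplit]
  · refine hlim.congr fun n => (hsplit _ ?_ fun ω => ?_).symm
    · refine Complex.measurable_exp.comp_aemeasurable (AEMeasurable.const_mul ?_ _)
      simp only [← hcast]
      exact Complex.measurable_ofReal.comp_aemeasurable ((hW n).1.aemeasurable.div_const _)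
    · have : Complex.I * ξ * (W n ω / v n) = ((ξ * (W n ω / v n) : ℝ) : ℂ) * Complex.I := by
        push_cast
        ring
      rw [this, Complex.norm_exp_ofReal_mul_I]
  · exact (Complex.measurable_exp.comp
      (((Complex.measurable_ofReal.comp hZ).const_mul _).div_const _).neg).aemeasurable
  · intro ω
    have : (-((ξ : ℂ) ^ 2 * Z ω / 2)) = ((-(ξ ^ 2 * Z ω / 2) : ℝ) : ℂ) := by push_cast; ring
    rw [this, ← Complex.ofReal_exp, Complex.norm_real, Real.norm_eq_abs,
      abs_of_pos (Real.exp_pos _), Real.exp_le_one_iff]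
    have := mul_nonneg (sq_nonneg ξ) (hZ_nonneg ω)
    linarith

end RandomVarianceCLT

/-! ### From Fourier transforms to convergence in law. -/

namespace RandomVarianceCLT

variable {Ω : Type*} {mΩ : MeasurableSpace Ω} {P : Measure Ω} [IsProbabilityMeasure P]

/-- The characteristic function of a centred Gaussian mixture. -/
lemma charFun_map_sqrt_mul {Z : Ω → ℝ} (hZ : Measurable Z) (hZ0 : ∀ ω, 0 ≤ Z ω) (ξ : ℝ) :
    charFun ((P.prod (gaussianReal 0 1)).map (fun p : Ω × ℝ => √(Z p.1) * p.2)) ξ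
      = ∫ ω, Complex.exp (-(ξ ^ 2 * Z ω / 2)) ∂P := by
  have hV : Measurable (fun p : Ω × ℝ => √(Z p.1) * p.2) :=
    ((hZ.comp measurable_fst).sqrt).mul measurable_snd
  have hexp : Measurable fun x : ℝ => Complex.exp (ξ * x * Complex.I) := by fun_prop
  rw [charFun_apply_real, integral_map hV.aemeasurable hexp.aestronglyMeasurable,
    integral_prod]
  · refine integral_congr_ae (ae_of_all _ fun ω => ?_)
    -- After Fubini, the inner integral is the Gaussian characteristic function at `ξ √Z`.
    have h := charFun_gaussianReal (μ := 0) (v := 1) (ξ * √(Z ω))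
    rw [charFun_apply_real] at h
    have h2 : ∀ x : ℝ, (ξ : ℂ) * ((√(Z ω) * x : ℝ) : ℂ) * Complex.I
        = ((ξ * √(Z ω) : ℝ) : ℂ) * x * Complex.I := fun x => by
      push_cast
      ring
    simp only [h2]
    rw [h]
    congr 1
    have h3 : ((√(Z ω) : ℝ) : ℂ) ^ 2 = (Z ω : ℂ) := by
      rw [← Complex.ofReal_pow, Real.sq_sqrt (hZ0 ω)]
    push_cast
    rw [mul_pow, h3]
    ring
  · refine Integrable.of_bound (hexp.comp hV).aestronglyMeasurable 1 (ae_of_all _ fun p => ?_)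
    rw [← Complex.ofReal_mul, Complex.norm_exp_ofReal_mul_I]

/-- Convergence in law on an event, from the convergence of the Fourier transforms on it. -/
lemma tendsto_measure_inter_preimage {X : ℕ → Ω → ℝ} (hX : ∀ n, AEMeasurable (X n) P)
    {Z : Ω → ℝ} (hZ : Measurable Z) (hZ0 : ∀ ω, 0 ≤ Z ω) {S : Set Ω} (hS : MeasurableSet S)
    (hlim : ∀ ξ : ℝ, Tendsto
      (fun n => ∫ ω, S.indicator (1 : Ω → ℂ) ω * Complex.exp (Complex.I * ξ * X n ω) ∂P) atTop
      (𝓝 (∫ ω, S.indicator (1 : Ω → ℂ) ω * Complex.exp (-(ξ ^ 2 * Z ω / 2)) ∂P)))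
    {J : Set ℝ} (hJ : MeasurableSet J)
    (hJ0 : (P.prod (gaussianReal 0 1)).map (fun p : Ω × ℝ => √(Z p.1) * p.2) (frontier J) = 0) :
    Tendsto (fun n => P (S ∩ X n ⁻¹' J)) atTop (𝓝 ((P.prod (gaussianReal 0 1))
      (S ×ˢ Set.univ ∩ (fun p : Ω × ℝ => √(Z p.1) * p.2) ⁻¹' J))) := by
  have hV : Measurable (fun p : Ω × ℝ => √(Z p.1) * p.2) :=
    ((hZ.comp measurable_fst).sqrt).mul measurable_snd
  by_cases hS0 : P S = 0
  · have h1 : ∀ n, P (S ∩ X n ⁻¹' J) = 0 := fun n => measure_mono_null Set.inter_subset_left hS0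
    have h2 : (P.prod (gaussianReal 0 1))
        (S ×ˢ Set.univ ∩ (fun p : Ω × ℝ => √(Z p.1) * p.2) ⁻¹' J) = 0 :=
      measure_mono_null Set.inter_subset_left (by rw [Measure.prod_prod, hS0, zero_mul])
    simp only [h1, h2]
    exact tendsto_const_nhds
  -- Conditioning on `S` turns the Fourier transforms weighted by its indicator into characteristic
  -- functions, so Lévy's continuity theorem applies.
  have hprob : IsProbabilityMeasure (P[|S]) := cond_isProbabilityMeasure hS0
  have hac : P[|S] ≪ P := cond_absolutelyContinuous
  have hX' : ∀ n, AEMeasurable (X n) (P[|S]) := fun n => (hX n).mono_ac hac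
  have hint : ∀ f : Ω → ℂ, ∫ ω, f ω ∂(P[|S])
      = ((P S)⁻¹.toReal : ℂ) * ∫ ω, S.indicator (1 : Ω → ℂ) ω * f ω ∂P := fun f => by
    rw [ProbabilityTheory.cond, integral_smul_measure, ← integral_indicator hS, Complex.real_smul]
    congr 2
    ext ω
    by_cases hω : ω ∈ S <;> simp [hω]
  let μ : ℕ → ProbabilityMeasure ℝ := fun n =>
    ⟨(P[|S]).map (X n), Measure.isProbabilityMeasure_map (hX' n)⟩
  let ν : ProbabilityMeasure ℝ := ⟨((P[|S]).prod (gaussianReal 0 1)).map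
    (fun p : Ω × ℝ => √(Z p.1) * p.2), Measure.isProbabilityMeasure_map hV.aemeasurable⟩
  have hμν : Tendsto μ atTop (𝓝 ν) := by
    rw [ProbabilityMeasure.tendsto_iff_tendsto_charFun]
    intro ξ
    have e1 : charFun (ν : Measure ℝ) ξ = ∫ ω, Complex.exp (-(ξ ^ 2 * Z ω / 2)) ∂(P[|S]) :=
      charFun_map_sqrt_mul hZ hZ0 ξ
    have e2 : ∀ n, charFun (μ n : Measure ℝ) ξ
        = ∫ ω, Complex.exp (Complex.I * ξ * X n ω) ∂(P[|S]) := fun n => by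
      have hexp : Measurable fun x : ℝ => Complex.exp (ξ * x * Complex.I) := by fun_prop
      change charFun ((P[|S]).map (X n)) ξ = _
      rw [charFun_apply_real, integral_map (hX' n) hexp.aestronglyMeasurable]
      refine integral_congr_ae (ae_of_all _ fun ω => ?_)
      change Complex.exp (ξ * X n ω * Complex.I) = Complex.exp (Complex.I * ξ * X n ω)
      rw [mul_comm, ← mul_assoc]
    simp only [e1, e2, hint]
    exact (hlim ξ).const_mul _
  have hac2 : (P[|S]).prod (gaussianReal 0 1) ≪ P.prod (gaussianReal 0 1) :=
    hac.prod Measure.AbsolutelyContinuous.rfl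
  -- The frontier of `J` is null for the unconditioned limit, hence for the conditioned one by
  -- absolute continuity: the same `J` serves every `S`.
  have key := ProbabilityMeasure.tendsto_measure_of_null_frontier_of_tendsto' hμν (E := J)
    (hac2.map hV hJ0)
  have m1 : ∀ n, P (S ∩ X n ⁻¹' J) = P S * (μ n : Measure ℝ) J := fun n => by
    change _ = P S * (P[|S]).map (X n) J
    rw [Measure.map_apply_of_aemeasurable (hX' n) hJ, cond_apply hS, ← mul_assoc,
      ENNReal.mul_inv_cancel hS0 (measure_ne_top P S), one_mul]
  have m2 : (P.prod (gaussianReal 0 1))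
      (S ×ˢ Set.univ ∩ (fun p : Ω × ℝ => √(Z p.1) * p.2) ⁻¹' J) = P S * (ν : Measure ℝ) J := by
    change _ = P S * ((P[|S]).prod (gaussianReal 0 1)).map (fun p : Ω × ℝ => √(Z p.1) * p.2) J
    rw [Measure.map_apply hV hJ, ProbabilityTheory.cond, Measure.prod_smul_left, Measure.smul_apply, smul_eq_mul,
      ← mul_assoc, ENNReal.mul_inv_cancel hS0 (measure_ne_top P S), one_mul,
      ← Measure.restrict_univ (μ := gaussianReal 0 1), Measure.prod_restrict,
      Measure.restrict_apply (hV hJ), Measure.restrict_univ, Set.inter_comm]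
  simp only [m1, m2]
  exact ENNReal.Tendsto.const_mul key (Or.inr (measure_ne_top P S))

/-- Joint convergence in law with a random variable, from the convergence of the Fourier
transforms on the events that it generates. -/
theorem tendstoInDistribution_prodMk {X : ℕ → Ω → ℝ} (hX : ∀ n, AEMeasurable (X n) P)
    {Z : Ω → ℝ} (hZ : Measurable Z) (hZ0 : ∀ ω, 0 ≤ Z ω) {E : Type*} [TopologicalSpace E]
    [PolishSpace E] [MeasurableSpace E] [BorelSpace E] {Y : Ω → E} (hY : Measurable Y)
    (hlim : ∀ B : Set E, MeasurableSet B → ∀ ξ : ℝ, Tendsto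
      (fun n => ∫ ω, (Y ⁻¹' B).indicator (1 : Ω → ℂ) ω * Complex.exp (Complex.I * ξ * X n ω) ∂P)
      atTop
      (𝓝 (∫ ω, (Y ⁻¹' B).indicator (1 : Ω → ℂ) ω * Complex.exp (-(ξ ^ 2 * Z ω / 2)) ∂P))) :
    TendstoInDistribution (fun n ω => (Y ω, X n ω)) atTop
      (fun p : Ω × ℝ => (Y p.1, √(Z p.1) * p.2)) (fun _ => P) (P.prod (gaussianReal 0 1)) := by
  have hV : Measurable (fun p : Ω × ℝ => √(Z p.1) * p.2) :=
    ((hZ.comp measurable_fst).sqrt).mul measurable_snd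
  have hYV : Measurable (fun p : Ω × ℝ => (Y p.1, √(Z p.1) * p.2)) :=
    (hY.comp measurable_fst).prodMk hV
  have hYX : ∀ n, AEMeasurable (fun ω => (Y ω, X n ω)) P := fun n => hY.aemeasurable.prodMk (hX n)
  refine ⟨hYX, hYV.aemeasurable, ?_⟩
  set ρ := (P.prod (gaussianReal 0 1)).map (fun p : Ω × ℝ => √(Z p.1) * p.2) with hρ
  -- `B` may be any Borel set because `Y` does not vary with `n`; only `J` has to be a continuity
  -- set.
  refine IsPiSystem.tendsto_probabilityMeasure_of_tendsto_of_mem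
    (S := {s | ∃ (B : Set E) (J : Set ℝ), MeasurableSet B ∧ MeasurableSet J ∧
      ρ (frontier J) = 0 ∧ s = B ×ˢ J}) ?_ ?_ ?_ ?_
  · rintro _ ⟨B, J, hB, hJ, hJ0, rfl⟩ _ ⟨B', J', hB', hJ', hJ0', rfl⟩ -
    refine ⟨B ∩ B', J ∩ J', hB.inter hB', hJ.inter hJ', ?_, Set.prod_inter_prod⟩
    refine measure_mono_null (frontier_inter_subset J J') (measure_union_null ?_ ?_)
    · exact measure_mono_null Set.inter_subset_left hJ0
    · exact measure_mono_null Set.inter_subset_right hJ0'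
  · rintro _ ⟨B, J, hB, hJ, -, rfl⟩
    exact hB.prod hJ
  · rintro u hu ⟨y, x⟩ hyx
    obtain ⟨B, I, hB, hI, hyB, hxI, hBI⟩ := isOpen_prod_iff.1 hu y x hyx
    obtain ⟨δ, hδ, hδI⟩ := Metric.isOpen_iff.1 hI x hxI
    -- Arbitrarily small balls have null frontier, so the rectangles contain a neighbourhood basis
    -- at every point.
    obtain ⟨r, ⟨hr0, hrδ⟩, hr⟩ := exists_null_frontier_thickening ρ {x} hδ
    rw [Metric.thickening_singleton] at hr
    refine ⟨B ×ˢ Metric.ball x r, ⟨B, _, hB.measurableSet, measurableSet_ball, hr, rfl⟩,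
      prod_mem_nhds (hB.mem_nhds hyB) (Metric.ball_mem_nhds x hr0),
      (Set.prod_mono_right ((Metric.ball_subset_ball hrδ.le).trans hδI)).trans hBI⟩
  · rintro _ ⟨B, J, hB, hJ, hJ0, rfl⟩
    have key := tendsto_measure_inter_preimage hX hZ hZ0 (hY hB) (hlim B hB) hJ hJ0
    have e1 : ∀ n, P.map (fun ω => (Y ω, X n ω)) (B ×ˢ J) = P (Y ⁻¹' B ∩ X n ⁻¹' J) := fun n => by
      rw [Measure.map_apply_of_aemeasurable (hYX n) (hB.prod hJ), Set.mk_preimage_prod]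
    have e2 : (P.prod (gaussianReal 0 1)).map (fun p : Ω × ℝ => (Y p.1, √(Z p.1) * p.2)) (B ×ˢ J)
        = (P.prod (gaussianReal 0 1))
          ((Y ⁻¹' B) ×ˢ Set.univ ∩ (fun p : Ω × ℝ => √(Z p.1) * p.2) ⁻¹' J) := by
      rw [Measure.map_apply hYV (hB.prod hJ)]
      congr 1
      ext p
      simp
    simp only [← e1, ← e2] at key
    exact (ENNReal.tendsto_toNNReal (e2 ▸ measure_ne_top _ _)).comp key

end RandomVarianceCLT

theorem theorem3p4 {Ω : Type u} {mΩ : MeasurableSpace Ω}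
    (P : Measure Ω) [IsProbabilityMeasure P]
    (𝓕 : Filtration ℝ≥0 mΩ)
    -- the random variables `W n ∈ L¹`, measurable (up to null sets) with respect to `𝓕_∞`
    (W : ℕ → Ω → ℝ)
    (hW : ∀ n, Integrable (W n) P)
    (hW_meas : ∀ n, AEStronglyMeasurable[⨆ t, 𝓕 t] (W n) P)
    -- `M n` is a continuous modification of the martingale `E[W n | 𝓕 t]`
    (M : ℕ → ℝ≥0 → Ω → ℝ)
    (hM : ∀ n t, M n t =ᵐ[P] P[W n | 𝓕 t])
    (hM_cont : ∀ n, ∀ᵐ ω ∂P, Continuous (fun t => M n t ω))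
    -- `A n` is the quadratic variation of `M n`
    (A : ℕ → ℝ≥0 → Ω → ℝ)
    (hA : ∀ n, RandomVarianceCLT.IsQuadraticVariation (M n) (A n)
      (RandomVarianceCLT.completion 𝓕 P) P)
    -- the normalization and the random variance
    (v : ℕ → ℝ) (hv : ∀ n, v n ≠ 0)
    (Z : Ω → ℝ) (hZ : Measurable Z) (hZ_nonneg : ∀ ω, 0 ≤ Z ω)
    -- the three convergences in probability
    (h_infty : TendstoInMeasure P
      (fun n ω => RandomVarianceCLT.valueAtInfinity (A n) ω / v n ^ 2) atTop Z)
    (h_fixed : ∀ t : ℝ≥0, TendstoInMeasure P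
      (fun n ω => A n t ω / v n ^ 2) atTop (fun _ => 0))
    (h_zero : TendstoInMeasure P (fun n ω => M n 0 ω / v n) atTop (fun _ => 0)) :
    (∀ H : Ω → ℂ, Measurable[⨆ t, 𝓕 t] H → (∃ C : ℝ, ∀ ω, ‖H ω‖ ≤ C) → ∀ ξ : ℝ,
      Tendsto (fun n => ∫ ω, H ω * Complex.exp (Complex.I * ξ * (W n ω / v n)) ∂P) atTop
        (𝓝 (∫ ω, H ω * Complex.exp (-(ξ ^ 2 * Z ω / 2)) ∂P))) ∧
    -- joint convergence in law of `(Y, W n / v n)` to `(Y, √Z 𝒩)`; the second factor of `Ω × ℝ`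
    -- carries the standard Gaussian `𝒩`, independent of `(Y, Z)`
    (∀ (E : Type w) [TopologicalSpace E] [PolishSpace E] [MeasurableSpace E] [BorelSpace E]
      (Y : Ω → E), Measurable[⨆ t, 𝓕 t] Y →
      TendstoInDistribution (fun n ω => (Y ω, W n ω / v n)) atTop
        (fun p : Ω × ℝ => (Y p.1, √(Z p.1) * p.2))
        (fun _ => P) (P.prod (gaussianReal 0 1))) := by
  have hfourier : ∀ H : Ω → ℂ, Measurable[⨆ t, 𝓕 t] H → (∃ C : ℝ, ∀ ω, ‖H ω‖ ≤ C) → ∀ ξ : ℝ,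
      Tendsto (fun n => ∫ ω, H ω * Complex.exp (Complex.I * ξ * (W n ω / v n)) ∂P) atTop
        (𝓝 (∫ ω, H ω * Complex.exp (-(ξ ^ 2 * Z ω / 2)) ∂P)) := fun H hH ⟨C, hC⟩ ξ =>
    RandomVarianceCLT.tendsto_integral_mul_exp hW hW_meas hM hM_cont hA hZ hZ_nonneg h_infty
      h_fixed h_zero hH hC ξ
  refine ⟨hfourier, fun E _ _ _ _ Y hY => ?_⟩
  refine RandomVarianceCLT.tendstoInDistribution_prodMk
    (fun n => (hW n).1.aemeasurable.div_const (v n)) hZ hZ_nonneg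
    (hY.mono (iSup_le 𝓕.le) le_rfl) fun B hB ξ => ?_
  have h := hfourier ((Y ⁻¹' B).indicator 1) (measurable_const.indicator (hY hB))
    ⟨1, fun ω => by by_cases hω : ω ∈ Y ⁻¹' B <;> simp [hω]⟩ ξ
  simpa only [Complex.ofReal_div] using h
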